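/- **Setting.** Let $\mathcal A\subset\mathbb R^d$ be a finite set of arms with $\|x\|_2\le 1$ for all $x\in\mathcal A$, let $\tilde x\in\mathcal A$, $\tilde x\neq 0$, be the target arm, assume that $\mathcal A$ has another arm, and let $\theta^*\in\mathbb R^d$ with $\|\theta^*\|_2\le1$ be the parameter of the environment. In round $t$ an arm $x_t$ is pulled and the true reward is $r_t=x_t^{\mathsf T}\theta^*+\eta_t$; an adversary replaces it by $\tilde r_t$. The noise $\eta_t$, and the noise $\tilde\eta_t$ that the adversary injects, are each conditionally $R$-sub-Gaussian given the past (including $x_t$), $R>0$. The cost of the attack is $\sum_{t\le T}|\tilde r_t-r_t|$. *Index.* For $v$ parallel to $\tilde x$ let $\epsilon(v)$ be the optimal value of $$\max_{\epsilon,\,w}\ \epsilon\quad\text{s.t. } \tilde x^{\mathsf T}v\ge\epsilon+x^{\mathsf T}(v+w)\ \ \forall x\in\mathcal A\setminus\{\tilde x\},\qquad \tilde x^{\mathsf T}w=0,\qquad\|v+w\|_2\le1 .$$ With $\theta^*_\parallel$ the orthogonal projection of $\theta^*$ onto $\mathbb R\tilde x$, the attackability index is $\epsilon^*=\epsilon(\theta^*_\parallel)$;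 the environment is attackable if $\epsilon^*>0$. *Victim.* LinUCB with parameters $\lambda>0$ and $\delta\in(0,1)$: after $t$ rounds, with $A_t=\lambda I+\sum_{s\le t}x_sx_s^{\mathsf T}$, $\hat\theta_t=A_t^{-1}\sum_{s\le t}\tilde r_sx_s$ and $\alpha_t=R\sqrt{d\log\frac{1+t/\lambda}{\delta}}+\sqrt\lambda$, it pulls an arm maximizing $x^{\mathsf T}\hat\theta_t+\alpha_t\|x\|_{A_t^{-1}}$ (ties broken arbitrarily). *Two-stage Null Space Attack with first stage of length $T_1\le T$.* It uses only $\mathcal A,\tilde x$, the pulled arms, the true rewards received so far and its own noise, not $\theta^*$. 1. Let $\epsilon_0^*$ be the maximum of $\epsilon$ such that some $\theta_0$ with $\|\theta_0\|_2\le 1$ satisfies $\tilde x^{\mathsf T}\theta_0\ge\epsilon+x^{\mathsf T}\theta_0$ for all $x\in\mathcal A\setminus\{\tilde x\}$. If $\epsilon_0^*\le0$, assert "not attackable" and do not attack. Otherwise fix a maximizer $\theta_0$ and set $\tilde r_t=x_t^{\mathsf T}\theta_0+\tilde\eta_t$ for $t\le T_1$. 2. Let $n$ be the number of pulls of $\tilde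 x$ in rounds $t\le T_1$, and $\tilde\theta_\parallel=\frac{\sum_{t\le T_1,\,x_t=\tilde x}r_t}{n\|\tilde x\|_2^2}\tilde x$ ($=0$ if $n=0$). Assert "attackable" if the program for $\epsilon(\tilde\theta_\parallel)$ is feasible with positive value; then let $\tilde\theta_\perp$ be an optimal $w$ and $\tilde\theta=\tilde\theta_\parallel+\tilde\theta_\perp$. Otherwise assert "not attackable" and stop attacking. 3. After "attackable": at the first pull of $\tilde x$ after round $T_1$, compensate by $\tilde r_t=r_t+n\,\tilde x^{\mathsf T}(\tilde\theta-\theta_0)$; until that pull, other arms still receive $\tilde r_t=x_t^{\mathsf T}\theta_0+\tilde\eta_t$; afterwards $\tilde r_t=r_t$ if $x_t=\tilde x$ and $\tilde r_t=x_t^{\mathsf T}\tilde\theta+\tilde\eta_t$ if $x_t\ne\tilde x$. **Theorem.** There are constants $C>0$ and $p\in\mathbb N$ depending only on $R$ and $\lambda$ such that for all $d,\mathcal A,\tilde x,\theta^*,\delta$ as above there is $T_0$ (depending on these, $R$ and $\lambda$, but not on the probability space, the noise, or the tie-breaking) such that the following holds. Write $$B(T_1,T)=\frac{d}{\epsilon^*}\Big(\sqrt{\log\tfrac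 T\delta}+\sqrt{T_1}\log\tfrac{T_1}\delta+\frac{\sqrt{T\log(1/\delta)}}{\sqrt{T_1}}\Big)\sqrt{T\log\tfrac T\delta}.$$ * If $\epsilon^*<0$ and $T\ge T_1\ge T_0$, the attack asserts "not attackable" with probability at least $1-\delta$. * If $\epsilon^*>0$, $\|\theta^*_\parallel\|_2<1$ and $T\ge T_1\ge T_0$, then it asserts "attackable" with probability at least $1-\delta$; with probability at least $1-3\delta$ LinUCB pulls non-target arms at most $C\,B(T_1,T)$ times in $T$ rounds; and with probability at least $1-4\delta$ the total cost is at most $C\,(T_1+B(T_1,T))$. * If $\epsilon^*>0$, $\|\theta^*_\parallel\|_2<1$, $T_1=\lceil T^{1/2}\rceil$ and $T\ge T_0$, then the number of non-target pulls (with probability at least $1-3\delta$) and the total cost (with probability at least $1-4\delta$) are at most $C\,\frac{d}{\epsilon^*}\,T^{3/4}(\log T)^p$, that is, $\tilde O(T^{3/4})$. -/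

import Mathlib

open MeasureTheory

noncomputable section

namespace LinBandit

/-- `d`-dimensional Euclidean space, where contexts and parameters live. -/
abbrev Vec (d : ℕ) := EuclideanSpace ℝ (Fin d)

/-- A finite set of arms (context vectors in the unit ball) with a nonzero target arm and at
least one non-target arm. -/
structure ArmSet (d : ℕ) where
  arms : Finset (Vec d)
  target : Vec d
  target_mem : target ∈ arms
  target_ne_zero : target ≠ 0
  exists_other : ∃ x ∈ arms, x ≠ target
  norm_le_one : ∀ x ∈ arms, ‖x‖ ≤ 1

variable {d : ℕ}

/-! ### The attackability index -/

/-- The orthogonal projection of `v` onto the line spanned by the target arm. -/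
def parPart (S : ArmSet d) (v : Vec d) : Vec d :=
  (inner ℝ S.target v / ‖S.target‖ ^ 2) • S.target

/-- `(ε, w)` is feasible for the quadratically constrained program with parallel component `v`:
maximize `ε` subject to `⟪x̃, v⟫ ≥ ε + ⟪x, v + w⟫` for all arms `x ≠ x̃`, `⟪x̃, w⟫ = 0` and
`‖v + w‖ ≤ 1`. -/
def CQPFeasible (S : ArmSet d) (v : Vec d) (ε : ℝ) (w : Vec d) : Prop :=
  (∀ x ∈ S.arms, x ≠ S.target → ε + inner ℝ x (v + w) ≤ inner ℝ S.target v) ∧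
    inner ℝ S.target w = 0 ∧ ‖v + w‖ ≤ 1

/-- Optimal value of the program with parallel component `v`.  The objective is bounded above, as
there is a non-target arm; if the program is infeasible (`‖v‖ > 1`) the value is `0`, so that it is
not positive. -/
def index (S : ArmSet d) (v : Vec d) : ℝ :=
  sSup {ε : ℝ | ∃ w, CQPFeasible S v ε w}

/-- The attackability index `ε*` of the environment with parameter `θ`. -/
def attackIndex (S : ArmSet d) (θ : Vec d) : ℝ := index S (parPart S θ)

/-- `solve` returns an optimal solution of the program whenever its value is positive. -/
def IsCQPSolver (S : ArmSet d) (solve : Vec d → Vec d) : Prop :=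
  ∀ v, 0 < index S v → CQPFeasible S v (index S v) (solve v)

/-- `θ₀` is in the unit ball and makes the target arm better than every other arm by `ε`. -/
def InitFeasible (S : ArmSet d) (ε : ℝ) (θ₀ : Vec d) : Prop :=
  (∀ x ∈ S.arms, x ≠ S.target → ε + inner ℝ x θ₀ ≤ inner ℝ S.target θ₀) ∧ ‖θ₀‖ ≤ 1

/-- The largest gap `ε₀*` by which a parameter of the unit ball can favour the target arm. -/
def initIndex (S : ArmSet d) : ℝ := sSup {ε : ℝ | ∃ θ₀, InitFeasible S ε θ₀}

/-! ### The attack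

Rounds are numbered from `0`.  `a t` is the arm pulled at round `t`, `r t` its true reward and
`ν t` the noise that the adversary draws at round `t`.  The true parameter is not an argument
of any definition in this section. -/

open Classical in
/-- Number of pulls of the target arm in the rounds before `t`. -/
def targetCount (S : ArmSet d) (a : ℕ → Vec d) (t : ℕ) : ℕ :=
  ((Finset.range t).filter (fun s => a s = S.target)).card

open Classical in
/-- The estimate of the parallel component from the true rewards of the target arm in the first
`T₁` rounds. -/
def estPar (S : ArmSet d) (T₁ : ℕ) (a : ℕ → Vec d) (r : ℕ → ℝ) : Vec d :=
  ((∑ s ∈ (Finset.range T₁).filter (fun s => a s = S.target), r s) /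
    ((targetCount S a T₁ : ℝ) * ‖S.target‖ ^ 2)) • S.target

/-- The adversary's verdict "attackable". -/
def Asserts (S : ArmSet d) (T₁ : ℕ) (a : ℕ → Vec d) (r : ℕ → ℝ) : Prop :=
  0 < initIndex S ∧ 0 < index S (estPar S T₁ a r)

/-- The parameter `θ̃` imitated in the second stage. -/
def attackParam (S : ArmSet d) (solve : Vec d → Vec d) (T₁ : ℕ) (a : ℕ → Vec d) (r : ℕ → ℝ) :
    Vec d :=
  estPar S T₁ a r + solve (estPar S T₁ a r)

/-- The target arm has been pulled at some round `s` with `T₁ ≤ s < t`. -/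
def Switched (S : ArmSet d) (T₁ : ℕ) (a : ℕ → Vec d) (t : ℕ) : Prop :=
  ∃ s, T₁ ≤ s ∧ s < t ∧ a s = S.target

open Classical in
/-- The reward that the adversary reports at round `t`.

* If `ε₀* ≤ 0` nothing is attacked.
* In the first `T₁` rounds all rewards are replaced by rewards generated by `θ₀`.
* After a negative verdict nothing is attacked any more.
* After a positive verdict the first pull of the target arm compensates for the rewards reported
  for this arm in the first stage; until then other arms are treated as in the first stage; from
  then on rewards of the target arm are left alone and rewards of other arms are replaced by
  rewards generated by `θ̃`. -/
def attackedReward (S : ArmSet d) (θ₀ : Vec d) (solve : Vec d → Vec d) (T₁ : ℕ)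
    (a : ℕ → Vec d) (r ν : ℕ → ℝ) (t : ℕ) : ℝ :=
  if initIndex S ≤ 0 then r t
  else if t < T₁ then inner ℝ (a t) θ₀ + ν t
  else if ¬ Asserts S T₁ a r then r t
  else if a t = S.target then
    if Switched S T₁ a t then r t
    else r t + (targetCount S a T₁ : ℝ) * inner ℝ S.target (attackParam S solve T₁ a r - θ₀)
  else if Switched S T₁ a t then inner ℝ (a t) (attackParam S solve T₁ a r) + ν t
  else inner ℝ (a t) θ₀ + ν t

/-- Total cost of an attack over `T` rounds; `r` are the true and `r'` the reported rewards. -/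
def attackCost (T : ℕ) (r r' : ℕ → ℝ) : ℝ := ∑ t ∈ Finset.range T, |r' t - r t|

open Classical in
/-- Number of pulls of non-target arms in `T` rounds. -/
def nonTargetCount (S : ArmSet d) (a : ℕ → Vec d) (T : ℕ) : ℕ :=
  ((Finset.range T).filter (fun s => a s ≠ S.target)).card

/-! ### LinUCB -/

/-- The regularized design matrix `λ I + ∑_{s < t} x_s x_sᵀ`. -/
def designMatrix (lam : ℝ) (a : ℕ → Vec d) (t : ℕ) : Matrix (Fin d) (Fin d) ℝ :=
  lam • (1 : Matrix (Fin d) (Fin d) ℝ) +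
    ∑ s ∈ Finset.range t, Matrix.vecMulVec (a s).ofLp (a s).ofLp

/-- The ridge regression estimate from the observations `(a s, y s)`, `s < t`. -/
def ridge (lam : ℝ) (a : ℕ → Vec d) (y : ℕ → ℝ) (t : ℕ) : Vec d :=
  WithLp.toLp 2
    (Matrix.mulVec (designMatrix lam a t)⁻¹ (∑ s ∈ Finset.range t, y s • (a s).ofLp))

/-- The norm `‖x‖_{A_t⁻¹}`. -/
def invNorm (lam : ℝ) (a : ℕ → Vec d) (t : ℕ) (x : Vec d) : ℝ :=
  Real.sqrt (dotProduct x.ofLp (Matrix.mulVec (designMatrix lam a t)⁻¹ x.ofLp))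

/-- The confidence radius `α_t`. -/
def confRadius (d : ℕ) (R lam δ : ℝ) (t : ℕ) : ℝ :=
  R * Real.sqrt (d * Real.log ((1 + t / lam) / δ)) + Real.sqrt lam

/-- The upper confidence bound of arm `x` after the observations `(a s, y s)`, `s < t`. -/
def ucb (R lam δ : ℝ) (a : ℕ → Vec d) (y : ℕ → ℝ) (t : ℕ) (x : Vec d) : ℝ :=
  inner ℝ x (ridge lam a y t) + confRadius d R lam δ t * invNorm lam a t x

/-- The arms `a` are those of LinUCB in `T` rounds with observed rewards `y`, ties being broken
arbitrarily. -/
def IsLinUCB (S : ArmSet d) (R lam δ : ℝ) (T : ℕ) (a : ℕ → Vec d) (y : ℕ → ℝ) : Prop :=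
  ∀ t < T, a t ∈ S.arms ∧ ∀ x ∈ S.arms, ucb R lam δ a y t x ≤ ucb R lam δ a y t (a t)

/-! ### The interaction -/

/-- `X` is conditionally `R`-sub-Gaussian given `m`. -/
def CondSubGaussian {Ω : Type*} {m0 : MeasurableSpace Ω} (μ : Measure Ω) (m : MeasurableSpace Ω)
    (R : ℝ) (X : Ω → ℝ) : Prop :=
  ∀ c : ℝ, Integrable (fun ω => Real.exp (c * X ω)) μ ∧
    μ[fun ω => Real.exp (c * X ω) | m] ≤ᵐ[μ] fun _ => Real.exp (c ^ 2 * R ^ 2 / 2)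

/-- The true reward of round `t` in the environment with parameter `θ` and noise `η`. -/
def trueReward (θ : Vec d) (a : ℕ → Vec d) (η : ℕ → ℝ) (t : ℕ) : ℝ := inner ℝ (a t) θ + η t

/-- The reported rewards when the attack is run in the environment with parameter `θ`. -/
def reported (S : ArmSet d) (θ θ₀ : Vec d) (solve : Vec d → Vec d) (T₁ : ℕ)
    (a : ℕ → Vec d) (η ν : ℕ → ℝ) : ℕ → ℝ :=
  attackedReward S θ₀ solve T₁ a (trueReward θ a η) ν

/-- A run of `T` rounds of LinUCB in the environment with parameter `θ` under the attack whose
first stage has length `T₁`.  `ℱ t` is the information available once the arm of round `t` is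
chosen and before its reward is drawn; `η` is the noise of the environment, `ν` that of the
adversary. -/
structure IsAttackedRun (S : ArmSet d) (θ : Vec d) (R lam δ : ℝ) (T₁ T : ℕ) {Ω : Type*}
    {m0 : MeasurableSpace Ω} (μ : Measure Ω) (ℱ : Filtration ℕ m0) (θ₀ : Vec d)
    (solve : Vec d → Vec d) (a : ℕ → Ω → Vec d) (η ν : ℕ → Ω → ℝ) : Prop where
  /-- `θ₀` is an optimal initial parameter. -/
  init : InitFeasible S (initIndex S) θ₀
  solver : IsCQPSolver S solve
  arm_meas : ∀ t < T, StronglyMeasurable[ℱ t] (a t)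
  noise_meas : ∀ t < T, StronglyMeasurable[ℱ (t + 1)] (η t)
  advNoise_meas : ∀ t < T, StronglyMeasurable[ℱ (t + 1)] (ν t)
  noise_subG : ∀ t < T, CondSubGaussian μ (ℱ t) R (η t)
  advNoise_subG : ∀ t < T, CondSubGaussian μ (ℱ t) R (ν t)
  linUCB : ∀ ω, IsLinUCB S R lam δ T (fun t => a t ω)
    (reported S θ θ₀ solve T₁ (fun t => a t ω) (fun t => η t ω) (fun t => ν t ω))

/-- The verdict "attackable" in outcome `ω`. -/
def VerdictAttackable (S : ArmSet d) (θ : Vec d) (T₁ : ℕ) {Ω : Type*}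
    (a : ℕ → Ω → Vec d) (η : ℕ → Ω → ℝ) (ω : Ω) : Prop :=
  Asserts S T₁ (fun t => a t ω) (trueReward θ (fun t => a t ω) (fun t => η t ω))

/-- Number of non-target pulls in outcome `ω`. -/
def runPulls (S : ArmSet d) (T : ℕ) {Ω : Type*} (a : ℕ → Ω → Vec d) (ω : Ω) : ℝ :=
  nonTargetCount S (fun t => a t ω) T

/-- Total cost of the attack in outcome `ω`. -/
def runCost (S : ArmSet d) (θ θ₀ : Vec d) (solve : Vec d → Vec d) (T₁ T : ℕ) {Ω : Type*}
    (a : ℕ → Ω → Vec d) (η ν : ℕ → Ω → ℝ) (ω : Ω) : ℝ :=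
  attackCost T (trueReward θ (fun t => a t ω) (fun t => η t ω))
    (reported S θ θ₀ solve T₁ (fun t => a t ω) (fun t => η t ω) (fun t => ν t ω))

/-- The rate
`d (√log(T/δ) + √T₁ log(T₁/δ) + √(T log(1/δ)) / √T₁) √(T log(T/δ)) / ε`. -/
def pullRate (d : ℕ) (ε δ : ℝ) (T₁ T : ℕ) : ℝ :=
  d * (Real.sqrt (Real.log (T / δ)) + Real.sqrt T₁ * Real.log (T₁ / δ)
    + Real.sqrt (T * Real.log (1 / δ)) / Real.sqrt T₁) * Real.sqrt (T * Real.log (T / δ)) / ε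

end LinBandit

end

/-! ### Quadratic forms of inverse matrices and the design matrix. -/

noncomputable section

namespace LinBandit

open Matrix

section QuadraticForms

variable {n : Type*} [Fintype n] [DecidableEq n]

/-! The argument is deterministic on a good outcome (`GoodOutcome`): the noise in the reported
rewards obeys a self-normalized bound in every round, and the environment's noise on the target arm
over the first stage is O(√T₁). This fails with probability at most δ/2.

In the first stage LinUCB sees a linear environment θ₀ in which the target wins by ε₀*, so it pulls
other arms polylogarithmically often, in particular at most c√τ times for any prescribed c > 0
(`exists_nonTargetCount_le_sqrt`). LinUCB's bonus may be too small for the failure probability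
needed here. But then log det is within a constant of its largest possible value, so the design
matrix is nearly isotropic, every arm has norm O(1/√t), and the shortfall is negligible
(`exists_noiseRadius_sub_le`).

Hence the target is pulled at least T₁/2 times, and its average reward locates the parallel
component within O(1/√T₁). On the target's line the index is continuous inside the unit ball and not
positive outside, so the verdict is right for large T₁ (`exists_nhds_not_index_pos`,
`exists_nhds_half_index_le`).

Relative to θ̃ the earlier rewards are corrupted. A corruption enters the ridge estimate only
multiplied by the inverse form at the pulled arm, so all corrupted target pulls act through one
linear functional and a single compensating reward cancels them exactly. What is left
(`abs_corruption_le`) is O(√T₁) corrupted non-target pulls and a mismatch of size O(1/√T₁) on the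
target arm, which Cauchy–Schwarz turns into that size times √T. Measured at the well-explored target
arm, both are a small fraction of ε*. So a non-target arm pulled later must have a confidence width
of order ε* (`quarter_index_le_of_pull`), and the elliptical potential lemma counts such rounds
(`card_mul_le`).

The noise bound is Ville's inequality for exp(‖Z‖²/(2R²) − ½ log det) (`self_normalized_bound`),
whose one-step inequality is a scalar Gaussian computation. The cost is governed by the number of
rounds the adversary generates and a Chernoff bound for the noise in them.

All failure probabilities add up to δ. The weaker levels 1−3δ and 1−4δ make the corresponding claims
void for δ ≥ 1/3; below that, log(8/δ) is comparable to log(1/δ). -/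

lemma posDef_inv_dotProduct_nonneg {A : Matrix n n ℝ} (hA : A.PosDef) (x : n → ℝ) :
    0 ≤ x ⬝ᵥ A⁻¹ *ᵥ x := by
  simpa using hA.inv.posSemidef.dotProduct_mulVec_nonneg x

lemma posDef_inv_dotProduct_comm {A : Matrix n n ℝ} (hA : A.PosDef) (x y : n → ℝ) :
    x ⬝ᵥ A⁻¹ *ᵥ y = y ⬝ᵥ A⁻¹ *ᵥ x := by
  have h : (A⁻¹)ᵀ = A⁻¹ := by
    rw [← conjTranspose_eq_transpose_of_trivial]
    exact hA.inv.isHermitian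
  rw [dotProduct_mulVec, ← mulVec_transpose, h, dotProduct_comm]

/-- The Cauchy–Schwarz inequality for the form `x ↦ xᵀ A⁻¹ x`. -/
lemma posDef_inv_cauchy_schwarz {A : Matrix n n ℝ} (hA : A.PosDef) (x y : n → ℝ) :
    (x ⬝ᵥ A⁻¹ *ᵥ y) ^ 2 ≤ (x ⬝ᵥ A⁻¹ *ᵥ x) * (y ⬝ᵥ A⁻¹ *ᵥ y) := by
  have key : ∀ s : ℝ, 0 ≤ (y ⬝ᵥ A⁻¹ *ᵥ y) * (s * s) + (2 * (x ⬝ᵥ A⁻¹ *ᵥ y)) * s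
      + x ⬝ᵥ A⁻¹ *ᵥ x := by
    intro s
    have h := posDef_inv_dotProduct_nonneg hA (x + s • y)
    simp only [mulVec_add, mulVec_smul, dotProduct_add, add_dotProduct, dotProduct_smul,
      smul_dotProduct, smul_eq_mul] at h
    rw [posDef_inv_dotProduct_comm hA y x] at h
    linarith
  have := discrim_le_zero key
  rw [discrim] at this
  nlinarith

lemma isUnit_det_of_posDef {A : Matrix n n ℝ} (hA : A.PosDef) : IsUnit A.det :=
  (Matrix.isUnit_iff_isUnit_det A).1 hA.isUnit

/-- The matrix determinant lemma for a rank one update. -/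
lemma det_add_vecMulVec {A : Matrix n n ℝ} (hA : A.PosDef) (x : n → ℝ) :
    (A + vecMulVec x x).det = A.det * (1 + x ⬝ᵥ A⁻¹ *ᵥ x) := by
  have h := det_add_replicateCol_mul_replicateRow (ι := Unit) (isUnit_det_of_posDef hA) x x
  rw [← vecMulVec_eq] at h
  rw [h]
  congr 1
  rw [det_unique, Matrix.add_apply, Matrix.one_apply_eq, dotProduct_mulVec, Matrix.mul_apply]
  simp [Matrix.mul_apply, dotProduct, vecMul]

/-- The Sherman–Morrison formula. -/
lemma inv_add_vecMulVec_mulVec {A : Matrix n n ℝ} (hA : A.PosDef) (x y : n → ℝ) :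
    (A + vecMulVec x x)⁻¹ *ᵥ y =
      A⁻¹ *ᵥ y - ((x ⬝ᵥ A⁻¹ *ᵥ y) / (1 + x ⬝ᵥ A⁻¹ *ᵥ x)) • A⁻¹ *ᵥ x := by
  have hx := posDef_inv_dotProduct_nonneg hA x
  have hU := isUnit_det_of_posDef hA
  have hU' : IsUnit (A + vecMulVec x x).det := by
    rw [det_add_vecMulVec hA]
    exact hU.mul (IsUnit.mk0 _ (by positivity))
  have h : (A + vecMulVec x x) *ᵥ
      (A⁻¹ *ᵥ y - ((x ⬝ᵥ A⁻¹ *ᵥ y) / (1 + x ⬝ᵥ A⁻¹ *ᵥ x)) • A⁻¹ *ᵥ x) = y := by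
    have hy (z : n → ℝ) : A *ᵥ A⁻¹ *ᵥ z = z := by
      rw [mulVec_mulVec, Matrix.mul_nonsing_inv _ hU, one_mulVec]
    rw [mulVec_sub, mulVec_smul, add_mulVec, add_mulVec, hy, hy, vecMulVec_mulVec, vecMulVec_mulVec]
    ext i
    simp only [Pi.add_apply, Pi.sub_apply, Pi.smul_apply, MulOpposite.smul_eq_mul_unop,
      MulOpposite.unop_op, smul_eq_mul]
    field_simp
    ring
  rw [← h, mulVec_mulVec, Matrix.nonsing_inv_mul _ hU', one_mulVec, h]

/-- The change of the norm in one round is a quadratic polynomial in `c`. When `c` is the new noise,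
all coefficients are known before it is drawn, which reduces the vector-valued supermartingale to a
scalar integral. -/
lemma inv_add_vecMulVec_quadratic {A : Matrix n n ℝ} (hA : A.PosDef) (x y : n → ℝ) (c : ℝ) :
    (y + c • x) ⬝ᵥ (A + vecMulVec x x)⁻¹ *ᵥ (y + c • x) =
      y ⬝ᵥ A⁻¹ *ᵥ y + (2 * c * (x ⬝ᵥ A⁻¹ *ᵥ y) + c ^ 2 * (x ⬝ᵥ A⁻¹ *ᵥ x)
        - (x ⬝ᵥ A⁻¹ *ᵥ y) ^ 2) / (1 + x ⬝ᵥ A⁻¹ *ᵥ x) := by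
  have hx := posDef_inv_dotProduct_nonneg hA x
  rw [inv_add_vecMulVec_mulVec hA]
  simp only [mulVec_add, mulVec_smul, dotProduct_add, add_dotProduct, dotProduct_smul,
    smul_dotProduct, smul_eq_mul, dotProduct_sub]
  rw [posDef_inv_dotProduct_comm hA y x]
  field_simp
  ring

/-- The determinant is at most the power of any bound on the mean of the eigenvalues. -/
lemma posSemidef_det_le_pow {A : Matrix n n ℝ} (hA : A.PosSemidef) {b : ℝ}
    (h : A.trace ≤ Fintype.card n * b) : A.det ≤ b ^ Fintype.card n := by
  rcases isEmpty_or_nonempty n with hn | hn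
  · simp
  have hc : (0 : ℝ) < Fintype.card n := by exact_mod_cast Fintype.card_pos
  have h1 : A.trace = ∑ i, hA.1.eigenvalues i := by
    simpa using hA.1.trace_eq_sum_eigenvalues
  have h2 : A.det = ∏ i, hA.1.eigenvalues i := by
    simpa using hA.1.det_eq_prod_eigenvalues
  have hg := Real.geom_mean_le_arith_mean Finset.univ (fun _ : n => (1 : ℝ)) hA.1.eigenvalues
    (fun _ _ => zero_le_one) (by simpa using hc) (fun i _ => hA.eigenvalues_nonneg i)
  simp only [Real.rpow_one, one_mul, Finset.sum_const, Finset.card_univ, nsmul_eq_mul, mul_one,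
    ← h1, ← h2] at hg
  have hd := hA.det_nonneg
  have h4 : A.det ^ ((Fintype.card n : ℝ)⁻¹) ≤ b :=
    hg.trans (by rw [div_le_iff₀ hc]; linarith)
  calc A.det = (A.det ^ ((Fintype.card n : ℝ)⁻¹)) ^ Fintype.card n := by
        rw [Real.rpow_inv_natCast_pow hd Fintype.card_ne_zero]
    _ ≤ b ^ Fintype.card n := pow_le_pow_left₀ (Real.rpow_nonneg hd _) h4 _

end QuadraticForms

variable {d : ℕ}

/-- The bilinear form of the inverse of the design matrix. -/
def invForm (lam : ℝ) (a : ℕ → Vec d) (t : ℕ) (x y : Vec d) : ℝ :=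
  x.ofLp ⬝ᵥ (designMatrix lam a t)⁻¹ *ᵥ y.ofLp

lemma designMatrix_zero (lam : ℝ) (a : ℕ → Vec d) : designMatrix lam a 0 = lam • 1 := by
  simp [designMatrix]

lemma designMatrix_succ (lam : ℝ) (a : ℕ → Vec d) (t : ℕ) :
    designMatrix lam a (t + 1) = designMatrix lam a t + vecMulVec (a t).ofLp (a t).ofLp := by
  simp [designMatrix, Finset.sum_range_succ, add_assoc]

lemma posSemidef_vecMulVec_self (x : Fin d → ℝ) : (vecMulVec x x).PosSemidef := by
  simpa using posSemidef_vecMulVec_self_star x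

variable {lam : ℝ} (hlam : 0 < lam)
include hlam

lemma designMatrix_posDef (a : ℕ → Vec d) (t : ℕ) : (designMatrix lam a t).PosDef :=
  (PosDef.one.smul hlam).add_posSemidef
    (posSemidef_sum _ fun s _ => posSemidef_vecMulVec_self (a s).ofLp)

lemma invForm_self_nonneg (a : ℕ → Vec d) (t : ℕ) (x : Vec d) : 0 ≤ invForm lam a t x x :=
  posDef_inv_dotProduct_nonneg (designMatrix_posDef hlam a t) _

lemma invNorm_sq (a : ℕ → Vec d) (t : ℕ) (x : Vec d) :
    invNorm lam a t x ^ 2 = invForm lam a t x x :=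
  Real.sq_sqrt (invForm_self_nonneg hlam a t x)

lemma abs_invForm_le (a : ℕ → Vec d) (t : ℕ) (x y : Vec d) :
    |invForm lam a t x y| ≤ invNorm lam a t x * invNorm lam a t y := by
  have h := posDef_inv_cauchy_schwarz (designMatrix_posDef hlam a t) x.ofLp y.ofLp
  refine abs_le_of_sq_le_sq ?_ (mul_nonneg (Real.sqrt_nonneg _) (Real.sqrt_nonneg _))
  rw [mul_pow, invNorm_sq hlam, invNorm_sq hlam]
  exact h

lemma designMatrix_det_pos (a : ℕ → Vec d) (t : ℕ) : 0 < (designMatrix lam a t).det :=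
  (designMatrix_posDef hlam a t).det_pos

lemma designMatrix_det_succ (a : ℕ → Vec d) (t : ℕ) :
    (designMatrix lam a (t + 1)).det =
      (designMatrix lam a t).det * (1 + invForm lam a t (a t) (a t)) := by
  rw [designMatrix_succ, det_add_vecMulVec (designMatrix_posDef hlam a t)]
  rfl

omit hlam in
lemma dotProduct_self_eq_norm_sq (x : Vec d) : x.ofLp ⬝ᵥ x.ofLp = ‖x‖ ^ 2 := by
  rw [← real_inner_self_eq_norm_sq, EuclideanSpace.inner_eq_star_dotProduct]
  simp

omit hlam in
lemma inner_eq_dotProduct (x y : Vec d) : inner ℝ x y = x.ofLp ⬝ᵥ y.ofLp := by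
  rw [EuclideanSpace.inner_eq_star_dotProduct, dotProduct_comm]
  simp

omit hlam in
lemma designMatrix_trace_le (a : ℕ → Vec d) (t : ℕ) (ha : ∀ s < t, ‖a s‖ ≤ 1) :
    (designMatrix lam a t).trace ≤ d * lam + t := by
  rw [designMatrix, trace_add, trace_smul, trace_one, trace_sum]
  have : ∑ s ∈ Finset.range t, (vecMulVec (a s).ofLp (a s).ofLp).trace ≤
      ∑ s ∈ Finset.range t, (1 : ℝ) := by
    refine Finset.sum_le_sum fun s hs => ?_
    rw [trace_vecMulVec, dotProduct_self_eq_norm_sq]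
    have := ha s (Finset.mem_range.1 hs)
    have h0 := norm_nonneg (a s)
    nlinarith
  simp only [Finset.sum_const, Finset.card_range, nsmul_eq_mul, mul_one] at this
  simp only [Fintype.card_fin, smul_eq_mul]
  linarith

/-- Arithmetic–geometric mean for the eigenvalues. Their mean is at most λ + t/d, and the cruder λ +
t suffices. -/
lemma designMatrix_det_le (hd : 0 < d) (a : ℕ → Vec d) (t : ℕ) (ha : ∀ s < t, ‖a s‖ ≤ 1) :
    (designMatrix lam a t).det ≤ (lam + t) ^ d := by
  have h := posSemidef_det_le_pow (designMatrix_posDef hlam a t).posSemidef (b := lam + t) (by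
    refine (designMatrix_trace_le a t ha).trans ?_
    have : (1 : ℝ) ≤ d := by exact_mod_cast hd
    rw [Fintype.card_fin]
    nlinarith [(Nat.cast_nonneg t : (0 : ℝ) ≤ t)])
  simpa using h

/-- The quadratic form at `x` in terms of `u = A⁻¹ x`. -/
lemma invForm_self_eq (a : ℕ → Vec d) (t : ℕ) (x : Vec d) (u : Fin d → ℝ)
    (hu : u = (designMatrix lam a t)⁻¹ *ᵥ x.ofLp) :
    invForm lam a t x x = lam * (u ⬝ᵥ u) + ∑ s ∈ Finset.range t, ((a s).ofLp ⬝ᵥ u) ^ 2 := by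
  have h : designMatrix lam a t *ᵥ u = x.ofLp := by
    rw [hu, mulVec_mulVec,
      Matrix.mul_nonsing_inv _ (isUnit_det_of_posDef (designMatrix_posDef hlam a t)), one_mulVec]
  have h2 : invForm lam a t x x = u ⬝ᵥ designMatrix lam a t *ᵥ u := by
    rw [h, invForm, ← hu, dotProduct_comm]
  rw [h2, designMatrix, add_mulVec, dotProduct_add, smul_mulVec, one_mulVec, dotProduct_smul,
    sum_mulVec, dotProduct_sum]
  congr 1
  refine Finset.sum_congr rfl fun s _ => ?_
  rw [vecMulVec_mulVec, op_smul_eq_smul, dotProduct_smul, smul_eq_mul, dotProduct_comm u, sq]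

/-- With u = A⁻¹x and q = x·u, the expansion gives q ≥ λ|u|² and Cauchy–Schwarz gives q² ≤ |x|²|u|²;
divide by q. -/
lemma invForm_self_le (a : ℕ → Vec d) (t : ℕ) (x : Vec d) :
    invForm lam a t x x ≤ ‖x‖ ^ 2 / lam := by
  set u := (designMatrix lam a t)⁻¹ *ᵥ x.ofLp with hu
  have h := invForm_self_eq hlam a t x u hu
  have h1 : 0 ≤ ∑ s ∈ Finset.range t, ((a s).ofLp ⬝ᵥ u) ^ 2 :=
    Finset.sum_nonneg fun _ _ => sq_nonneg _
  have h2 : invForm lam a t x x = x.ofLp ⬝ᵥ u := rfl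
  have h3 : (x.ofLp ⬝ᵥ u) ^ 2 ≤ (x.ofLp ⬝ᵥ x.ofLp) * (u ⬝ᵥ u) := by
    simpa [dotProduct, sq] using Finset.sum_mul_sq_le_sq_mul_sq Finset.univ x.ofLp u
  rw [dotProduct_self_eq_norm_sq, ← h2] at h3
  have hq := invForm_self_nonneg hlam a t x
  rw [le_div_iff₀ hlam]
  rcases hq.eq_or_lt with h0 | h0
  · rw [← h0]; simp
  refine le_of_mul_le_mul_right ?_ h0
  have : lam * (u ⬝ᵥ u) ≤ invForm lam a t x x := by linarith
  nlinarith [sq_nonneg ‖x‖]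

lemma invNorm_le (a : ℕ → Vec d) (t : ℕ) {x : Vec d} (hx : ‖x‖ ≤ 1) :
    invNorm lam a t x ≤ 1 / Real.sqrt lam := by
  rw [← Real.sqrt_one, ← Real.sqrt_div zero_le_one]
  refine Real.sqrt_le_sqrt ((invForm_self_le hlam a t x).trans ?_)
  gcongr
  nlinarith [norm_nonneg x]

omit hlam in
lemma invNorm_nonneg (a : ℕ → Vec d) (t : ℕ) (x : Vec d) : 0 ≤ invNorm lam a t x :=
  Real.sqrt_nonneg _

open Classical in
/-- An arm that has been pulled `n` times has squared norm at most `1 / n`. -/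
lemma card_mul_invForm_le_one (a : ℕ → Vec d) (t : ℕ) (x : Vec d) :
    ((Finset.range t).filter (fun s => a s = x)).card * invForm lam a t x x ≤ 1 := by
  set u := (designMatrix lam a t)⁻¹ *ᵥ x.ofLp with hu
  have h := invForm_self_eq hlam a t x u hu
  have h2 : invForm lam a t x x = x.ofLp ⬝ᵥ u := rfl
  have h0 : 0 ≤ u ⬝ᵥ u := Finset.sum_nonneg fun _ _ => mul_self_nonneg _
  -- With q = x·u, the n rounds that pulled `x` contribute n q² to the expansion of q, so n q² ≤ q.
  have h1 : ∑ s ∈ (Finset.range t).filter (fun s => a s = x), (x.ofLp ⬝ᵥ u) ^ 2 ≤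
      ∑ s ∈ Finset.range t, ((a s).ofLp ⬝ᵥ u) ^ 2 := by
    refine le_trans (le_of_eq (Finset.sum_congr rfl fun s hs => ?_))
      (Finset.sum_le_sum_of_subset_of_nonneg (Finset.filter_subset _ _) fun _ _ _ => sq_nonneg _)
    rw [(Finset.mem_filter.1 hs).2]
  rw [Finset.sum_const, nsmul_eq_mul, ← h2] at h1
  have hq := invForm_self_nonneg hlam a t x
  rcases hq.eq_or_lt with h3 | h3
  · rw [← h3]; simp
  refine le_of_mul_le_mul_right ?_ h3
  nlinarith [mul_nonneg hlam.le h0]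

/-- The logarithm of the normalized determinant of the design matrix. -/
def logDet (lam : ℝ) (a : ℕ → Vec d) (t : ℕ) : ℝ :=
  Real.log ((designMatrix lam a t).det / lam ^ d)

omit hlam in
lemma logDet_zero (hlam : 0 < lam) (a : ℕ → Vec d) : logDet lam a 0 = 0 := by
  rw [logDet, designMatrix_zero, det_smul, det_one, Fintype.card_fin, mul_one,
    div_self (by positivity), Real.log_one]

lemma logDet_succ (a : ℕ → Vec d) (t : ℕ) :
    logDet lam a (t + 1) = logDet lam a t + Real.log (1 + invForm lam a t (a t) (a t)) := by
  have h1 := designMatrix_det_pos hlam a t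
  have h2 := invForm_self_nonneg hlam a t (a t)
  rw [logDet, logDet, designMatrix_det_succ hlam, mul_div_right_comm,
    Real.log_mul (by positivity) (by positivity)]

lemma logDet_le (hd : 0 < d) (a : ℕ → Vec d) (t : ℕ) (ha : ∀ s < t, ‖a s‖ ≤ 1) :
    logDet lam a t ≤ d * Real.log (1 + t / lam) := by
  have h := designMatrix_det_le hlam hd a t ha
  rw [logDet, ← Real.log_pow]
  refine Real.log_le_log (div_pos (designMatrix_det_pos hlam a t) (by positivity)) ?_
  rw [div_le_iff₀ (by positivity), ← mul_pow]
  refine h.trans (le_of_eq ?_)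
  congr 1
  field_simp

/-- The elliptical potential lemma. -/
lemma sum_invForm_le (a : ℕ → Vec d) (t : ℕ) (ha : ∀ s < t, ‖a s‖ ≤ 1) :
    ∑ s ∈ Finset.range t, invForm lam a s (a s) (a s) ≤ (1 + 1 / lam) * logDet lam a t := by
  induction t with
  | zero => simp [logDet_zero hlam]
  | succ t ih =>
    rw [Finset.sum_range_succ, logDet_succ hlam, mul_add]
    refine add_le_add (ih fun s hs => ha s (hs.trans (Nat.lt_succ_self t))) ?_
    set u := invForm lam a t (a t) (a t)
    have hu : 0 ≤ u := invForm_self_nonneg hlam a t (a t)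
    have hu1 : u ≤ 1 / lam := (invForm_self_le hlam a t (a t)).trans (by
      gcongr
      have := ha t (Nat.lt_succ_self t)
      nlinarith [norm_nonneg (a t)])
    have hl : 1 - (1 + u)⁻¹ ≤ Real.log (1 + u) := Real.one_sub_inv_le_log_of_pos (by linarith)
    have h1 : u = (1 + u) * (1 - (1 + u)⁻¹) := by field_simp; ring
    have h2 : 0 ≤ Real.log (1 + u) := Real.log_nonneg (by linarith)
    -- The bound u ≤ (1 + u) log(1 + u) holds without restriction; u ≤ 1/λ then produces the
    -- constant.
    calc u = (1 + u) * (1 - (1 + u)⁻¹) := h1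
      _ ≤ (1 + u) * Real.log (1 + u) := by gcongr
      _ ≤ _ := by gcongr

/-- Recursion for the self-normalized norm of a sum. -/
lemma invForm_succ_add_smul (a : ℕ → Vec d) (t : ℕ) (y : Vec d) (c : ℝ) :
    invForm lam a (t + 1) (y + c • a t) (y + c • a t) = invForm lam a t y y +
      (2 * c * invForm lam a t (a t) y + c ^ 2 * invForm lam a t (a t) (a t)
        - invForm lam a t (a t) y ^ 2) / (1 + invForm lam a t (a t) (a t)) := by
  rw [invForm, designMatrix_succ]
  exact inv_add_vecMulVec_quadratic (designMatrix_posDef hlam a t) _ _ c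

omit hlam in
lemma invForm_add_right (a : ℕ → Vec d) (t : ℕ) (x y z : Vec d) :
    invForm lam a t x (y + z) = invForm lam a t x y + invForm lam a t x z := by
  simp [invForm, mulVec_add, dotProduct_add]

omit hlam in
lemma invForm_smul_right (a : ℕ → Vec d) (t : ℕ) (x y : Vec d) (c : ℝ) :
    invForm lam a t x (c • y) = c * invForm lam a t x y := by
  simp [invForm, mulVec_smul, dotProduct_smul]

omit hlam in
lemma invForm_sum_right {ι : Type*} (a : ℕ → Vec d) (t : ℕ) (x : Vec d) (s : Finset ι)
    (y : ι → Vec d) :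
    invForm lam a t x (∑ i ∈ s, y i) = ∑ i ∈ s, invForm lam a t x (y i) := by
  classical
  induction s using Finset.induction_on with
  | empty => simp [invForm]
  | insert i s hi ih => rw [Finset.sum_insert hi, Finset.sum_insert hi, invForm_add_right, ih]

omit hlam in
lemma inner_ridge (a : ℕ → Vec d) (y : ℕ → ℝ) (t : ℕ) (x : Vec d) :
    inner ℝ x (ridge lam a y t) = ∑ s ∈ Finset.range t, y s * invForm lam a t x (a s) := by
  simp_rw [← invForm_smul_right, ← invForm_sum_right]
  rw [inner_eq_dotProduct, ridge, invForm]
  simp [WithLp.ofLp_sum]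

/-- Write θ = A⁻¹(Aθ) and expand A. Subtracted from the ridge estimate, this isolates the
regularization bias from the per-round errors. -/
lemma inner_eq_invForm (a : ℕ → Vec d) (t : ℕ) (x θ : Vec d) :
    inner ℝ x θ = lam * invForm lam a t x θ +
      ∑ s ∈ Finset.range t, inner ℝ (a s) θ * invForm lam a t x (a s) := by
  have hA := designMatrix_posDef hlam a t
  have h1 : θ.ofLp = (designMatrix lam a t)⁻¹ *ᵥ (designMatrix lam a t *ᵥ θ.ofLp) := by
    rw [mulVec_mulVec, Matrix.nonsing_inv_mul _ (isUnit_det_of_posDef hA), one_mulVec]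
  have h2 : WithLp.toLp 2 (designMatrix lam a t *ᵥ θ.ofLp) =
      lam • θ + ∑ s ∈ Finset.range t, (inner ℝ (a s) θ : ℝ) • a s := by
    ext i
    rw [designMatrix, add_mulVec, smul_mulVec, one_mulVec, sum_mulVec]
    simp only [vecMulVec_mulVec, op_smul_eq_smul, inner_eq_dotProduct]
    simp
  simp_rw [← invForm_smul_right, ← invForm_sum_right]
  rw [← invForm_add_right, ← h2, invForm, ← h1, inner_eq_dotProduct]

/-- Error of the ridge estimate in terms of regularization, noise and corruption. -/
lemma inner_ridge_sub (a : ℕ → Vec d) (y ξ : ℕ → ℝ) (t : ℕ) (x θ : Vec d) :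
    inner ℝ x (ridge lam a y t) - inner ℝ x θ = - (lam * invForm lam a t x θ)
      + invForm lam a t x (∑ s ∈ Finset.range t, ξ s • a s)
      + ∑ s ∈ Finset.range t, (y s - ξ s - inner ℝ (a s) θ) * invForm lam a t x (a s) := by
  rw [inner_ridge, inner_eq_invForm hlam a t x θ, invForm_sum_right]
  simp_rw [invForm_smul_right, sub_mul, Finset.sum_sub_distrib]
  ring

lemma abs_lam_mul_invForm_le (a : ℕ → Vec d) (t : ℕ) (x θ : Vec d) (hθ : ‖θ‖ ≤ 1) :
    |lam * invForm lam a t x θ| ≤ invNorm lam a t x * Real.sqrt lam := by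
  rw [abs_mul, abs_of_pos hlam]
  have h1 := abs_invForm_le hlam a t x θ
  have h2 := invNorm_le hlam a t hθ
  have h3 := invNorm_nonneg (lam := lam) a t x
  calc lam * |invForm lam a t x θ| ≤ lam * (invNorm lam a t x * (1 / Real.sqrt lam)) := by
        gcongr; exact h1.trans (by gcongr)
    _ = invNorm lam a t x * (lam / Real.sqrt lam) := by ring
    _ = _ := by rw [Real.div_sqrt]

end LinBandit
end

/-! ### Conditional sub-Gaussianity, Gaussian linearization and Ville's inequality. -/

noncomputable section

namespace LinBandit

open ProbabilityTheory Filter Topology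
open scoped ENNReal NNReal

/-- The moment generating function of `ρ` is at most that of a centred Gaussian of standard
deviation `R`. -/
def IsSubGaussianLaw (R : ℝ) (ρ : Measure ℝ) : Prop :=
  ∀ c : ℝ, ∫⁻ y, ENNReal.ofReal (Real.exp (c * y)) ∂ρ ≤ ENNReal.ofReal (Real.exp (c ^ 2 * R ^ 2 / 2))

/-- A conditional law satisfies each moment inequality only off a null set depending on the slope.
Countably many slopes share a null set, and Fatou's lemma extends the inequality to real slopes. -/
lemma isSubGaussianLaw_of_rat {R : ℝ} {ρ : Measure ℝ}
    (h : ∀ c : ℚ, ∫⁻ y, ENNReal.ofReal (Real.exp (c * y)) ∂ρ ≤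
      ENNReal.ofReal (Real.exp ((c : ℝ) ^ 2 * R ^ 2 / 2))) : IsSubGaussianLaw R ρ := by
  intro c
  obtain ⟨u, -, -, hu⟩ := Real.exists_seq_rat_strictMono_tendsto c
  have hl : ∀ y : ℝ, Tendsto (fun n => ENNReal.ofReal (Real.exp (u n * y))) atTop
      (𝓝 (ENNReal.ofReal (Real.exp (c * y)))) := fun y =>
    ENNReal.tendsto_ofReal ((Real.continuous_exp.tendsto _).comp (hu.mul_const y))
  have hr : Tendsto (fun n => ENNReal.ofReal (Real.exp ((u n : ℝ) ^ 2 * R ^ 2 / 2))) atTop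
      (𝓝 (ENNReal.ofReal (Real.exp (c ^ 2 * R ^ 2 / 2)))) :=
    ENNReal.tendsto_ofReal ((Real.continuous_exp.tendsto _).comp
      (((hu.pow 2).mul_const _).div_const _))
  calc ∫⁻ y, ENNReal.ofReal (Real.exp (c * y)) ∂ρ
      = ∫⁻ y, liminf (fun n => ENNReal.ofReal (Real.exp (u n * y))) atTop ∂ρ := by
        simp_rw [(hl _).liminf_eq]
    _ ≤ liminf (fun n => ∫⁻ y, ENNReal.ofReal (Real.exp (u n * y)) ∂ρ) atTop :=
        lintegral_liminf_le fun n => by fun_prop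
    _ ≤ liminf (fun n => ENNReal.ofReal (Real.exp ((u n : ℝ) ^ 2 * R ^ 2 / 2))) atTop :=
        liminf_le_liminf (Eventually.of_forall fun n => h (u n))
    _ = _ := hr.liminf_eq

/-- Integrating out a variable that is sub-Gaussian given `Z`. -/
lemma lintegral_comp_le_of_subGaussian_given {Ω β : Type*} {mΩ : MeasurableSpace Ω}
    {mβ : MeasurableSpace β} {μ : Measure Ω} [IsProbabilityMeasure μ] {Z : Ω → β} {X : Ω → ℝ}
    {R : ℝ} (hZ : Measurable Z) (hX : Measurable X)
    (h : ∀ c : ℝ, ∀ B, MeasurableSet B → ∫⁻ ω in Z ⁻¹' B, ENNReal.ofReal (Real.exp (c * X ω)) ∂μ ≤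
      ENNReal.ofReal (Real.exp (c ^ 2 * R ^ 2 / 2)) * μ (Z ⁻¹' B))
    {f : β × ℝ → ℝ≥0∞} {g : β → ℝ≥0∞} (hf : Measurable f) (hg : Measurable g)
    (hfg : ∀ z, ∀ ρ : Measure ℝ, IsProbabilityMeasure ρ → IsSubGaussianLaw R ρ →
      ∫⁻ y, f (z, y) ∂ρ ≤ g z) :
    ∫⁻ ω, f (Z ω, X ω) ∂μ ≤ ∫⁻ ω, g (Z ω) ∂μ := by
  have hP : IsProbabilityMeasure (μ.map Z) := Measure.isProbabilityMeasure_map hZ.aemeasurable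
  have hc := compProd_map_condDistrib (mβ := mβ) (X := Z) (μ := μ) hX.aemeasurable
  -- The hypothesis on preimages of measurable sets is the integrated form of this inequality for
  -- the conditional distribution; comparing integrals over all such sets gives it almost
  -- everywhere.
  have hrat : ∀ c : ℚ, ∀ᵐ z ∂(μ.map Z), ∫⁻ y, ENNReal.ofReal (Real.exp (c * y))
      ∂(condDistrib X Z μ z) ≤ ENNReal.ofReal (Real.exp ((c : ℝ) ^ 2 * R ^ 2 / 2)) := by
    intro c
    have hm : Measurable fun y : ℝ => ENNReal.ofReal (Real.exp (c * y)) := by fun_prop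
    refine ae_le_of_forall_setLIntegral_le_of_sigmaFinite (Measurable.lintegral_kernel hm)
      fun B hB _ => ?_
    have h1 := Measure.setLIntegral_compProd (μ := μ.map Z) (κ := condDistrib X Z μ)
      (f := fun p : β × ℝ => ENNReal.ofReal (Real.exp (c * p.2))) (hm.comp measurable_snd) hB
      MeasurableSet.univ
    simp only [Measure.restrict_univ] at h1
    rw [← h1, hc, setLIntegral_const, Measure.map_apply hZ hB,
      setLIntegral_map (f := fun p : β × ℝ => ENNReal.ofReal (Real.exp (c * p.2)))
        (hB.prod MeasurableSet.univ) (hm.comp measurable_snd) (hZ.prodMk hX)]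
    refine le_trans (le_of_eq ?_) (h c B hB)
    congr 2
    ext ω; simp
  calc ∫⁻ ω, f (Z ω, X ω) ∂μ = ∫⁻ p, f p ∂(μ.map fun ω => (Z ω, X ω)) :=
        (lintegral_map hf (hZ.prodMk hX)).symm
    _ = ∫⁻ z, ∫⁻ y, f (z, y) ∂(condDistrib X Z μ z) ∂(μ.map Z) := by
        rw [← hc, Measure.lintegral_compProd hf]
    _ ≤ ∫⁻ z, g z ∂(μ.map Z) := by
        refine lintegral_mono_ae ?_
        filter_upwards [ae_all_iff.2 hrat] with z hz
        exact hfg z _ inferInstance (isSubGaussianLaw_of_rat hz)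
    _ = _ := lintegral_map hg hZ

/-- A set-integral form of conditional sub-Gaussianity. -/
def SubGaussianGiven {Ω : Type*} {m0 : MeasurableSpace Ω} (μ : Measure Ω) (m : MeasurableSpace Ω)
    (R : ℝ) (X : Ω → ℝ) : Prop :=
  ∀ c : ℝ, ∀ B, MeasurableSet[m] B → ∫⁻ ω in B, ENNReal.ofReal (Real.exp (c * X ω)) ∂μ ≤
    ENNReal.ofReal (Real.exp (c ^ 2 * R ^ 2 / 2)) * μ B

/-- Integrates the conditional bound over `B`. The integrated form localizes to events and
disintegrates without further use of conditional expectations. -/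
lemma CondSubGaussian.subGaussianGiven {Ω : Type*} {m m0 : MeasurableSpace Ω} {μ : Measure Ω}
    [IsProbabilityMeasure μ] {R : ℝ} {X : Ω → ℝ} (hm : m ≤ m0) (h : CondSubGaussian μ m R X) :
    SubGaussianGiven μ m R X := by
  intro c B hB
  obtain ⟨hi, hc⟩ := h c
  rw [← ofReal_integral_eq_lintegral_ofReal hi.integrableOn
    (Eventually.of_forall fun _ => (Real.exp_pos _).le), ← setIntegral_condExp hm hi hB]
  refine (ENNReal.ofReal_le_ofReal (setIntegral_mono_ae integrable_condExp.integrableOn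
    (integrable_const _).integrableOn hc)).trans (le_of_eq ?_)
  rw [setIntegral_const, smul_eq_mul, mul_comm, ENNReal.ofReal_mul (Real.exp_pos _).le,
    ofReal_measureReal]

/-- Split `B` along the event. This is needed because the pulled arm, known before the reward,
decides whether the learner sees the environment's noise or the adversary's. -/
lemma SubGaussianGiven.piecewise {Ω : Type*} {m m0 : MeasurableSpace Ω} {μ : Measure Ω}
    {R : ℝ} {X Y : Ω → ℝ} (hm : m ≤ m0) (hX : SubGaussianGiven μ m R X)
    (hY : SubGaussianGiven μ m R Y) {P : Ω → Prop} [DecidablePred P]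
    (hP : MeasurableSet[m] {ω | P ω}) :
    SubGaussianGiven μ m R (fun ω => if P ω then X ω else Y ω) := by
  intro c B hB
  have hP0 : MeasurableSet {ω | P ω} := hm _ hP
  rw [← lintegral_inter_add_sdiff _ B hP0, ← measure_inter_add_sdiff B hP0, mul_add]
  refine add_le_add (le_trans (le_of_eq ?_) (hX c _ (hB.inter hP)))
    (le_trans (le_of_eq ?_) (hY c _ (hB.diff hP)))
  · refine setLIntegral_congr_fun (hm _ (hB.inter hP)) fun ω hω => ?_
    simp only [if_pos (show P ω from hω.2)]
  · refine setLIntegral_congr_fun (hm _ (hB.diff hP)) fun ω hω => ?_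
    simp only [if_neg (show ¬ P ω from hω.2)]

/-- Conditioning on a sub-σ-algebra is conditioning on the identity map into the space with the
smaller σ-algebra. A bound valid for every sub-Gaussian law with the past frozen therefore
integrates. -/
lemma SubGaussianGiven.lintegral_le {Ω : Type*} {m m0 : MeasurableSpace Ω} {μ : Measure Ω}
    [IsProbabilityMeasure μ] {R : ℝ} {X : Ω → ℝ} (hm : m ≤ m0) (hX : Measurable X)
    (h : SubGaussianGiven μ m R X) {f : Ω → ℝ → ℝ≥0∞} {g : Ω → ℝ≥0∞}
    (hf : Measurable[m.prod inferInstance] (Function.uncurry f)) (hg : Measurable[m] g)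
    (hfg : ∀ ω, ∀ ρ : Measure ℝ, IsProbabilityMeasure ρ → IsSubGaussianLaw R ρ →
      ∫⁻ y, f ω y ∂ρ ≤ g ω) :
    ∫⁻ ω, f ω (X ω) ∂μ ≤ ∫⁻ ω, g ω ∂μ :=
  lintegral_comp_le_of_subGaussian_given (mβ := m) (Z := id) (measurable_id'' hm) hX
    (fun c B hB => h c B hB) hf hg hfg

/-! ### Laws on the line -/

/-- Completing the square turns the integrand into a constant times a Gaussian density of variance
1/(1 − s²R²). -/
lemma lintegral_exp_gaussian_mixture (p s R : ℝ) (hs : s ^ 2 * R ^ 2 < 1) :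
    ∫⁻ z, ENNReal.ofReal (Real.exp ((p + s * z) ^ 2 * R ^ 2 / 2)) ∂(gaussianReal 0 1) =
      ENNReal.ofReal ((Real.sqrt (1 - s ^ 2 * R ^ 2))⁻¹ *
        Real.exp (p ^ 2 * R ^ 2 / (2 * (1 - s ^ 2 * R ^ 2)))) := by
  set w := 1 - s ^ 2 * R ^ 2 with hw
  have hw0 : 0 < w := by rw [hw]; linarith
  let v : ℝ≥0 := ⟨w⁻¹, (inv_pos.2 hw0).le⟩
  have hvr : (v : ℝ) = w⁻¹ := rfl
  have hv : v ≠ 0 := by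
    intro h
    have : (v : ℝ) = 0 := by rw [h]; rfl
    rw [hvr] at this
    exact (inv_pos.2 hw0).ne' this
  have h1 : ∀ z, ENNReal.ofReal (Real.exp ((p + s * z) ^ 2 * R ^ 2 / 2)) * gaussianPDF 0 1 z
      = ENNReal.ofReal ((Real.sqrt w)⁻¹ * Real.exp (p ^ 2 * R ^ 2 / (2 * w))) *
        gaussianPDF (p * s * R ^ 2 / w) v z := by
    intro z
    rw [gaussianPDF, gaussianPDF, ← ENNReal.ofReal_mul (Real.exp_pos _).le,
      ← ENNReal.ofReal_mul (by positivity)]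
    congr 1
    rw [gaussianPDFReal, gaussianPDFReal, hvr]
    have e1 : Real.sqrt (2 * Real.pi * w⁻¹) = Real.sqrt (2 * Real.pi) * (Real.sqrt w)⁻¹ := by
      rw [Real.sqrt_mul (by positivity), Real.sqrt_inv]
    rw [e1, NNReal.coe_one, mul_one]
    have hsw : Real.sqrt w ≠ 0 := (Real.sqrt_pos.2 hw0).ne'
    have hpi : Real.sqrt (2 * Real.pi) ≠ 0 := (Real.sqrt_pos.2 (by positivity)).ne'
    have e2 : (p + s * z) ^ 2 * R ^ 2 / 2 + -(z - 0) ^ 2 / (2 * 1) =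
        p ^ 2 * R ^ 2 / (2 * w) + -(z - p * s * R ^ 2 / w) ^ 2 / (2 * w⁻¹) := by
      have : s ^ 2 * R ^ 2 = 1 - w := by rw [hw]; ring
      field_simp
      have h3 : R ^ 2 * p ^ 2 * w + R ^ 2 * (s * z) ^ 2 * w = R ^ 2 * p ^ 2 * w + (1 - w) * z ^ 2 * w := by
        rw [← this]; ring
      have h4 : s ^ 2 * R ^ 2 * (R ^ 2 * p ^ 2) = (1 - w) * (R ^ 2 * p ^ 2) := by rw [this]
      ring_nf
      ring_nf at h3 h4
      linarith
    calc Real.exp ((p + s * z) ^ 2 * R ^ 2 / 2) *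
          ((Real.sqrt (2 * Real.pi))⁻¹ * Real.exp (-(z - 0) ^ 2 / (2 * 1)))
        = (Real.sqrt (2 * Real.pi))⁻¹ *
          Real.exp ((p + s * z) ^ 2 * R ^ 2 / 2 + -(z - 0) ^ 2 / (2 * 1)) := by
          rw [Real.exp_add]; ring
      _ = _ := by
          rw [e2, Real.exp_add]; field_simp
  rw [gaussianReal_of_var_ne_zero 0 one_ne_zero,
    lintegral_withDensity_eq_lintegral_mul _ (measurable_gaussianPDF 0 1) (by fun_prop)]
  simp only [Pi.mul_apply, mul_comm (gaussianPDF 0 1 _), h1]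
  rw [lintegral_const_mul _ (measurable_gaussianPDF _ _), lintegral_gaussianPDF_eq_one _ hv, mul_one]

lemma lintegral_exp_mul_gaussian (t : ℝ) :
    ∫⁻ z, ENNReal.ofReal (Real.exp (t * z)) ∂(gaussianReal 0 1) =
      ENNReal.ofReal (Real.exp (t ^ 2 / 2)) := by
  have h := mgf_id_gaussianReal (μ := 0) (v := 1)
  have h2 := congrFun h t
  simp only [mgf, id, zero_mul, zero_add, NNReal.coe_one, one_mul] at h2
  rw [← h2, ofReal_integral_eq_lintegral_ofReal (integrable_exp_mul_gaussianReal t)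
    (Eventually.of_forall fun _ => (Real.exp_pos _).le)]

/-- Exponential moments of a quadratic polynomial of a sub-Gaussian variable. -/
lemma IsSubGaussianLaw.lintegral_exp_quadratic_le {R : ℝ} {ρ : Measure ℝ} [IsProbabilityMeasure ρ]
    (h : IsSubGaussianLaw R ρ) (p q : ℝ) (hq : 0 ≤ q) (hqR : q * R ^ 2 < 1) :
    ∫⁻ y, ENNReal.ofReal (Real.exp (p * y + q * y ^ 2 / 2)) ∂ρ ≤
      ENNReal.ofReal ((Real.sqrt (1 - q * R ^ 2))⁻¹ *
        Real.exp (p ^ 2 * R ^ 2 / (2 * (1 - q * R ^ 2)))) := by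
  set s := Real.sqrt q with hs
  have hs2 : s ^ 2 = q := Real.sq_sqrt hq
  -- Linearization: exp(qy²/2) is the average of exp(√q z y) over a standard Gaussian z. After
  -- exchanging the integrals, sub-Gaussianity applies at the slope p + √q z.
  have h1 : ∀ y, ENNReal.ofReal (Real.exp (p * y + q * y ^ 2 / 2)) =
      ∫⁻ z, ENNReal.ofReal (Real.exp ((p + s * z) * y)) ∂(gaussianReal 0 1) := by
    intro y
    have : ∀ z, ENNReal.ofReal (Real.exp ((p + s * z) * y)) =
        ENNReal.ofReal (Real.exp (p * y)) * ENNReal.ofReal (Real.exp ((s * y) * z)) := by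
      intro z
      rw [← ENNReal.ofReal_mul (Real.exp_pos _).le, ← Real.exp_add]
      congr 2; ring
    simp_rw [this]
    rw [lintegral_const_mul _ (by fun_prop), lintegral_exp_mul_gaussian,
      ← ENNReal.ofReal_mul (Real.exp_pos _).le, ← Real.exp_add, mul_pow, hs2]
  simp_rw [h1]
  rw [lintegral_lintegral_swap (by fun_prop), ← hs2,
    ← lintegral_exp_gaussian_mixture p s R (by rw [hs2]; exact hqR)]
  exact lintegral_mono fun z => h (p + s * z)

lemma IsSubGaussianLaw.lintegral_exp_abs_le {R : ℝ} {ρ : Measure ℝ}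
    (h : IsSubGaussianLaw R ρ) (c : ℝ) :
    ∫⁻ y, ENNReal.ofReal (Real.exp (c * |y|)) ∂ρ ≤
      ENNReal.ofReal (2 * Real.exp (c ^ 2 * R ^ 2 / 2)) := by
  have h1 : ∀ y, ENNReal.ofReal (Real.exp (c * |y|)) ≤
      ENNReal.ofReal (Real.exp (c * y)) + ENNReal.ofReal (Real.exp (-c * y)) := by
    intro y
    rcases abs_cases y with ⟨hy, -⟩ | ⟨hy, -⟩
    · rw [hy]; exact le_self_add
    · rw [hy, mul_neg, ← neg_mul]; exact le_add_self
  refine (lintegral_mono h1).trans ?_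
  rw [lintegral_add_left (by fun_prop), two_mul, ENNReal.ofReal_add (Real.exp_pos _).le
    (Real.exp_pos _).le]
  refine add_le_add (h c) ?_
  simpa using h (-c)

/-! ### A maximal inequality -/

/-- Ville's inequality for a nonnegative supermartingale on a finite time horizon. -/
lemma measure_exists_le_of_supermartingale {Ω : Type*} {m0 : MeasurableSpace Ω} {μ : Measure Ω}
    (ℱ : Filtration ℕ m0) (M : ℕ → Ω → ℝ≥0∞) (T : ℕ)
    (hM : ∀ t ≤ T, Measurable[ℱ t] (M t))
    (hsup : ∀ t < T, ∀ B, MeasurableSet[ℱ t] B → ∫⁻ ω in B, M (t + 1) ω ∂μ ≤ ∫⁻ ω in B, M t ω ∂μ)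
    (c : ℝ≥0∞) :
    c * μ {ω | ∃ t ≤ T, c ≤ M t ω} ≤ ∫⁻ ω, M 0 ω ∂μ := by
  -- Stopping at the first crossing: paths that crossed before `t` count `c` each, and the rest
  -- carry their current value. The supermartingale property keeps this total from increasing.
  have key : ∀ t ≤ T, c * μ {ω | ∃ s < t, c ≤ M s ω} +
      ∫⁻ ω in {ω | ∃ s < t, c ≤ M s ω}ᶜ, M t ω ∂μ ≤ ∫⁻ ω, M 0 ω ∂μ := by
    intro t
    induction t with
    | zero => simp
    | succ t ih =>
      intro ht
      have hmeas : ∀ s ≤ t, MeasurableSet[ℱ t] {ω | c ≤ M s ω} := fun s hs =>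
        ℱ.mono hs _ (hM s (by omega) measurableSet_Ici)
      have hE : MeasurableSet[ℱ t] {ω | ∃ s < t, c ≤ M s ω} := by
        have : {ω | ∃ s < t, c ≤ M s ω} = ⋃ s ∈ Set.Iio t, {ω | c ≤ M s ω} := by
          ext ω; simp
        rw [this]
        exact MeasurableSet.biUnion (Set.to_countable _) fun s hs => hmeas s (le_of_lt hs)
      set E := {ω | ∃ s < t, c ≤ M s ω} with hEdef
      set F := {ω | c ≤ M t ω} with hFdef
      have hF : MeasurableSet[ℱ t] F := hmeas t le_rfl
      have hEF : {ω | ∃ s < t + 1, c ≤ M s ω} = E ∪ (Eᶜ ∩ F) := by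
        ext ω
        simp only [E, F, Set.mem_ofPred_eq, Set.mem_union, Set.mem_inter_iff, Set.mem_compl_iff]
        constructor
        · rintro ⟨s, hs, h⟩
          rcases Nat.lt_succ_iff_lt_or_eq.1 hs with h' | rfl
          · exact Or.inl ⟨s, h', h⟩
          · by_cases h2 : ∃ s' < s, c ≤ M s' ω
            · exact Or.inl h2
            · exact Or.inr ⟨h2, h⟩
        · rintro (⟨s, hs, h⟩ | ⟨-, h⟩)
          · exact ⟨s, by omega, h⟩
          · exact ⟨t, by omega, h⟩
      have hEF' : {ω | ∃ s < t + 1, c ≤ M s ω}ᶜ = Eᶜ \ F := by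
        rw [hEF]; ext ω; simp; tauto
      have hle := ℱ.le t
      calc c * μ {ω | ∃ s < t + 1, c ≤ M s ω} +
            ∫⁻ ω in {ω | ∃ s < t + 1, c ≤ M s ω}ᶜ, M (t + 1) ω ∂μ
          ≤ (c * μ E + c * μ (Eᶜ ∩ F)) + ∫⁻ ω in Eᶜ \ F, M t ω ∂μ := by
            rw [hEF', hEF, ← mul_add]
            exact add_le_add (mul_le_mul_right (measure_union_le _ _) _)
              (hsup t (by omega) _ (hE.compl.diff hF))
        _ ≤ c * μ E + (∫⁻ ω in Eᶜ ∩ F, M t ω ∂μ + ∫⁻ ω in Eᶜ \ F, M t ω ∂μ) := by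
            rw [add_assoc]
            gcongr
            rw [← setLIntegral_const]
            exact setLIntegral_mono' (hle _ (hE.compl.inter hF)) fun ω hω => hω.2
        _ = c * μ E + ∫⁻ ω in Eᶜ, M t ω ∂μ := by
            rw [lintegral_inter_add_sdiff _ _ (hle _ hF)]
        _ ≤ _ := ih (by omega)
  have h1 := key T le_rfl
  have hE : MeasurableSet {ω | ∃ s < T, c ≤ M s ω} := by
    have : {ω | ∃ s < T, c ≤ M s ω} = ⋃ s ∈ Set.Iio T, {ω | c ≤ M s ω} := by
      ext ω; simp
    rw [this]
    exact MeasurableSet.biUnion (Set.to_countable _) fun s hs =>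
      measurableSet_le measurable_const ((hM s (le_of_lt hs)).mono (ℱ.le s) le_rfl)
  have hF : MeasurableSet {ω | c ≤ M T ω} :=
    measurableSet_le measurable_const ((hM T le_rfl).mono (ℱ.le T) le_rfl)
  refine le_trans ?_ h1
  have hsub : {ω | ∃ t ≤ T, c ≤ M t ω} ⊆
      {ω | ∃ s < T, c ≤ M s ω} ∪ ({ω | ∃ s < T, c ≤ M s ω}ᶜ ∩ {ω | c ≤ M T ω}) := by
    rintro ω ⟨t, ht, h⟩
    by_cases h2 : ∃ s < T, c ≤ M s ω
    · exact Or.inl h2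
    · refine Or.inr ⟨h2, ?_⟩
      rcases ht.lt_or_eq with h' | rfl
      · exact absurd ⟨t, h', h⟩ h2
      · exact h
  calc c * μ {ω | ∃ t ≤ T, c ≤ M t ω} ≤ c * (μ {ω | ∃ s < T, c ≤ M s ω} +
        μ ({ω | ∃ s < T, c ≤ M s ω}ᶜ ∩ {ω | c ≤ M T ω})) := by
        gcongr
        exact (measure_mono hsub).trans (measure_union_le _ _)
    _ ≤ _ := by
        rw [mul_add]
        gcongr
        rw [← setLIntegral_const]
        refine (setLIntegral_mono' (hE.compl.inter hF) fun ω hω => hω.2).trans ?_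
        exact lintegral_mono_set Set.inter_subset_left

end LinBandit
end

/-! ### Self-normalized and Chernoff bounds for the noise. -/

noncomputable section

namespace LinBandit

open ProbabilityTheory Filter Topology
open scoped ENNReal NNReal

variable {d : ℕ}

/-! ### Measurability of the statistics of the learner -/

section Measurability

variable {Ω : Type*} {mΩ : MeasurableSpace Ω}

lemma measurable_vec_apply {X : Ω → Vec d} (hX : Measurable X) (i : Fin d) :
    Measurable fun ω => X ω i :=
  ((EuclideanSpace.proj (𝕜 := ℝ) i).continuous.measurable).comp hX

lemma measurable_matrix_det {n : Type*} [Fintype n] [DecidableEq n] {A : Ω → Matrix n n ℝ}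
    (hA : ∀ i j, Measurable fun ω => A ω i j) : Measurable fun ω => (A ω).det := by
  simp_rw [Matrix.det_apply]
  refine Finset.measurable_sum _ fun σ _ => Measurable.const_smul ?_ _
  exact Finset.measurable_prod _ fun i _ => hA _ _

lemma measurable_matrix_inv {n : Type*} [Fintype n] [DecidableEq n] {A : Ω → Matrix n n ℝ}
    (hA : ∀ i j, Measurable fun ω => A ω i j) (i j : n) : Measurable fun ω => (A ω)⁻¹ i j := by
  simp_rw [Matrix.inv_def, Ring.inverse_eq_inv', Matrix.smul_apply, smul_eq_mul,
    Matrix.adjugate_apply]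
  refine (measurable_matrix_det hA).inv.mul (measurable_matrix_det fun k l => ?_)
  simp only [Matrix.updateRow_apply]
  split_ifs
  · exact measurable_const
  · exact hA _ _

variable {a : ℕ → Ω → Vec d} {t : ℕ} (ha : ∀ s < t, Measurable (a s))
include ha

lemma measurable_designMatrix (lam : ℝ) (i j : Fin d) :
    Measurable fun ω => designMatrix lam (fun s => a s ω) t i j := by
  simp only [designMatrix, Matrix.add_apply, Matrix.sum_apply, Matrix.vecMulVec_apply]
  refine measurable_const.add (Finset.measurable_sum _ fun s hs => ?_)
  have := ha s (Finset.mem_range.1 hs)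
  exact (measurable_vec_apply this i).mul (measurable_vec_apply this j)

lemma measurable_logDet (lam : ℝ) : Measurable fun ω => logDet lam (fun s => a s ω) t :=
  Real.measurable_log.comp ((measurable_matrix_det (measurable_designMatrix ha lam)).div_const _)

lemma measurable_invForm (lam : ℝ) {X Y : Ω → Vec d} (hX : Measurable X) (hY : Measurable Y) :
    Measurable fun ω => invForm lam (fun s => a s ω) t (X ω) (Y ω) := by
  simp only [invForm, dotProduct, Matrix.mulVec]
  exact Finset.measurable_sum _ fun i _ => (measurable_vec_apply hX i).mul
    (Finset.measurable_sum _ fun j _ =>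
      (measurable_matrix_inv (measurable_designMatrix ha lam) i j).mul (measurable_vec_apply hY j))

end Measurability

variable {Ω : Type*} {m0 : MeasurableSpace Ω} {μ : Measure Ω} [IsProbabilityMeasure μ]

/-- The Gaussian computation with coefficients and weight known from the past, so that they may be
frozen while the noise is integrated. -/
lemma SubGaussianGiven.lintegral_quadratic_le {m : MeasurableSpace Ω} {R : ℝ} {X : Ω → ℝ}
    (hm : m ≤ m0) (hX : Measurable[m0] X) (h : SubGaussianGiven μ m R X) {W : Ω → ℝ≥0∞}
    (hW : Measurable[m] W) {p q : Ω → ℝ} (hp : Measurable[m] p) (hq : Measurable[m] q)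
    (hq0 : ∀ ω, 0 ≤ q ω) (hq1 : ∀ ω, q ω * R ^ 2 < 1) :
    ∫⁻ ω, W ω * ENNReal.ofReal (Real.exp (p ω * X ω + q ω * X ω ^ 2 / 2)) ∂μ ≤
      ∫⁻ ω, W ω * ENNReal.ofReal ((Real.sqrt (1 - q ω * R ^ 2))⁻¹ *
        Real.exp (p ω ^ 2 * R ^ 2 / (2 * (1 - q ω * R ^ 2)))) ∂μ := by
  refine SubGaussianGiven.lintegral_le hm hX h
    (f := fun ω y => W ω * ENNReal.ofReal (Real.exp (p ω * y + q ω * y ^ 2 / 2))) ?_ ?_ ?_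
  · have h1 : Measurable[m.prod inferInstance] fun z : Ω × ℝ => W z.1 := hW.comp measurable_fst
    have h2 : Measurable[m.prod inferInstance] fun z : Ω × ℝ => p z.1 := hp.comp measurable_fst
    have h3 : Measurable[m.prod inferInstance] fun z : Ω × ℝ => q z.1 := hq.comp measurable_fst
    have h4 : Measurable[m.prod inferInstance] fun z : Ω × ℝ => z.2 := measurable_snd
    exact h1.mul (ENNReal.measurable_ofReal.comp (Real.measurable_exp.comp
      ((h2.mul h4).add ((h3.mul (h4.pow_const 2)).div_const 2))))
  · exact hW.mul (ENNReal.measurable_ofReal.comp (((Real.continuous_sqrt.measurable.comp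
      (measurable_const.sub (hq.mul_const _))).inv).mul (Real.measurable_exp.comp
      (((hp.pow_const 2).mul_const _).div (measurable_const.mul
        (measurable_const.sub (hq.mul_const _)))))))
  · intro ω ρ hρ hsub
    rw [lintegral_const_mul _ (by fun_prop)]
    gcongr
    exact hsub.lintegral_exp_quadratic_le _ _ (hq0 ω) (hq1 ω)

/-- The self-normalized bound for vector-valued martingales: the noise collected until round `t` is
at most `R ^ 2 * (log det + 2 log (1 / δ))` in the squared norm of the inverse design matrix,
simultaneously for all `t`. -/
lemma self_normalized_bound {lam R : ℝ} (hlam : 0 < lam) (hR : 0 < R) (ℱ : Filtration ℕ m0)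
    (T : ℕ) {a : ℕ → Ω → Vec d} {ξ : ℕ → Ω → ℝ} (ha : ∀ t < T, Measurable[ℱ t] (a t))
    (hξ : ∀ t < T, Measurable[ℱ (t + 1)] (ξ t)) (hsub : ∀ t < T, SubGaussianGiven μ (ℱ t) R (ξ t))
    {δ : ℝ} (hδ : 0 < δ) :
    μ {ω | ∃ t ≤ T, R ^ 2 * (logDet lam (fun s => a s ω) t + 2 * Real.log (1 / δ)) <
      invForm lam (fun s => a s ω) t (∑ s ∈ Finset.range t, ξ s ω • a s ω)
        (∑ s ∈ Finset.range t, ξ s ω • a s ω)} ≤ ENNReal.ofReal δ := by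
  set Z : ℕ → Ω → Vec d := fun t ω => ∑ s ∈ Finset.range t, ξ s ω • a s ω with hZ
  set M : ℕ → Ω → ℝ≥0∞ := fun t ω => ENNReal.ofReal (Real.exp
    (invForm lam (fun s => a s ω) t (Z t ω) (Z t ω) / (2 * R ^ 2)
      - logDet lam (fun s => a s ω) t / 2)) with hMdef
  have ham : ∀ t ≤ T, ∀ s < t, Measurable[ℱ t] (a s) := fun t ht s hs =>
    (ha s (by omega)).mono (ℱ.mono hs.le) le_rfl
  have hZm : ∀ t ≤ T, Measurable[ℱ t] (Z t) := fun t ht =>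
    Finset.measurable_sum _ fun s hs => by
      have hs := Finset.mem_range.1 hs
      exact ((hξ s (by omega)).mono (ℱ.mono hs) le_rfl).smul (ham t ht s hs)
  have hM : ∀ t ≤ T, Measurable[ℱ t] (M t) := fun t ht =>
    ENNReal.measurable_ofReal.comp (Real.measurable_exp.comp
      (((measurable_invForm (ham t ht) lam (hZm t ht) (hZm t ht)).div_const _).sub
        ((measurable_logDet (ham t ht) lam).div_const _)))
  have hsup : ∀ t < T, ∀ B, MeasurableSet[ℱ t] B →
      ∫⁻ ω in B, M (t + 1) ω ∂μ ≤ ∫⁻ ω in B, M t ω ∂μ := by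
    intro t ht B hB
    set u : Ω → ℝ := fun ω => invForm lam (fun s => a s ω) t (a t ω) (a t ω) with hu
    set b : Ω → ℝ := fun ω => invForm lam (fun s => a s ω) t (a t ω) (Z t ω) with hb
    have hum : Measurable[ℱ t] u := measurable_invForm (ham t ht.le) lam (ha t ht) (ha t ht)
    have hbm : Measurable[ℱ t] b := measurable_invForm (ham t ht.le) lam (ha t ht) (hZm t ht.le)
    have hu0 : ∀ ω, 0 ≤ u ω := fun ω => invForm_self_nonneg hlam _ _ _
    -- The part of the next value that does not involve the new noise: the determinant update gives
    -- the square root, the norm update the negative exponent.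
    set W : Ω → ℝ≥0∞ := fun ω => B.indicator 1 ω * (M t ω * ENNReal.ofReal
      ((Real.sqrt (1 + u ω))⁻¹ * Real.exp (-(b ω ^ 2 / (2 * R ^ 2 * (1 + u ω)))))) with hW
    have hWm : Measurable[ℱ t] W :=
      (Measurable.indicator (@measurable_one _ _ _ (ℱ t) _) hB).mul ((hM t ht.le).mul (ENNReal.measurable_ofReal.comp
        ((Real.continuous_sqrt.measurable.comp (measurable_const.add hum)).inv.mul
          (Real.measurable_exp.comp ((hbm.pow_const 2).div
            (measurable_const.mul (measurable_const.add hum))).neg))))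
    have hB0 := ℱ.le t _ hB
    -- These coefficients of the new noise make 1 − qR² equal to 1/(1 + u), so the Gaussian bound is
    -- exactly the reciprocal of the correction in `W`.
    have hq := SubGaussianGiven.lintegral_quadratic_le (ℱ.le t)
      ((hξ t ht).mono (ℱ.le _) le_rfl) (hsub t ht) hWm
      (p := fun ω => b ω / (R ^ 2 * (1 + u ω))) (q := fun ω => u ω / (R ^ 2 * (1 + u ω)))
      (hbm.div (measurable_const.mul (measurable_const.add hum)))
      (hum.div (measurable_const.mul (measurable_const.add hum)))
      (fun ω => by have := hu0 ω; positivity)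
      (fun ω => by
        have := hu0 ω
        rw [div_mul_eq_mul_div, div_lt_one (by positivity)]
        nlinarith [sq_pos_of_pos hR])
    rw [← lintegral_indicator hB0, ← lintegral_indicator hB0]
    refine le_trans (le_of_eq (lintegral_congr fun ω => ?_))
      (hq.trans (le_of_eq (lintegral_congr fun ω => ?_)))
    · by_cases hω : ω ∈ B
      swap
      · simp [hW, hω]
      simp only [hW, Set.indicator_of_mem hω, Pi.one_apply, one_mul]
      have h1 := hu0 ω
      rw [hMdef]
      simp only
      rw [← ENNReal.ofReal_mul (Real.exp_pos _).le, ← ENNReal.ofReal_mul (by positivity)]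
      congr 1
      have hZs : Z (t + 1) ω = Z t ω + ξ t ω • a t ω := by
        simp [hZ, Finset.sum_range_succ]
      rw [hZs, invForm_succ_add_smul hlam, logDet_succ hlam]
      have hsq : (Real.sqrt (1 + u ω))⁻¹ = Real.exp (-(Real.log (1 + u ω) / 2)) := by
        rw [Real.exp_neg, ← Real.log_sqrt (by linarith), Real.exp_log (by positivity)]
      rw [hsq, ← Real.exp_add, ← Real.exp_add, ← Real.exp_add]
      congr 1
      change _ / (2 * R ^ 2) - (_ + Real.log (1 + u ω)) / 2 = _
      change (_ + (2 * ξ t ω * b ω + ξ t ω ^ 2 * u ω - b ω ^ 2) / (1 + u ω)) / (2 * R ^ 2) - _ = _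
      field_simp
      ring
    · by_cases hω : ω ∈ B
      swap
      · simp [hW, hω]
      simp only [hW, Set.indicator_of_mem hω, Pi.one_apply, one_mul]
      have h1 := hu0 ω
      have hR2 := sq_pos_of_pos hR
      rw [mul_assoc, ← ENNReal.ofReal_mul (by positivity)]
      have e1 : 1 - u ω / (R ^ 2 * (1 + u ω)) * R ^ 2 = (1 + u ω)⁻¹ := by
        field_simp; ring
      rw [e1, Real.sqrt_inv, inv_inv]
      have e2 : (b ω / (R ^ 2 * (1 + u ω))) ^ 2 * R ^ 2 / (2 * (1 + u ω)⁻¹) =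
          b ω ^ 2 / (2 * R ^ 2 * (1 + u ω)) := by
        field_simp
      rw [e2]
      have e3 : (Real.sqrt (1 + u ω))⁻¹ * Real.exp (-(b ω ^ 2 / (2 * R ^ 2 * (1 + u ω)))) *
          (Real.sqrt (1 + u ω) * Real.exp (b ω ^ 2 / (2 * R ^ 2 * (1 + u ω)))) = 1 := by
        have : Real.sqrt (1 + u ω) ≠ 0 := (Real.sqrt_pos.2 (by linarith)).ne'
        rw [Real.exp_neg]
        field_simp
      rw [e3, ENNReal.ofReal_one, mul_one]
  have hV := measure_exists_le_of_supermartingale (μ := μ) ℱ M T hM hsup (ENNReal.ofReal (1 / δ))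
  have hM0 : ∫⁻ ω, M 0 ω ∂μ = 1 := by
    have : ∀ ω, M 0 ω = 1 := fun ω => by
      simp [hMdef, hZ, logDet_zero hlam, invForm]
    simp [this]
  rw [hM0] at hV
  have hsubset : {ω | ∃ t ≤ T, R ^ 2 * (logDet lam (fun s => a s ω) t + 2 * Real.log (1 / δ)) <
      invForm lam (fun s => a s ω) t (Z t ω) (Z t ω)} ⊆
      {ω | ∃ t ≤ T, ENNReal.ofReal (1 / δ) ≤ M t ω} := by
    rintro ω ⟨t, ht, h⟩
    refine ⟨t, ht, ENNReal.ofReal_le_ofReal ?_⟩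
    rw [← Real.log_le_iff_le_exp (by positivity), le_sub_iff_add_le, le_div_iff₀ (by positivity)]
    linarith
  have h0 : ENNReal.ofReal δ * ENNReal.ofReal (1 / δ) = 1 := by
    rw [← ENNReal.ofReal_mul hδ.le, mul_one_div_cancel hδ.ne', ENNReal.ofReal_one]
  calc _ ≤ μ {ω | ∃ t ≤ T, ENNReal.ofReal (1 / δ) ≤ M t ω} := measure_mono hsubset
    _ = ENNReal.ofReal δ * (ENNReal.ofReal (1 / δ) *
        μ {ω | ∃ t ≤ T, ENNReal.ofReal (1 / δ) ≤ M t ω}) := by rw [← mul_assoc, h0, one_mul]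
    _ ≤ ENNReal.ofReal δ * 1 := by gcongr
    _ = _ := mul_one _

open Classical in
/-- A Chernoff bound for a sum of functions of conditionally sub-Gaussian variables over the
rounds that satisfy a predictable condition `P`. -/
lemma chernoff_bound_predictable {R : ℝ} (ℱ : Filtration ℕ m0) (T : ℕ) {X : ℕ → Ω → ℝ}
    (hX : ∀ t < T, Measurable[ℱ (t + 1)] (X t)) (hsub : ∀ t < T, SubGaussianGiven μ (ℱ t) R (X t))
    {P : ℕ → Ω → Prop} (hP : ∀ t < T, MeasurableSet[ℱ t] {ω | P t ω}) {φ : ℝ → ℝ}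
    (hφ : Measurable φ) {κ : ℝ} (hκ : ∀ ρ : Measure ℝ, IsProbabilityMeasure ρ →
      IsSubGaussianLaw R ρ → ∫⁻ y, ENNReal.ofReal (Real.exp (φ y)) ∂ρ ≤
        ENNReal.ofReal (Real.exp κ)) {δ : ℝ} (hδ : 0 < δ) :
    μ {ω | κ * ((Finset.range T).filter (fun s => P s ω)).card + Real.log (1 / δ) <
      ∑ s ∈ (Finset.range T).filter (fun s => P s ω), φ (X s ω)} ≤ ENNReal.ofReal δ := by
  -- Selected rounds are centred by `κ` and the others contribute nothing. The selection is known
  -- before the noise, so exp Y is a supermartingale.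
  set Y : ℕ → Ω → ℝ := fun t ω => ∑ s ∈ Finset.range t, if P s ω then φ (X s ω) - κ else 0
    with hY
  set M : ℕ → Ω → ℝ≥0∞ := fun t ω => ENNReal.ofReal (Real.exp (Y t ω)) with hMdef
  have hM : ∀ t ≤ T, Measurable[ℱ t] (M t) := fun t ht =>
    ENNReal.measurable_ofReal.comp (Real.measurable_exp.comp (Finset.measurable_sum _
      fun s hs => by
        have hs := Finset.mem_range.1 hs
        exact Measurable.ite (ℱ.mono hs.le _ (hP s (by omega)))
          ((hφ.comp ((hX s (by omega)).mono (ℱ.mono hs) le_rfl)).sub_const _) measurable_const))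
  have hsup : ∀ t < T, ∀ B, MeasurableSet[ℱ t] B →
      ∫⁻ ω in B, M (t + 1) ω ∂μ ≤ ∫⁻ ω in B, M t ω ∂μ := by
    intro t ht B hB
    have hB0 := ℱ.le t _ hB
    have key := SubGaussianGiven.lintegral_le (ℱ.le t) ((hX t ht).mono (ℱ.le _) le_rfl)
      (hsub t ht) (f := fun ω y => B.indicator (M t) ω *
        ENNReal.ofReal (Real.exp (if P t ω then φ y - κ else 0))) (g := B.indicator (M t)) ?_ ?_ ?_
    · rw [← lintegral_indicator hB0, ← lintegral_indicator hB0]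
      refine le_trans (le_of_eq (lintegral_congr fun ω => ?_)) key
      by_cases hω : ω ∈ B
      swap
      · simp [hω]
      simp only [Set.indicator_of_mem hω]
      rw [hMdef]
      simp only
      rw [← ENNReal.ofReal_mul (Real.exp_pos _).le, ← Real.exp_add]
      congr 2
      simp [hY, Finset.sum_range_succ]
    · have h1 : Measurable[(ℱ t : MeasurableSpace Ω).prod inferInstance]
          fun z : Ω × ℝ => B.indicator (M t) z.1 :=
        ((hM t ht.le).indicator hB).comp measurable_fst
      have h4 : Measurable[(ℱ t : MeasurableSpace Ω).prod inferInstance]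
          fun z : Ω × ℝ => z.2 := measurable_snd
      have h5 : MeasurableSet[(ℱ t : MeasurableSpace Ω).prod inferInstance]
          {z : Ω × ℝ | P t z.1} :=
        (@measurable_fst Ω ℝ (ℱ t) _) (hP t ht)
      exact h1.mul (ENNReal.measurable_ofReal.comp (Real.measurable_exp.comp
        (Measurable.ite h5 ((hφ.comp h4).sub_const _) measurable_const)))
    · exact (hM t ht.le).indicator hB
    · intro ω ρ hρ hs
      rw [lintegral_const_mul _ (by split_ifs <;> fun_prop)]
      refine mul_le_of_le_one_right' ?_
      by_cases h : P t ω
      · simp only [if_pos h]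
        have : ∀ y, ENNReal.ofReal (Real.exp (φ y - κ)) =
            ENNReal.ofReal (Real.exp (-κ)) * ENNReal.ofReal (Real.exp (φ y)) := fun y => by
          rw [← ENNReal.ofReal_mul (Real.exp_pos _).le, ← Real.exp_add]
          congr 2; ring
        simp_rw [this]
        rw [lintegral_const_mul _ (by fun_prop)]
        refine (mul_le_mul_right (hκ ρ hρ hs) _).trans (le_of_eq ?_)
        rw [← ENNReal.ofReal_mul (Real.exp_pos _).le, ← Real.exp_add]
        simp
      · simp [h]
  have hV := measure_exists_le_of_supermartingale (μ := μ) ℱ M T hM hsup (ENNReal.ofReal (1 / δ))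
  have hM0 : ∫⁻ ω, M 0 ω ∂μ = 1 := by
    simp [hMdef, hY]
  rw [hM0] at hV
  have hsubset : {ω | κ * ((Finset.range T).filter (fun s => P s ω)).card + Real.log (1 / δ) <
      ∑ s ∈ (Finset.range T).filter (fun s => P s ω), φ (X s ω)} ⊆
      {ω | ∃ t ≤ T, ENNReal.ofReal (1 / δ) ≤ M t ω} := by
    intro ω h
    refine ⟨T, le_rfl, ENNReal.ofReal_le_ofReal ?_⟩
    rw [← Real.log_le_iff_le_exp (by positivity), hY]
    simp only
    rw [← Finset.sum_filter, Finset.sum_sub_distrib, Finset.sum_const, nsmul_eq_mul]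
    simp only [Set.mem_ofPred_eq] at h
    linarith
  have h0 : ENNReal.ofReal δ * ENNReal.ofReal (1 / δ) = 1 := by
    rw [← ENNReal.ofReal_mul hδ.le, mul_one_div_cancel hδ.ne', ENNReal.ofReal_one]
  calc _ ≤ μ {ω | ∃ t ≤ T, ENNReal.ofReal (1 / δ) ≤ M t ω} := measure_mono hsubset
    _ = ENNReal.ofReal δ * (ENNReal.ofReal (1 / δ) *
        μ {ω | ∃ t ≤ T, ENNReal.ofReal (1 / δ) ≤ M t ω}) := by rw [← mul_assoc, h0, one_mul]
    _ ≤ ENNReal.ofReal δ * 1 := by gcongr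
    _ = _ := mul_one _

end LinBandit
end

/-! ### Stability of the attackability index and the estimate of the parallel component. -/

noncomputable section

namespace LinBandit

open Filter Topology

variable {d : ℕ}

lemma ArmSet.dim_pos (S : ArmSet d) : 0 < d := by
  rcases Nat.eq_zero_or_pos d with rfl | h
  · exact absurd (Subsingleton.elim _ _) S.target_ne_zero
  · exact h

lemma ArmSet.norm_target_le (S : ArmSet d) : ‖S.target‖ ≤ 1 := S.norm_le_one _ S.target_mem

lemma ArmSet.norm_target_pos (S : ArmSet d) : 0 < ‖S.target‖ := norm_pos_iff.2 S.target_ne_zero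

lemma abs_inner_le_norm_of_norm_le_one {x v : Vec d} (hx : ‖x‖ ≤ 1) :
    |(inner ℝ x v : ℝ)| ≤ ‖v‖ :=
  (abs_real_inner_le_norm x v).trans (mul_le_of_le_one_left (norm_nonneg v) hx)

lemma CQPFeasible.inner_target {S : ArmSet d} {v w : Vec d} {ε : ℝ} (h : CQPFeasible S v ε w) :
    (inner ℝ S.target (v + w) : ℝ) = inner ℝ S.target v := by
  rw [inner_add_right, h.2.1, add_zero]

lemma CQPFeasible.initFeasible {S : ArmSet d} {v w : Vec d} {ε : ℝ} (h : CQPFeasible S v ε w) :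
    InitFeasible S ε (v + w) :=
  ⟨fun x hx hne => by rw [h.inner_target]; exact h.1 x hx hne, h.2.2⟩

lemma InitFeasible.le_two {S : ArmSet d} {θ₀ : Vec d} {ε : ℝ} (h : InitFeasible S ε θ₀) :
    ε ≤ 2 := by
  obtain ⟨x, hx, hne⟩ := S.exists_other
  have h1 := h.1 x hx hne
  have h2 := abs_le.1 ((abs_inner_le_norm_of_norm_le_one (v := θ₀) (S.norm_le_one x hx)).trans h.2)
  have h3 := abs_le.1 ((abs_inner_le_norm_of_norm_le_one (v := θ₀) S.norm_target_le).trans h.2)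
  linarith [h2.1, h3.2]

lemma bddAbove_cqp (S : ArmSet d) (v : Vec d) : BddAbove {ε : ℝ | ∃ w, CQPFeasible S v ε w} :=
  ⟨2, fun _ ⟨_, h⟩ => h.initFeasible.le_two⟩

lemma bddAbove_init (S : ArmSet d) : BddAbove {ε : ℝ | ∃ θ₀, InitFeasible S ε θ₀} :=
  ⟨2, fun _ ⟨_, h⟩ => h.le_two⟩

/-- The bound also covers the infeasible case, where the supremum of the empty set is 0. -/
lemma index_le_two (S : ArmSet d) (v : Vec d) : index S v ≤ 2 :=
  Real.sSup_le (fun _ ⟨_, h⟩ => h.initFeasible.le_two) zero_le_two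

lemma CQPFeasible.le_index {S : ArmSet d} {v w : Vec d} {ε : ℝ} (h : CQPFeasible S v ε w) :
    ε ≤ index S v :=
  le_csSup (bddAbove_cqp S v) ⟨w, h⟩

lemma cqp_nonempty_of_index_pos {S : ArmSet d} {v : Vec d} (h : 0 < index S v) :
    {ε : ℝ | ∃ w, CQPFeasible S v ε w}.Nonempty := by
  by_contra h0
  rw [Set.not_nonempty_iff_eq_empty] at h0
  rw [index, h0, Real.sSup_empty] at h
  exact lt_irrefl _ h

/-- A feasible `w` gives the initial parameter v + w. Positivity excludes the default value 0 of an
infeasible program. -/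
lemma index_le_initIndex {S : ArmSet d} {v : Vec d} (h : 0 < index S v) :
    index S v ≤ initIndex S :=
  csSup_le (cqp_nonempty_of_index_pos h) fun _ ⟨w, hw⟩ =>
    le_csSup (bddAbove_init S) ⟨v + w, hw.initFeasible⟩

/-- Inner products in the unit ball lie in [−1, 1]. This makes the set of feasible values nonempty
whenever `v` is in the ball. -/
lemma cqpFeasible_neg_two (S : ArmSet d) {v : Vec d} (hv : ‖v‖ ≤ 1) : CQPFeasible S v (-2) 0 := by
  refine ⟨fun x hx _ => ?_, by simp, by simpa using hv⟩
  have h2 := abs_le.1 ((abs_inner_le_norm_of_norm_le_one (v := v) (S.norm_le_one x hx)).trans hv)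
  have h3 := abs_le.1 ((abs_inner_le_norm_of_norm_le_one (v := v) S.norm_target_le).trans hv)
  rw [add_zero]
  linarith [h2.2, h3.1]

/-- Radius of the orthogonal section of the unit ball at `v`. -/
def sectionRadius (v : Vec d) : ℝ := Real.sqrt (1 - ‖v‖ ^ 2)

lemma norm_add_sq_of_orthogonal (S : ArmSet d) (c : ℝ) {w : Vec d}
    (hw : (inner ℝ S.target w : ℝ) = 0) :
    ‖c • S.target + w‖ ^ 2 = ‖c • S.target‖ ^ 2 + ‖w‖ ^ 2 := by
  have := norm_add_sq_real (c • S.target) w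
  rw [inner_smul_left, hw] at this
  simpa using this

/-- Quantitative semicontinuity of the index along the line of the target arm. -/
lemma index_sub_le (S : ArmSet d) {c c' : ℝ} (hc : ‖c • S.target‖ ≤ 1) (hc' : ‖c' • S.target‖ ≤ 1) :
    index S (c • S.target) - (2 * ‖c' • S.target - c • S.target‖ +
      |sectionRadius (c • S.target) - sectionRadius (c' • S.target)|) ≤ index S (c' • S.target) := by
  set u := c • S.target with hu
  set v := c' • S.target with hv
  rw [sub_le_iff_le_add]
  refine csSup_le ⟨-2, 0, cqpFeasible_neg_two S hc⟩ ?_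
  rintro ε ⟨w, hw⟩
  have hwr : ‖w‖ ≤ sectionRadius u := by
    refine Real.le_sqrt_of_sq_le ?_
    have h1 := norm_add_sq_of_orthogonal S c hw.2.1
    have h2 : ‖u + w‖ ^ 2 ≤ 1 := by
      have := hw.2.2
      nlinarith [norm_nonneg (u + w)]
    rw [← hu] at h1
    linarith
  -- Keep `w` if it fits into the section of the ball at `v`; otherwise shrink it radially onto the
  -- boundary of that section.
  obtain ⟨w', hw', hr, hd⟩ : ∃ w' : Vec d, (inner ℝ S.target w' : ℝ) = 0 ∧ ‖w'‖ ≤ sectionRadius v ∧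
      ‖w' - w‖ ≤ |sectionRadius u - sectionRadius v| := by
    by_cases h : ‖w‖ ≤ sectionRadius v
    · exact ⟨w, hw.2.1, h, by simp⟩
    · rw [not_le] at h
      have hr0 : 0 ≤ sectionRadius v := Real.sqrt_nonneg _
      have hw0 : 0 < ‖w‖ := hr0.trans_lt h
      have h1 : ‖(sectionRadius v / ‖w‖) • w‖ = sectionRadius v := by
        rw [norm_smul, Real.norm_of_nonneg (by positivity), div_mul_cancel₀ _ hw0.ne']
      refine ⟨(sectionRadius v / ‖w‖) • w, by rw [inner_smul_right, hw.2.1, mul_zero], h1.le, ?_⟩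
      have h2 : (sectionRadius v / ‖w‖) • w - w = (sectionRadius v / ‖w‖ - 1) • w := by
        rw [sub_smul, one_smul]
      rw [h2, norm_smul, Real.norm_eq_abs, ← abs_norm w, ← abs_mul, abs_norm, sub_mul,
        div_mul_cancel₀ _ hw0.ne', one_mul, abs_of_nonpos (by linarith), abs_of_nonneg (by linarith)]
      linarith
  -- Moving from `u` to `v` costs ‖v − u‖ once in the competing arm and once in the target;
  -- shrinking `w` costs the difference of the radii.
  have hf : CQPFeasible S v (ε - (2 * ‖v - u‖ + |sectionRadius u - sectionRadius v|)) w' := by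
    refine ⟨fun x hx hne => ?_, hw', ?_⟩
    · have h1 := hw.1 x hx hne
      have h2 := abs_le.1 (abs_inner_le_norm_of_norm_le_one (v := v - u) (S.norm_le_one x hx))
      have h3 := abs_le.1 (abs_inner_le_norm_of_norm_le_one (v := v - u) S.norm_target_le)
      have h4 := abs_le.1 (abs_inner_le_norm_of_norm_le_one (v := w' - w) (S.norm_le_one x hx))
      rw [inner_sub_right] at h2 h3 h4
      rw [inner_add_right] at h1 ⊢
      linarith [h2.2, h3.1, h4.2]
    · have h1 := norm_add_sq_of_orthogonal S c' hw'
      rw [← hv] at h1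
      have h2 : ‖w'‖ ^ 2 ≤ 1 - ‖v‖ ^ 2 := by
        rw [← Real.sq_sqrt (show 0 ≤ 1 - ‖v‖ ^ 2 by nlinarith [norm_nonneg v])]
        exact pow_le_pow_left₀ (norm_nonneg _) hr 2
      nlinarith [norm_nonneg (v + w')]
  linarith [hf.le_index]

/-- The modulus is continuous and vanishes at the base point. The section radius is not Lipschitz at
the unit sphere, so `κ` is left implicit. -/
lemma exists_nhds_index_close (S : ArmSet d) (c : ℝ) {ε : ℝ} (hε : 0 < ε) :
    ∃ κ > 0, ∀ c' : ℝ, ‖c' • S.target - c • S.target‖ ≤ κ →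
      2 * ‖c' • S.target - c • S.target‖ +
        |sectionRadius (c • S.target) - sectionRadius (c' • S.target)| < ε := by
  have hcont : Continuous fun v : Vec d =>
      2 * ‖v - c • S.target‖ + |sectionRadius (c • S.target) - sectionRadius v| := by
    unfold sectionRadius; fun_prop
  have h0 : 2 * ‖c • S.target - c • S.target‖ +
      |sectionRadius (c • S.target) - sectionRadius (c • S.target)| < ε := by simpa using hε
  obtain ⟨κ, hκ, h⟩ := Metric.continuous_iff.1 hcont (c • S.target) ε hε
  refine ⟨κ / 2, by positivity, fun c' hc' => ?_⟩
  have := h (c' • S.target) (by rw [dist_eq_norm]; linarith)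
  rw [Real.dist_eq] at this
  have h2 := (abs_lt.1 this).2
  simp only [sub_self, norm_zero, mul_zero, abs_zero, add_zero, sub_zero] at h2
  linarith

/-- If the index is negative then it is not positive at nearby points of the line. -/
lemma exists_nhds_not_index_pos (S : ArmSet d) (c : ℝ) (hc : ‖c • S.target‖ ≤ 1)
    (h : index S (c • S.target) < 0) :
    ∃ κ > 0, ∀ c' : ℝ, ‖c' • S.target - c • S.target‖ ≤ κ → ¬ 0 < index S (c' • S.target) := by
  obtain ⟨κ, hκ, hcl⟩ := exists_nhds_index_close S c (neg_pos.2 h)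
  refine ⟨κ, hκ, fun c' hc' hpos => ?_⟩
  -- An infeasible program has value 0, so a positive value certifies a feasible pair and hence a
  -- point in the ball. No interior assumption on the base point is needed.
  have h1 : ‖c' • S.target‖ ≤ 1 := by
    obtain ⟨ε, w, hw⟩ := cqp_nonempty_of_index_pos hpos
    have h1 := norm_add_sq_of_orthogonal S c' hw.2.1
    have := hw.2.2
    nlinarith [norm_nonneg (c' • S.target + w), norm_nonneg (c' • S.target), sq_nonneg ‖w‖]
  have h2 := index_sub_le S h1 hc
  have h3 := hcl c' hc'
  rw [norm_sub_rev, abs_sub_comm] at h2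
  linarith

/-- If the index is positive inside the ball, then it is bounded below at nearby points. -/
lemma exists_nhds_half_index_le (S : ArmSet d) (c : ℝ) (hc : ‖c • S.target‖ < 1)
    (h : 0 < index S (c • S.target)) :
    ∃ κ > 0, ∀ c' : ℝ, ‖c' • S.target - c • S.target‖ ≤ κ →
      index S (c • S.target) / 2 ≤ index S (c' • S.target) := by
  obtain ⟨κ, hκ, hcl⟩ := exists_nhds_index_close S c (half_pos h)
  -- The second entry keeps nearby points inside the ball; an estimate outside would make the
  -- program infeasible.
  refine ⟨min κ (1 - ‖c • S.target‖), lt_min hκ (by linarith), fun c' hc' => ?_⟩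
  have h1 : ‖c' • S.target‖ ≤ 1 := by
    have := norm_le_norm_add_norm_sub' (c' • S.target) (c • S.target)
    linarith [hc'.trans (min_le_right _ _)]
  have h2 := index_sub_le S hc.le h1
  have h3 := hcl c' (hc'.trans (min_le_left _ _))
  linarith

/-! ### The estimate of the parallel component -/

lemma norm_parPart_le (S : ArmSet d) (θ : Vec d) : ‖parPart S θ‖ ≤ ‖θ‖ := by
  have h := S.norm_target_pos
  rw [parPart, norm_smul, Real.norm_eq_abs, abs_div, abs_of_pos (pow_pos h 2), div_mul_eq_mul_div,
    div_le_iff₀ (by positivity)]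
  have := abs_real_inner_le_norm S.target θ
  nlinarith

lemma inner_target_smul_target (S : ArmSet d) (c : ℝ) :
    (inner ℝ S.target (c • S.target) : ℝ) = c * ‖S.target‖ ^ 2 := by
  rw [inner_smul_right, real_inner_self_eq_norm_sq]

open Classical in
/-- Total noise of the environment on the target arm before round `T₁`. -/
def targetNoise (S : ArmSet d) (T₁ : ℕ) (a : ℕ → Vec d) (η : ℕ → ℝ) : ℝ :=
  ∑ s ∈ (Finset.range T₁).filter (fun s => a s = S.target), η s

lemma estPar_eq (S : ArmSet d) (θ : Vec d) (T₁ : ℕ) (a : ℕ → Vec d) (η : ℕ → ℝ)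
    (hn : 0 < targetCount S a T₁) :
    estPar S T₁ a (trueReward θ a η) = ((inner ℝ S.target θ +
      targetNoise S T₁ a η / targetCount S a T₁) / ‖S.target‖ ^ 2) • S.target := by
  classical
  have h := S.norm_target_pos
  have hn' : (0 : ℝ) < targetCount S a T₁ := by exact_mod_cast hn
  rw [estPar]
  congr 1
  have : ∑ s ∈ (Finset.range T₁).filter (fun s => a s = S.target), trueReward θ a η s =
      targetCount S a T₁ * inner ℝ S.target θ + targetNoise S T₁ a η := by
    unfold trueReward
    rw [Finset.sum_add_distrib, targetNoise]
    congr 1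
    rw [targetCount, ← nsmul_eq_mul, ← Finset.sum_const]
    refine Finset.sum_congr rfl fun s hs => ?_
    rw [(Finset.mem_filter.1 hs).2]
  rw [this]
  field_simp

lemma norm_estPar_sub_parPart (S : ArmSet d) (θ : Vec d) (T₁ : ℕ) (a : ℕ → Vec d) (η : ℕ → ℝ)
    (hn : 0 < targetCount S a T₁) :
    ‖estPar S T₁ a (trueReward θ a η) - parPart S θ‖ =
      |targetNoise S T₁ a η / targetCount S a T₁| / ‖S.target‖ := by
  have h := S.norm_target_pos
  rw [estPar_eq S θ T₁ a η hn, parPart, ← sub_smul, ← sub_div, add_sub_cancel_left, norm_smul,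
    Real.norm_eq_abs, abs_div, abs_of_pos (pow_pos h 2)]
  field_simp

lemma inner_target_estPar (S : ArmSet d) (θ : Vec d) (T₁ : ℕ) (a : ℕ → Vec d) (η : ℕ → ℝ)
    (hn : 0 < targetCount S a T₁) :
    (inner ℝ S.target (estPar S T₁ a (trueReward θ a η)) : ℝ) = inner ℝ S.target θ +
      targetNoise S T₁ a η / targetCount S a T₁ := by
  have h := S.norm_target_pos
  rw [estPar_eq S θ T₁ a η hn, inner_target_smul_target, div_mul_cancel₀ _ (by positivity)]

end LinBandit
end

/-! ### Confidence widths and the counting of poorly explored pulls. -/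

noncomputable section

namespace LinBandit

open Filter Topology Matrix

variable {d : ℕ}

/-- The exploration part of the confidence radius. -/
def baseRadius (d : ℕ) (R lam δ : ℝ) (t : ℕ) : ℝ :=
  R * Real.sqrt (d * Real.log ((1 + t / lam) / δ))

/-- The radius of the self-normalized bound at failure probability `exp (-L)`. -/
def noiseRadius (R lam L : ℝ) (a : ℕ → Vec d) (t : ℕ) : ℝ :=
  R * Real.sqrt (logDet lam a t + 2 * L)

/-- A bound for the total width of the confidence intervals up to round `t`. -/
def totalWidth (d : ℕ) (R lam δ L : ℝ) (t : ℕ) : ℝ :=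
  baseRadius d R lam δ t + R * Real.sqrt (d * Real.log (1 + t / lam) + 2 * L) + 2 * Real.sqrt lam

/-- The noise `ξ` obeys the self-normalized bound at round `t`. -/
def NoiseBounded (R lam L : ℝ) (a : ℕ → Vec d) (ξ : ℕ → ℝ) (t : ℕ) : Prop :=
  invForm lam a t (∑ s ∈ Finset.range t, ξ s • a s) (∑ s ∈ Finset.range t, ξ s • a s) ≤
    R ^ 2 * (logDet lam a t + 2 * L)

section

variable {lam : ℝ} (hlam : 0 < lam)
include hlam

lemma one_le_one_add_div (t : ℕ) : (1 : ℝ) ≤ 1 + t / lam :=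
  le_add_of_nonneg_right (by positivity)

lemma log_div_ge {δ : ℝ} (hδ : 0 < δ) (hδ1 : δ < 1) (t : ℕ) :
    Real.log (1 + t / lam) ≤ Real.log ((1 + t / lam) / δ) := by
  have := one_le_one_add_div hlam t
  exact Real.log_le_log (by linarith) (by rw [le_div_iff₀ hδ]; nlinarith)

/-- The left side is the determinant of A + t xxᵀ, whose trace is at most dλ + 2t. Thus a nearly
maximal det A forces the norm of every `x` to be O(1/√t). -/
lemma det_mul_le (hd : 0 < d) (a : ℕ → Vec d) (t : ℕ) (ha : ∀ s < t, ‖a s‖ ≤ 1) {x : Vec d}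
    (hx : ‖x‖ ≤ 1) :
    (designMatrix lam a t).det * (1 + t * invForm lam a t x x) ≤ (lam + 2 * t) ^ d := by
  set u : Fin d → ℝ := Real.sqrt t • x.ofLp with hu
  have hA := designMatrix_posDef hlam a t
  have h1 := det_add_vecMulVec hA u
  have h2 : u ⬝ᵥ (designMatrix lam a t)⁻¹ *ᵥ u = t * invForm lam a t x x := by
    rw [hu, Matrix.mulVec_smul, dotProduct_smul, smul_dotProduct, smul_eq_mul, smul_eq_mul,
      ← mul_assoc, Real.mul_self_sqrt (Nat.cast_nonneg t)]
    rfl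
  rw [h2] at h1
  rw [← h1]
  have ht : (0 : ℝ) ≤ t := Nat.cast_nonneg t
  have h := posSemidef_det_le_pow (hA.posSemidef.add (posSemidef_vecMulVec_self u))
    (b := lam + 2 * t) (by
      have h3 := designMatrix_trace_le (lam := lam) a t ha
      have h4 : u ⬝ᵥ u ≤ t := by
        rw [hu, dotProduct_smul, smul_dotProduct, smul_eq_mul, smul_eq_mul,
          ← mul_assoc, Real.mul_self_sqrt ht, dotProduct_self_eq_norm_sq]
        have : ‖x‖ ^ 2 ≤ 1 := by nlinarith [norm_nonneg x]
        nlinarith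
      rw [Matrix.trace_add, Matrix.trace_vecMulVec, Fintype.card_fin]
      have : (1 : ℝ) ≤ d := by exact_mod_cast hd
      nlinarith)
  simpa using h

/-- The bonus of the learner covers the deviation of the estimate, up to a small error at late
rounds. -/
lemma exists_noiseRadius_sub_le {R δ L ε : ℝ} (hd : 0 < d) (hR : 0 < R) (hδ : 0 < δ) (hδ1 : δ < 1)
    (hL : 0 ≤ L) (hε : 0 < ε) :
    ∃ t₀ : ℕ, ∀ t ≥ t₀, ∀ a : ℕ → Vec d, (∀ s < t, ‖a s‖ ≤ 1) → ∀ x : Vec d, ‖x‖ ≤ 1 →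
      (noiseRadius R lam L a t - baseRadius d R lam δ t) * invNorm lam a t x ≤ ε := by
  set K : ℝ := 2 ^ d * Real.exp (2 * L) with hK
  have hK0 : 0 < K := by positivity
  obtain ⟨t₀, ht₀⟩ := exists_nat_ge ((R ^ 2 * (2 * L)) * K / ε ^ 2 + 1)
  refine ⟨t₀, fun t ht a ha x hx => ?_⟩
  have htt : (t₀ : ℝ) ≤ t := by exact_mod_cast ht
  have ht1 : (R ^ 2 * (2 * L)) * K / ε ^ 2 + 1 ≤ t := ht₀.trans htt
  have htpos : (0 : ℝ) < t := by
    have : 0 ≤ (R ^ 2 * (2 * L)) * K / ε ^ 2 := by positivity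
    linarith
  have hN := invNorm_nonneg (lam := lam) a t x
  have hone := one_le_one_add_div hlam t
  set Y := d * Real.log ((1 + t / lam) / δ) with hY
  have hYlog : d * Real.log (1 + t / lam) ≤ Y := by
    have := log_div_ge hlam hδ hδ1 t
    rw [hY]; gcongr
  have hlog0 : 0 ≤ d * Real.log (1 + t / lam) :=
    mul_nonneg (Nat.cast_nonneg d) (Real.log_nonneg hone)
  -- In the first case the bonus dominates the deviation. In the second, log det is within 2L of its
  -- maximal order d log(1 + t/λ), so the design is nearly isotropic.
  rcases le_or_gt (logDet lam a t + 2 * L) Y with h | h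
  · refine le_trans (mul_nonpos_of_nonpos_of_nonneg ?_ hN) hε.le
    rw [noiseRadius, baseRadius, sub_nonpos, ← hY]
    gcongr
  have hdet : Real.exp (-(2 * L)) * (lam + t) ^ d ≤ (designMatrix lam a t).det := by
    have h1 : d * Real.log (1 + t / lam) - 2 * L ≤ logDet lam a t := by linarith
    rw [logDet, Real.le_log_iff_exp_le (div_pos (designMatrix_det_pos hlam a t) (by positivity)),
      le_div_iff₀ (by positivity), sub_eq_add_neg, Real.exp_add, ← Real.log_pow,
      Real.exp_log (by positivity)] at h1
    refine le_trans (le_of_eq ?_) h1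
    have : (1 + t / lam) ^ d * lam ^ d = (lam + t) ^ d := by
      rw [← mul_pow]; congr 1; field_simp
    rw [← this]; ring
  have hq0 := invForm_self_nonneg hlam a t x
  have hq : t * invForm lam a t x x ≤ K := by
    have h1 := det_mul_le hlam hd a t ha hx
    have h2 : (lam + 2 * t) ^ d ≤ 2 ^ d * (lam + t) ^ d := by
      rw [← mul_pow]
      exact pow_le_pow_left₀ (by positivity) (by linarith) d
    have h3 : Real.exp (-(2 * L)) * (lam + t) ^ d * (1 + t * invForm lam a t x x) ≤
        2 ^ d * (lam + t) ^ d :=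
      (mul_le_mul_of_nonneg_right hdet (by positivity)).trans (h1.trans h2)
    have h4 : Real.exp (-(2 * L)) * (1 + t * invForm lam a t x x) ≤ 2 ^ d := by
      refine le_of_mul_le_mul_right ?_ (show 0 < (lam + t) ^ d by positivity)
      linarith
    rw [Real.exp_neg, inv_mul_le_iff₀ (Real.exp_pos _)] at h4
    rw [hK]
    linarith
  have hdiff : noiseRadius R lam L a t - baseRadius d R lam δ t ≤ R * Real.sqrt (2 * L) := by
    rw [noiseRadius, baseRadius, ← hY, ← mul_sub]
    refine mul_le_mul_of_nonneg_left ?_ hR.le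
    rw [sub_le_iff_le_add, add_comm]
    have h1 := logDet_le hlam hd a t ha
    refine Real.sqrt_le_iff.2 ⟨by positivity, ?_⟩
    rw [add_sq, Real.sq_sqrt (by linarith), Real.sq_sqrt (by linarith)]
    have : 0 ≤ 2 * Real.sqrt (2 * L) * Real.sqrt Y := by positivity
    linarith
  refine (mul_le_mul_of_nonneg_right hdiff hN).trans (abs_le_of_sq_le_sq' ?_ hε.le).2
  rw [mul_pow, mul_pow, Real.sq_sqrt (by positivity), invNorm_sq hlam]
  have h5 : (R ^ 2 * (2 * L)) * K ≤ ε ^ 2 * t := by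
    have : (R ^ 2 * (2 * L)) * K / ε ^ 2 ≤ t := by linarith
    rwa [div_le_iff₀ (by positivity), mul_comm (t : ℝ)] at this
  refine le_of_mul_le_mul_right ?_ htpos
  calc R ^ 2 * (2 * L) * invForm lam a t x x * t
      = R ^ 2 * (2 * L) * (t * invForm lam a t x x) := by ring
    _ ≤ R ^ 2 * (2 * L) * K := by gcongr
    _ ≤ _ := h5

lemma radius_add_le_totalWidth {R δ L : ℝ} (hd : 0 < d) (hR : 0 < R) (hδ : 0 < δ)
    {t T : ℕ} (htT : t ≤ T) (a : ℕ → Vec d) (ha : ∀ s < t, ‖a s‖ ≤ 1) :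
    2 * Real.sqrt lam + noiseRadius R lam L a t + baseRadius d R lam δ t ≤
      totalWidth d R lam δ L T := by
  have hone := one_le_one_add_div hlam t
  have hle : (1 : ℝ) + t / lam ≤ 1 + T / lam := by gcongr
  have h1 : baseRadius d R lam δ t ≤ baseRadius d R lam δ T := by
    unfold baseRadius
    gcongr
  have h2 : noiseRadius R lam L a t ≤ R * Real.sqrt (d * Real.log (1 + T / lam) + 2 * L) := by
    unfold noiseRadius
    refine mul_le_mul_of_nonneg_left (Real.sqrt_le_sqrt ?_) hR.le
    have := logDet_le hlam hd a t ha
    have h3 : d * Real.log (1 + t / lam) ≤ d * Real.log (1 + T / lam) := by gcongr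
    linarith
  rw [totalWidth]
  linarith

/-- The gap of a pulled arm is at most the sum of the confidence widths, when the rewards come from
`θ` up to the noise `ξ` and a corruption. -/
lemma gap_le_of_ucb_le {R δ L g : ℝ} (hR : 0 < R) (a : ℕ → Vec d)
    (y ξ : ℕ → ℝ) (t : ℕ) {x z θ : Vec d} (hθ : ‖θ‖ ≤ 1) (hG : NoiseBounded R lam L a ξ t)
    (hc : ∀ v ∈ ({x, z} : Set (Vec d)), |∑ s ∈ Finset.range t,
      (y s - ξ s - inner ℝ (a s) θ) * invForm lam a t v (a s)| ≤ g * invNorm lam a t v)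
    (hucb : ucb R lam δ a y t x ≤ ucb R lam δ a y t z) :
    inner ℝ x θ - inner ℝ z θ ≤
      (noiseRadius R lam L a t - baseRadius d R lam δ t) * invNorm lam a t x
      + g * invNorm lam a t x
      + (2 * Real.sqrt lam + noiseRadius R lam L a t + baseRadius d R lam δ t + g)
        * invNorm lam a t z := by
  set Z := ∑ s ∈ Finset.range t, ξ s • a s with hZ
  have hn : invNorm lam a t Z ≤ noiseRadius R lam L a t := by
    rw [noiseRadius, ← Real.sqrt_sq hR.le, ← Real.sqrt_mul (sq_nonneg R)]
    exact Real.sqrt_le_sqrt hG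
  have herr : ∀ v ∈ ({x, z} : Set (Vec d)),
      |inner ℝ v (ridge lam a y t) - inner ℝ v θ| ≤
        (Real.sqrt lam + noiseRadius R lam L a t + g) * invNorm lam a t v := by
    intro v hv
    rw [inner_ridge_sub hlam a y ξ t v θ]
    have h1 := abs_lam_mul_invForm_le hlam a t v θ hθ
    have h2 := abs_invForm_le hlam a t v Z
    have h3 := hc v hv
    have h4 := mul_le_mul_of_nonneg_left hn (invNorm_nonneg (lam := lam) a t v)
    refine (abs_add_le _ _).trans ((add_le_add_left (abs_add_le _ _) _).trans ?_)
    rw [abs_neg]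
    linarith
  -- For `x` the √λ in the bonus cancels the regularization error; for `z` the two add up, whence
  -- the factor 2.
  have hx := abs_le.1 (herr x (by simp))
  have hz := abs_le.1 (herr z (by simp))
  rw [ucb, ucb, confRadius] at hucb
  change _ + (baseRadius d R lam δ t + _) * _ ≤ _ + (baseRadius d R lam δ t + _) * _ at hucb
  linarith [hx.1, hz.2]

/-- Counting rounds in which the pulled arm is insufficiently explored. -/
lemma card_mul_sq_le {c W : ℝ} (hd : 0 < d) (hc : 0 < c) (a : ℕ → Vec d) (T : ℕ)
    (ha : ∀ s < T, ‖a s‖ ≤ 1) {J : Finset ℕ} (hJ : J ⊆ Finset.range T)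
    (h : ∀ t ∈ J, c ≤ W * invNorm lam a t (a t)) :
    J.card * c ^ 2 ≤ W ^ 2 * ((1 + 1 / lam) * (d * Real.log (1 + T / lam))) := by
  calc J.card * c ^ 2 = ∑ t ∈ J, c ^ 2 := by rw [Finset.sum_const, nsmul_eq_mul]
    _ ≤ ∑ t ∈ J, W ^ 2 * invForm lam a t (a t) (a t) := by
        refine Finset.sum_le_sum fun t ht => ?_
        rw [← invNorm_sq hlam, ← mul_pow]
        exact pow_le_pow_left₀ hc.le (h t ht) 2
    _ ≤ ∑ t ∈ Finset.range T, W ^ 2 * invForm lam a t (a t) (a t) :=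
        Finset.sum_le_sum_of_subset_of_nonneg hJ fun t _ _ =>
          mul_nonneg (sq_nonneg _) (invForm_self_nonneg hlam a t _)
    _ = W ^ 2 * ∑ t ∈ Finset.range T, invForm lam a t (a t) (a t) := by rw [Finset.mul_sum]
    _ ≤ _ := by
        gcongr
        refine (sum_invForm_le hlam a T ha).trans ?_
        gcongr
        exact logDet_le hlam hd a T ha

/-- Interpolates the squared count with the trivial bound |J| ≤ T, which trades 1/c² for √T/c. This
is the origin of the single power of 1/ε* in the rate. -/
lemma card_mul_le {c W : ℝ} (hd : 0 < d) (hc : 0 < c) (hW : 0 ≤ W) (a : ℕ → Vec d) (T : ℕ)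
    (ha : ∀ s < T, ‖a s‖ ≤ 1) {J : Finset ℕ} (hJ : J ⊆ Finset.range T)
    (h : ∀ t ∈ J, c ≤ W * invNorm lam a t (a t)) :
    J.card * c ≤ W * Real.sqrt (T * ((1 + 1 / lam) * (d * Real.log (1 + T / lam)))) := by
  have h1 := card_mul_sq_le hlam hd hc a T ha hJ h
  have h2 : (J.card : ℝ) ≤ T := by
    have := Finset.card_le_card hJ
    rw [Finset.card_range] at this
    exact_mod_cast this
  have h3 : 0 ≤ (1 + 1 / lam) * (d * Real.log (1 + T / lam)) :=
    mul_nonneg (by positivity) (mul_nonneg (Nat.cast_nonneg d)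
      (Real.log_nonneg (one_le_one_add_div hlam T)))
  refine (abs_le_of_sq_le_sq' ?_ (mul_nonneg hW (Real.sqrt_nonneg _))).2
  rw [mul_pow W, Real.sq_sqrt (by positivity)]
  calc (J.card * c) ^ 2 = J.card * (J.card * c ^ 2) := by ring
    _ ≤ T * (W ^ 2 * ((1 + 1 / lam) * (d * Real.log (1 + T / lam)))) := by
        gcongr
    _ = _ := by ring

/-- Since log x = o(x^(1/4)), a squared logarithm is o(√x); constants are absorbed into the
logarithm first. -/
lemma exists_log_sq_le_sqrt (A B : ℝ) {c : ℝ} (hc : 0 < c) :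
    ∃ τ₀ : ℕ, ∀ τ ≥ τ₀, A * (Real.log (1 + (τ : ℕ) / lam) + B) ^ 2 ≤ c * Real.sqrt τ := by
  have h1 : (fun x : ℝ => Real.log x + (Real.log (1 + 1 / lam) + |B|)) =o[atTop]
      fun x => x ^ (1 / 4 : ℝ) :=
    (isLittleO_log_rpow_atTop (by norm_num)).add
      (Asymptotics.isLittleO_const_left.2 (Or.inr
        (tendsto_norm_atTop_atTop.comp (tendsto_rpow_atTop (by norm_num)))))
  have h2 := (h1.pow (n := 2) two_pos).comp_tendsto tendsto_natCast_atTop_atTop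
  have h3 := (h2.const_mul_left (|A|)).def hc
  obtain ⟨τ₀, hτ₀⟩ := eventually_atTop.1 h3
  refine ⟨max τ₀ 1, fun τ hτ => ?_⟩
  have h4 := hτ₀ τ ((le_max_left _ _).trans hτ)
  have hτ1 : (1 : ℝ) ≤ τ := by exact_mod_cast (le_max_right _ _).trans hτ
  simp only [Function.comp_apply] at h4
  have e1 : ((τ : ℝ) ^ (1 / 4 : ℝ)) ^ 2 = Real.sqrt τ := by
    rw [← Real.rpow_natCast, ← Real.rpow_mul (by positivity), Real.sqrt_eq_rpow]
    norm_num
  rw [e1, Real.norm_of_nonneg (Real.sqrt_nonneg _), Real.norm_of_nonneg (by positivity)] at h4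
  refine le_trans ?_ h4
  have hl0 : 0 ≤ Real.log (1 + τ / lam) := Real.log_nonneg (one_le_one_add_div hlam τ)
  have hl : Real.log (1 + τ / lam) ≤ Real.log τ + Real.log (1 + 1 / lam) := by
    rw [← Real.log_mul (by positivity) (by positivity)]
    refine Real.log_le_log (by positivity) ?_
    rw [mul_add, mul_one, mul_one_div]
    linarith
  calc A * (Real.log (1 + τ / lam) + B) ^ 2 ≤ |A| * (Real.log (1 + τ / lam) + B) ^ 2 :=
        mul_le_mul_of_nonneg_right (le_abs_self A) (sq_nonneg _)
    _ ≤ _ := by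
        refine mul_le_mul_of_nonneg_left (sq_le_sq' ?_ ?_) (abs_nonneg A)
        · linarith [neg_abs_le B]
        · linarith [le_abs_self B]

end

end LinBandit
end

/-! ### LinUCB under consistent rewards, and the effect of the corruption. -/

noncomputable section

namespace LinBandit

variable {d : ℕ}

/-- The squared width is linear in the logarithm, so with one more logarithm from the elliptical
potential the number of bad pulls is of order log². -/
lemma totalWidth_sq_le {R lam δ L : ℝ} (hR : 0 < R) (hlam : 0 < lam) (hδ : 0 < δ) (hδ1 : δ < 1)
    (hL : 0 ≤ L) (t : ℕ) :
    totalWidth d R lam δ L t ^ 2 ≤ (3 * (2 * R ^ 2 * d + R ^ 2 + 4 * lam)) *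
      (Real.log (1 + t / lam) + (1 + Real.log (1 / δ) + 2 * L)) := by
  set l := Real.log (1 + t / lam) with hl
  have hl0 : 0 ≤ l := Real.log_nonneg (one_le_one_add_div hlam t)
  have hD : 0 ≤ Real.log (1 / δ) := Real.log_nonneg (by rw [le_div_iff₀ hδ]; linarith)
  have hld : Real.log ((1 + t / lam) / δ) = l + Real.log (1 / δ) := by
    have := one_le_one_add_div hlam t
    rw [div_eq_mul_one_div, Real.log_mul (by linarith) (by positivity)]
  have h1 : baseRadius d R lam δ t ^ 2 = R ^ 2 * (d * (l + Real.log (1 / δ))) := by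
    rw [baseRadius, hld, mul_pow, Real.sq_sqrt (by positivity)]
  have h2 : (R * Real.sqrt (d * l + 2 * L)) ^ 2 = R ^ 2 * (d * l + 2 * L) := by
    rw [mul_pow, Real.sq_sqrt (by positivity)]
  have h3 : (2 * Real.sqrt lam) ^ 2 = 4 * lam := by
    rw [mul_pow, Real.sq_sqrt hlam.le]; norm_num
  rw [totalWidth]
  set x := baseRadius d R lam δ t
  set y := R * Real.sqrt (d * l + 2 * L)
  set z := 2 * Real.sqrt lam
  have h4 : (x + y + z) ^ 2 ≤ 3 * (x ^ 2 + y ^ 2 + z ^ 2) := by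
    nlinarith [sq_nonneg (x - y), sq_nonneg (y - z), sq_nonneg (x - z)]
  refine h4.trans ?_
  rw [h1, h2, h3]
  have e1 : 0 ≤ R ^ 2 * d := by positivity
  have e2 : 0 ≤ R ^ 2 := by positivity
  nlinarith [mul_nonneg e1 hL, mul_nonneg e1 hD, mul_nonneg e1 hl0, mul_nonneg e2 hL,
    mul_nonneg e2 hD, mul_nonneg e2 hl0, mul_nonneg hlam.le hL, mul_nonneg hlam.le hD,
    mul_nonneg hlam.le hl0]

lemma IsLinUCB.mono {S : ArmSet d} {R lam δ : ℝ} {T T' : ℕ} {a : ℕ → Vec d} {y : ℕ → ℝ}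
    (h : IsLinUCB S R lam δ T a y) (hT : T' ≤ T) : IsLinUCB S R lam δ T' a y :=
  fun t ht => h t (by omega)

lemma IsLinUCB.norm_le {S : ArmSet d} {R lam δ : ℝ} {T : ℕ} {a : ℕ → Vec d} {y : ℕ → ℝ}
    (h : IsLinUCB S R lam δ T a y) {t : ℕ} (ht : t ≤ T) : ∀ s < t, ‖a s‖ ≤ 1 :=
  fun s hs => S.norm_le_one _ (h s (by omega)).1

/-- If all rewards come from a parameter that favours the target arm, then LinUCB pulls the other
arms rarely. -/
lemma exists_nonTargetCount_le_sqrt (S : ArmSet d) {R lam δ L ε₀ c : ℝ} (hR : 0 < R)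
    (hlam : 0 < lam) (hδ : 0 < δ) (hδ1 : δ < 1) (hL : 0 ≤ L) (hε₀ : 0 < ε₀) (hc : 0 < c) :
    ∃ τ₀ : ℕ, ∀ τ ≥ τ₀, ∀ θ₀ : Vec d, InitFeasible S ε₀ θ₀ → ∀ (a : ℕ → Vec d) (y ξ : ℕ → ℝ),
      IsLinUCB S R lam δ τ a y → (∀ t < τ, NoiseBounded R lam L a ξ t) →
      (∀ s < τ, y s = inner ℝ (a s) θ₀ + ξ s) →
      (nonTargetCount S a τ : ℝ) ≤ c * Real.sqrt τ := by
  classical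
  -- Half of the gap pays for the shortfall of the bonus at the target; the other half must be
  -- covered by the width of the pulled arm.
  obtain ⟨t₀, ht₀⟩ := exists_noiseRadius_sub_le hlam S.dim_pos hR hδ hδ1 hL (half_pos hε₀)
  set K : ℝ := 3 * (2 * R ^ 2 * d + R ^ 2 + 4 * lam) with hK
  have hK0 : 0 ≤ K := by positivity
  have hD : 0 ≤ Real.log (1 / δ) := Real.log_nonneg (by rw [le_div_iff₀ hδ]; linarith)
  set B : ℝ := 1 + Real.log (1 / δ) + 2 * L with hB
  have hB1 : 1 ≤ B := by rw [hB]; linarith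
  -- The coefficient collects the `t₀` initial rounds, which are simply given away, and the
  -- elliptical count of the later ones.
  obtain ⟨τ₀, hτ₀⟩ := exists_log_sq_le_sqrt hlam
    (t₀ + K * ((1 + 1 / lam) * d) / (ε₀ / 2) ^ 2) B hc
  refine ⟨τ₀, fun τ hτ θ₀ hθ₀ a y ξ hucb hG hy => ?_⟩
  refine le_trans ?_ (hτ₀ τ hτ)
  have hl0 : 0 ≤ Real.log (1 + τ / lam) := Real.log_nonneg (one_le_one_add_div hlam τ)
  set l := Real.log (1 + τ / lam) with hl
  set J := (Finset.range τ).filter (fun s => t₀ ≤ s ∧ a s ≠ S.target) with hJ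
  have hJcard := card_mul_sq_le hlam (W := totalWidth d R lam δ L τ) S.dim_pos (half_pos hε₀) a τ
    (hucb.norm_le le_rfl) (J := J) (Finset.filter_subset _ _) (by
      intro t ht
      rw [hJ, Finset.mem_filter, Finset.mem_range] at ht
      obtain ⟨htτ, htt, hne⟩ := ht
      have ha := hucb.norm_le htτ.le
      have h1 := gap_le_of_ucb_le (g := 0) (x := S.target) hlam hR a y ξ t hθ₀.2 (hG t htτ)
        (fun v _ => by
          rw [Finset.sum_eq_zero, abs_zero, zero_mul]
          intro s hs
          rw [hy s ((Finset.mem_range.1 hs).trans htτ)]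
          ring)
        ((hucb t htτ).2 _ S.target_mem)
      have h2 := hθ₀.1 _ (hucb t htτ).1 hne
      have h3 := ht₀ t htt a ha S.target S.norm_target_le
      have h4 := mul_le_mul_of_nonneg_right
        (radius_add_le_totalWidth (L := L) hlam S.dim_pos hR hδ htτ.le a ha)
        (invNorm_nonneg (lam := lam) a t (a t))
      linarith)
  have hcount : (nonTargetCount S a τ : ℝ) ≤ t₀ + J.card := by
    have : nonTargetCount S a τ ≤ (Finset.range t₀ ∪ J).card := by
      refine Finset.card_le_card fun s hs => ?_
      rw [Finset.mem_filter] at hs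
      rw [Finset.mem_union, hJ, Finset.mem_filter, Finset.mem_range]
      by_cases h : s < t₀
      · exact Or.inl h
      · exact Or.inr ⟨hs.1, not_lt.1 h, hs.2⟩
    have h2 := this.trans (Finset.card_union_le _ _)
    rw [Finset.card_range] at h2
    exact_mod_cast h2
  have hW := totalWidth_sq_le (d := d) hR hlam hδ hδ1 hL τ
  rw [← hl, ← hB, ← hK] at hW
  have h5 : J.card * (ε₀ / 2) ^ 2 ≤ K * ((1 + 1 / lam) * d) * (l + B) ^ 2 := by
    refine hJcard.trans ?_
    calc totalWidth d R lam δ L τ ^ 2 * ((1 + 1 / lam) * (d * l))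
        ≤ (K * (l + B)) * ((1 + 1 / lam) * (d * (l + B))) := by
          gcongr
          linarith
      _ = _ := by ring
  have h6 : (J.card : ℝ) ≤ K * ((1 + 1 / lam) * d) / (ε₀ / 2) ^ 2 * (l + B) ^ 2 := by
    rw [div_mul_eq_mul_div, le_div_iff₀ (by positivity)]
    exact h5
  have h7 : (t₀ : ℝ) ≤ t₀ * (l + B) ^ 2 := by
    have : (1 : ℝ) ≤ (l + B) ^ 2 := by nlinarith
    nlinarith [(Nat.cast_nonneg t₀ : (0 : ℝ) ≤ t₀)]
  linarith

open Classical in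
lemma targetCount_add_nonTargetCount (S : ArmSet d) (a : ℕ → Vec d) (t : ℕ) :
    targetCount S a t + nonTargetCount S a t = t := by
  rw [targetCount, nonTargetCount, Finset.card_filter_add_card_filter_not, Finset.card_range]

/-- After n pulls the target has norm at most 1/√n, which absorbs corruptions of order √n when they
are measured at the target. -/
lemma sqrt_targetCount_mul_invNorm_le_one {lam : ℝ} (hlam : 0 < lam) (S : ArmSet d)
    (a : ℕ → Vec d) (t : ℕ) :
    Real.sqrt (targetCount S a t) * invNorm lam a t S.target ≤ 1 := by
  rw [invNorm, ← Real.sqrt_mul (Nat.cast_nonneg _)]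
  refine Real.sqrt_le_iff.2 ⟨zero_le_one, ?_⟩
  rw [one_pow]
  exact card_mul_invForm_le_one hlam a t S.target

/-! ### Deterministic analysis of a run -/

open Classical in
/-- The noise in the reported rewards when the verdict is positive. -/
def mixedNoise (S : ArmSet d) (T₁ : ℕ) (a : ℕ → Vec d) (η ν : ℕ → ℝ) (t : ℕ) : ℝ :=
  if t < T₁ ∨ a t ≠ S.target then ν t else η t

/-- An outcome in which the noise behaves as expected. -/
structure GoodOutcome (S : ArmSet d) (θ θ₀ : Vec d) (solve : Vec d → Vec d) (R lam δ L e : ℝ)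
    (T₁ T : ℕ) (a : ℕ → Vec d) (η ν : ℕ → ℝ) : Prop where
  le : T₁ ≤ T
  norm_le : ‖θ‖ ≤ 1
  init : InitFeasible S (initIndex S) θ₀
  solver : IsCQPSolver S solve
  linUCB : IsLinUCB S R lam δ T a (reported S θ θ₀ solve T₁ a η ν)
  noise : ∀ t < T, NoiseBounded R lam L a (mixedNoise S T₁ a η ν) t
  targetNoise : |targetNoise S T₁ a η| ≤ e * Real.sqrt T₁

section Deterministic

variable {S : ArmSet d} {θ θ₀ : Vec d} {solve : Vec d → Vec d} {R lam δ L e : ℝ}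
  {T₁ T : ℕ} {a : ℕ → Vec d} {η ν : ℕ → ℝ}

lemma reported_first_stage (h0 : 0 < initIndex S) {s : ℕ} (hs : s < T₁) :
    reported S θ θ₀ solve T₁ a η ν s = inner ℝ (a s) θ₀ + mixedNoise S T₁ a η ν s := by
  simp [reported, attackedReward, mixedNoise, not_le.2 h0, hs]

/-- Until the compensation the learner keeps seeing the environment θ₀, so the first-stage analysis
remains valid up to the switch, however late that is. -/
lemma reported_before_switch (h0 : 0 < initIndex S)
    (hA : Asserts S T₁ a (trueReward θ a η)) {s τ : ℕ}
    (hτ : ∀ s, T₁ ≤ s → s < τ → a s ≠ S.target) (hs : s < τ) :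
    reported S θ θ₀ solve T₁ a η ν s = inner ℝ (a s) θ₀ + mixedNoise S T₁ a η ν s := by
  by_cases h1 : s < T₁
  · exact reported_first_stage h0 h1
  · have h2 := hτ s (not_lt.1 h1) hs
    have h3 : ¬ Switched S T₁ a s := fun ⟨u, hu, hus, hau⟩ => hτ u hu (hus.trans hs) hau
    simp [reported, attackedReward, mixedNoise, not_le.2 h0, h1, hA, h2, h3]

lemma reported_switch (h0 : 0 < initIndex S)
    (hA : Asserts S T₁ a (trueReward θ a η)) {τ : ℕ} (hτ₁ : T₁ ≤ τ)
    (hτ : ∀ s, T₁ ≤ s → s < τ → a s ≠ S.target) (ha : a τ = S.target) :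
    reported S θ θ₀ solve T₁ a η ν τ = inner ℝ S.target θ + mixedNoise S T₁ a η ν τ +
      targetCount S a T₁ * inner ℝ S.target (attackParam S solve T₁ a (trueReward θ a η) - θ₀) := by
  have h3 : ¬ Switched S T₁ a τ := fun ⟨u, hu, hus, hau⟩ => hτ u hu hus hau
  simp [reported, attackedReward, mixedNoise, not_le.2 h0, not_lt.2 hτ₁, hA, ha, h3, trueReward]

lemma reported_after_switch (h0 : 0 < initIndex S)
    (hA : Asserts S T₁ a (trueReward θ a η)) {s τ : ℕ} (hτ₁ : T₁ ≤ τ)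
    (ha : a τ = S.target) (hs : τ < s) :
    (a s = S.target → reported S θ θ₀ solve T₁ a η ν s =
      inner ℝ S.target θ + mixedNoise S T₁ a η ν s) ∧
    (a s ≠ S.target → reported S θ θ₀ solve T₁ a η ν s =
      inner ℝ (a s) (attackParam S solve T₁ a (trueReward θ a η)) + mixedNoise S T₁ a η ν s) := by
  have h3 : Switched S T₁ a s := ⟨τ, hτ₁, hs, ha⟩
  have h4 : ¬ s < T₁ := by omega
  constructor <;> intro h <;>
  simp [reported, attackedReward, mixedNoise, not_le.2 h0, h4, hA, h, h3, trueReward]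

open Classical in
/-- The total effect of the corruption after the compensation. -/
lemma abs_corruption_le (hlam : 0 < lam) (h0 : 0 < initIndex S) (hθ₀ : ‖θ₀‖ ≤ 1)
    (hA : Asserts S T₁ a (trueReward θ a η)) {θ' : Vec d}
    (hθ' : θ' = attackParam S solve T₁ a (trueReward θ a η)) (hn' : ‖θ'‖ ≤ 1) {τ t : ℕ}
    (hτ₁ : T₁ ≤ τ) (hτ : ∀ s, T₁ ≤ s → s < τ → a s ≠ S.target) (ha : a τ = S.target)
    (hτt : τ < t) (ha1 : ∀ s < t, ‖a s‖ ≤ 1) (v : Vec d) :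
    |∑ s ∈ Finset.range t, (reported S θ θ₀ solve T₁ a η ν s - mixedNoise S T₁ a η ν s -
        inner ℝ (a s) θ') * invForm lam a t v (a s)| ≤
      (2 / Real.sqrt lam * nonTargetCount S a τ +
        |(inner ℝ S.target (θ - θ') : ℝ)| * Real.sqrt (targetCount S a t)) * invNorm lam a t v := by
  set f : Vec d → ℝ := fun x => invForm lam a t v x with hf
  set X : ℝ := inner ℝ S.target (θ₀ - θ') with hX
  set e' : ℝ := inner ℝ S.target (θ - θ') with he'
  -- The four sources of corruption relative to θ̃: other arms before the switch, the estimation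
  -- error on target pulls from the switch on, target pulls in the first stage, and the
  -- compensation.
  set c₁ : ℕ → ℝ := fun s => if s < τ ∧ a s ≠ S.target then inner ℝ (a s) (θ₀ - θ') else 0
  set c₂ : ℕ → ℝ := fun s => if τ ≤ s ∧ a s = S.target then e' else 0
  set c₃ : ℕ → ℝ := fun s => if s < T₁ ∧ a s = S.target then X else 0
  set c₄ : ℕ → ℝ := fun s => if s = τ then - (targetCount S a T₁ * X) else 0
  have hdec : ∀ s ∈ Finset.range t, (reported S θ θ₀ solve T₁ a η ν s -
      mixedNoise S T₁ a η ν s - inner ℝ (a s) θ') * f (a s) =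
      c₁ s * f (a s) + c₂ s * f (a s) + (c₃ s + c₄ s) * f S.target := by
    intro s hs
    rcases lt_trichotomy s τ with h | h | h
    · rw [reported_before_switch h0 hA hτ h]
      have e2 : c₂ s = 0 := if_neg (by omega)
      have e4 : c₄ s = 0 := if_neg (by omega)
      by_cases h1 : a s = S.target
      · have e1 : c₁ s = 0 := if_neg (by tauto)
        have hsT : s < T₁ := by
          by_contra h2
          exact hτ s (by omega) h h1
        have e3 : c₃ s = X := if_pos ⟨hsT, h1⟩
        rw [e1, e2, e3, e4, h1, hX, inner_sub_right]
        ring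
      · have e1 : c₁ s = inner ℝ (a s) (θ₀ - θ') := if_pos ⟨h, h1⟩
        have e3 : c₃ s = 0 := if_neg (by tauto)
        rw [e1, e2, e3, e4, inner_sub_right]
        ring
    · subst h
      rw [reported_switch h0 hA hτ₁ hτ ha, ← hθ']
      have e1 : c₁ s = 0 := if_neg (by omega)
      have e2 : c₂ s = e' := if_pos ⟨le_rfl, ha⟩
      have e3 : c₃ s = 0 := if_neg (by omega)
      have e4 : c₄ s = - (targetCount S a T₁ * X) := if_pos rfl
      rw [e1, e2, e3, e4, ha, hX, he']
      simp only [inner_sub_right]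
      ring
    · have hr := reported_after_switch (θ₀ := θ₀) (solve := solve) (ν := ν) h0 hA hτ₁ ha h
      have e1 : c₁ s = 0 := if_neg (by omega)
      have e3 : c₃ s = 0 := if_neg (by omega)
      have e4 : c₄ s = 0 := if_neg (by omega)
      by_cases h1 : a s = S.target
      · have e2 : c₂ s = e' := if_pos ⟨h.le, h1⟩
        rw [hr.1 h1, e1, e2, e3, e4, h1, he', inner_sub_right]
        ring
      · have e2 : c₂ s = 0 := if_neg (by tauto)
        rw [hr.2 h1, e1, e2, e3, e4, ← hθ']
        ring
  have hc3 : ∑ s ∈ Finset.range t, c₃ s = targetCount S a T₁ * X := by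
    rw [← Finset.sum_filter, Finset.sum_const, nsmul_eq_mul, targetCount]
    congr 3
    ext s
    simp only [Finset.mem_filter, Finset.mem_range]
    constructor
    · rintro ⟨-, h⟩; exact h
    · rintro ⟨h1, h2⟩; exact ⟨by omega, h1, h2⟩
  have hc4 : ∑ s ∈ Finset.range t, c₄ s = - (targetCount S a T₁ * X) := by
    rw [Finset.sum_ite_eq' (Finset.range t) τ, if_pos (Finset.mem_range.2 hτt)]
  -- The last two sources multiply the same number, the form at the target, and their sums are
  -- opposite. The compensation is exact.
  rw [Finset.sum_congr rfl hdec, Finset.sum_add_distrib, Finset.sum_add_distrib,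
    ← Finset.sum_mul, Finset.sum_add_distrib, hc3, hc4, add_neg_cancel, zero_mul, add_zero]
  have hv0 := invNorm_nonneg (lam := lam) a t v
  have hb1 : |∑ s ∈ Finset.range t, c₁ s * f (a s)| ≤
      2 / Real.sqrt lam * nonTargetCount S a τ * invNorm lam a t v := by
    have : ∑ s ∈ Finset.range t, c₁ s * f (a s) =
        ∑ s ∈ (Finset.range τ).filter (fun s => a s ≠ S.target),
          inner ℝ (a s) (θ₀ - θ') * f (a s) := by
      simp only [c₁, ite_mul, zero_mul]
      rw [← Finset.sum_filter]
      refine Finset.sum_congr ?_ fun _ _ => rfl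
      ext s
      simp only [Finset.mem_filter, Finset.mem_range]
      constructor
      · rintro ⟨-, h⟩; exact h
      · rintro ⟨h1, h2⟩; exact ⟨by omega, h1, h2⟩
    rw [this]
    refine (Finset.abs_sum_le_sum_abs _ _).trans ?_
    calc ∑ s ∈ (Finset.range τ).filter (fun s => a s ≠ S.target),
          |inner ℝ (a s) (θ₀ - θ') * f (a s)|
        ≤ ∑ s ∈ (Finset.range τ).filter (fun s => a s ≠ S.target),
          2 * (invNorm lam a t v * (1 / Real.sqrt lam)) := by
          refine Finset.sum_le_sum fun s hs => ?_
          have hst : s < t := (Finset.mem_range.1 (Finset.mem_filter.1 hs).1).trans hτt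
          rw [abs_mul]
          refine mul_le_mul ?_ ((abs_invForm_le hlam a t v (a s)).trans ?_) (abs_nonneg _) two_pos.le
          · refine (abs_inner_le_norm_of_norm_le_one (ha1 s hst)).trans ((norm_sub_le _ _).trans ?_)
            linarith
          · gcongr
            exact invNorm_le hlam a t (ha1 s hst)
      _ = _ := by
          rw [Finset.sum_const, nsmul_eq_mul, nonTargetCount]
          ring
  have hb2 : |∑ s ∈ Finset.range t, c₂ s * f (a s)| ≤
      |e'| * Real.sqrt (targetCount S a t) * invNorm lam a t v := by
    have h1 : ∑ s ∈ Finset.range t, c₂ s * f (a s) =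
        ((Finset.range t).filter (fun s => τ ≤ s ∧ a s = S.target)).card * (e' * f S.target) := by
      simp only [c₂, ite_mul, zero_mul]
      rw [← Finset.sum_filter, ← nsmul_eq_mul, ← Finset.sum_const]
      refine Finset.sum_congr rfl fun s hs => ?_
      rw [(Finset.mem_filter.1 hs).2.2]
    have h2 : (((Finset.range t).filter (fun s => τ ≤ s ∧ a s = S.target)).card : ℝ) ≤
        targetCount S a t := by
      rw [targetCount]
      refine Nat.cast_le.2 (Finset.card_le_card fun s hs => ?_)
      rw [Finset.mem_filter] at hs ⊢
      exact ⟨hs.1, hs.2.2⟩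
    have h3 := sqrt_targetCount_mul_invNorm_le_one hlam S a t
    rw [h1, abs_mul, abs_mul, Nat.abs_cast]
    -- One factor √n of the count n is absorbed by the norm of the target, leaving a corruption of
    -- order √n instead of n.
    calc _ ≤ (targetCount S a t : ℝ) * (|e'| * (invNorm lam a t v * invNorm lam a t S.target)) := by
          gcongr
          exact abs_invForm_le hlam a t v S.target
      _ = |e'| * Real.sqrt (targetCount S a t) * invNorm lam a t v *
          (Real.sqrt (targetCount S a t) * invNorm lam a t S.target) := by
          nth_rewrite 1 [← Real.mul_self_sqrt (Nat.cast_nonneg (targetCount S a t))]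
          ring
      _ ≤ |e'| * Real.sqrt (targetCount S a t) * invNorm lam a t v * 1 := by
          refine mul_le_mul_of_nonneg_left h3 (by positivity)
      _ = _ := mul_one _
  refine (abs_add_le _ _).trans ?_
  rw [add_mul]
  exact add_le_add hb1 hb2

end Deterministic

end LinBandit
end

/-! ### The verdict, the second stage and the cost in a good outcome. -/

noncomputable section

namespace LinBandit

variable {d : ℕ} {S : ArmSet d} {θ θ₀ : Vec d} {solve : Vec d → Vec d} {R lam δ L e : ℝ}

lemma exists_forall_div_sqrt_le (x : ℝ) {ε : ℝ} (hε : 0 < ε) :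
    ∃ T₀ : ℕ, 1 ≤ T₀ ∧ ∀ t ≥ T₀, x / Real.sqrt (t : ℕ) ≤ ε := by
  obtain ⟨n, hn⟩ := exists_nat_ge ((x / ε) ^ 2)
  refine ⟨max n 1, le_max_right _ _, fun t ht => ?_⟩
  have h1 : (n : ℝ) ≤ t := by exact_mod_cast (le_max_left _ _).trans ht
  have h2 : (1 : ℝ) ≤ t := by exact_mod_cast (le_max_right _ _).trans ht
  rw [div_le_iff₀ (Real.sqrt_pos.2 (by linarith)), mul_comm, ← div_le_iff₀ hε]
  exact Real.le_sqrt_of_sq_le (hn.trans h1)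

/-- The first stage: the target arm is pulled in most rounds, and the estimate is accurate. -/
lemma exists_first_stage (hR : 0 < R) (hlam : 0 < lam) (hδ : 0 < δ) (hδ1 : δ < 1) (hL : 0 ≤ L)
    (h0 : 0 < initIndex S) {κ : ℝ} (hκ : 0 < κ) :
    ∃ T₀ : ℕ, 1 ≤ T₀ ∧ ∀ T₁ ≥ T₀, ∀ T θ θ₀ solve a η ν,
      GoodOutcome S θ θ₀ solve R lam δ L e T₁ T a η ν →
      0 < targetCount S a T₁ ∧ (T₁ : ℝ) ≤ 2 * targetCount S a T₁ ∧
      |targetNoise S T₁ a η / targetCount S a T₁| ≤ 2 * e / Real.sqrt T₁ ∧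
      ‖estPar S T₁ a (trueReward θ a η) - parPart S θ‖ ≤ κ := by
  -- At most ½√T₁ ≤ T₁/2 rounds go to other arms, so the target receives at least half of the stage.
  obtain ⟨τ₀, hτ₀⟩ := exists_nonTargetCount_le_sqrt S hR hlam hδ hδ1 hL h0 (half_pos one_pos)
  have hx := S.norm_target_pos
  obtain ⟨n, hn1, hn⟩ := exists_forall_div_sqrt_le (2 * e) (mul_pos hκ hx)
  refine ⟨max τ₀ n, hn1.trans (le_max_right _ _), fun T₁ hT₁ T θ θ₀ solve a η ν H => ?_⟩
  have h1 : (1 : ℝ) ≤ T₁ := by exact_mod_cast hn1.trans ((le_max_right _ _).trans hT₁)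
  have hN := hτ₀ T₁ ((le_max_left _ _).trans hT₁) θ₀ H.init a _ _ (H.linUCB.mono H.le)
    (fun t ht => H.noise t (ht.trans_le H.le)) (fun s hs => reported_first_stage h0 hs)
  have hs : Real.sqrt T₁ ≤ T₁ := by
    rw [Real.sqrt_le_left (by linarith)]; nlinarith
  have hsum : (targetCount S a T₁ : ℝ) + nonTargetCount S a T₁ = T₁ := by
    exact_mod_cast targetCount_add_nonTargetCount S a T₁
  have h2 : (T₁ : ℝ) ≤ 2 * targetCount S a T₁ := by linarith
  have hpos : (0 : ℝ) < targetCount S a T₁ := by linarith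
  have hs0 : 0 < Real.sqrt T₁ := Real.sqrt_pos.2 (by linarith)
  have h3 : |targetNoise S T₁ a η / targetCount S a T₁| ≤ 2 * e / Real.sqrt T₁ := by
    rw [abs_div, Nat.abs_cast, div_le_div_iff₀ hpos hs0]
    have h4 := H.targetNoise
    have he : 0 ≤ e := nonneg_of_mul_nonneg_left ((abs_nonneg _).trans h4) hs0
    calc |targetNoise S T₁ a η| * Real.sqrt T₁ ≤ e * Real.sqrt T₁ * Real.sqrt T₁ := by gcongr
      _ = e * T₁ := by rw [mul_assoc, Real.mul_self_sqrt (by linarith)]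
      _ ≤ e * (2 * targetCount S a T₁) := by gcongr
      _ = _ := by ring
  refine ⟨by exact_mod_cast hpos, h2, h3, ?_⟩
  rw [norm_estPar_sub_parPart S θ T₁ a η (by exact_mod_cast hpos), div_le_iff₀ hx]
  exact h3.trans (hn T₁ ((le_max_right _ _).trans hT₁))

lemma exists_estPar_eq_smul (S : ArmSet d) (T₁ : ℕ) (a : ℕ → Vec d) (r : ℕ → ℝ) :
    ∃ c : ℝ, estPar S T₁ a r = c • S.target := ⟨_, rfl⟩

/-- The verdict on an environment of negative index. -/
lemma exists_not_asserts (hR : 0 < R) (hlam : 0 < lam) (hδ : 0 < δ) (hδ1 : δ < 1) (hL : 0 ≤ L)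
    (hθ : ‖θ‖ ≤ 1) (hneg : attackIndex S θ < 0) :
    ∃ T₀ : ℕ, ∀ T₁ ≥ T₀, ∀ T θ₀ solve a η ν,
      GoodOutcome S θ θ₀ solve R lam δ L e T₁ T a η ν → ¬ Asserts S T₁ a (trueReward θ a η) := by
  rcases le_or_gt (initIndex S) 0 with h0 | h0
  · exact ⟨0, fun _ _ _ _ _ _ _ _ _ h => absurd h.1 (not_lt.2 h0)⟩
  obtain ⟨κ, hκ, h⟩ := exists_nhds_not_index_pos S (inner ℝ S.target θ / ‖S.target‖ ^ 2)
    ((norm_parPart_le S θ).trans hθ) hneg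
  obtain ⟨T₀, -, hT₀⟩ := exists_first_stage (S := S) (e := e) hR hlam hδ hδ1 hL h0 hκ
  refine ⟨T₀, fun T₁ hT₁ T θ₀ solve a η ν H hA => ?_⟩
  obtain ⟨c, hc⟩ := exists_estPar_eq_smul S T₁ a (trueReward θ a η)
  have h1 := (hT₀ T₁ hT₁ T θ θ₀ solve a η ν H).2.2.2
  rw [hc] at h1
  have h2 := hA.2
  rw [hc] at h2
  exact h c h1 h2

/-- The value τ = T encodes that the target is never pulled after the first stage; then there are no
later rounds to analyse. -/
lemma exists_switch_time (S : ArmSet d) (a : ℕ → Vec d) {T₁ T : ℕ} (h : T₁ ≤ T) :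
    ∃ τ, T₁ ≤ τ ∧ τ ≤ T ∧ (∀ s, T₁ ≤ s → s < τ → a s ≠ S.target) ∧ (τ < T → a τ = S.target) := by
  classical
  have hex : ∃ τ, T₁ ≤ τ ∧ (τ = T ∨ a τ = S.target) := ⟨T, h, Or.inl rfl⟩
  refine ⟨Nat.find hex, (Nat.find_spec hex).1, Nat.find_min' hex ⟨h, Or.inl rfl⟩, ?_, ?_⟩
  · intro s hs1 hs2 hs3
    exact Nat.find_min hex hs2 ⟨hs1, Or.inr hs3⟩
  · intro hlt
    exact (Nat.find_spec hex).2.resolve_left hlt.ne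

/-- A non-target arm pulled after the compensation is insufficiently explored. -/
lemma quarter_index_le_of_pull (hR : 0 < R) (hlam : 0 < lam) (hδ : 0 < δ)
    {T₁ T : ℕ} {a : ℕ → Vec d} {η ν : ℕ → ℝ} (H : GoodOutcome S θ θ₀ solve R lam δ L e T₁ T a η ν)
    (h0 : 0 < initIndex S) (hA : Asserts S T₁ a (trueReward θ a η)) {E γ : ℝ} (hγ : 0 ≤ γ)
    (hE : E / 2 ≤ index S (estPar S T₁ a (trueReward θ a η))) (hγE : 2 * γ ≤ E / 16)
    (hT₁ : 0 < targetCount S a T₁) (hn : (T₁ : ℝ) ≤ 2 * targetCount S a T₁)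
    (hZ : |targetNoise S T₁ a η / targetCount S a T₁| ≤ 2 * e / Real.sqrt T₁)
    (heE : 2 * e / Real.sqrt T₁ ≤ E / 16) {τ t : ℕ} (hτ₁ : T₁ ≤ τ)
    (hτ : ∀ s, T₁ ≤ s → s < τ → a s ≠ S.target) (hτa : a τ = S.target)
    (hτt : τ < t) (htT : t < T) (hN : 2 / Real.sqrt lam * nonTargetCount S a τ ≤ γ * Real.sqrt T₁)
    (hopt : (noiseRadius R lam L a t - baseRadius d R lam δ t) * invNorm lam a t S.target ≤ E / 16)
    (hat : a t ≠ S.target) :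
    E / 4 ≤ (totalWidth d R lam δ L T + (γ * Real.sqrt T₁ + 2 * e / Real.sqrt T₁ * Real.sqrt T)) *
      invNorm lam a t (a t) := by
  set v := estPar S T₁ a (trueReward θ a η) with hv
  have hfeas : CQPFeasible S v (index S v) (solve v) := H.solver v hA.2
  set θ' := attackParam S solve T₁ a (trueReward θ a η) with hθ'
  have hθ'v : θ' = v + solve v := rfl
  have hn' : ‖θ'‖ ≤ 1 := hfeas.2.2
  have ha1 := H.linUCB.norm_le htT.le
  have hcor := abs_corruption_le (ν := ν) hlam h0 H.init.2 hA hθ' hn' hτ₁ hτ hτa hτt ha1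
  set e' : ℝ := inner ℝ S.target (θ - θ') with he'
  have he'le : |e'| ≤ 2 * e / Real.sqrt T₁ := by
    refine le_trans (le_of_eq ?_) hZ
    rw [he', inner_sub_right, hθ'v, hfeas.inner_target, hv, inner_target_estPar S θ T₁ a η hT₁,
      sub_add_cancel_left, abs_neg]
  set nt := targetCount S a t with hnt
  have hntn : targetCount S a T₁ ≤ nt := by
    classical
    refine Finset.card_le_card fun s hs => ?_
    rw [Finset.mem_filter, Finset.mem_range] at hs ⊢
    exact ⟨by omega, hs.2⟩
  have hntT : (nt : ℝ) ≤ T := by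
    have := targetCount_add_nonTargetCount S a t
    exact_mod_cast (show nt ≤ T by omega)
  have hnt' : (targetCount S a T₁ : ℝ) ≤ nt := by exact_mod_cast hntn
  set g := 2 / Real.sqrt lam * nonTargetCount S a τ + |e'| * Real.sqrt nt with hg
  have hgap := gap_le_of_ucb_le (δ := δ) (g := g) hlam hR a _ _ t hn' (H.noise t htT)
    (fun v _ => hcor v) ((H.linUCB t htT).2 _ S.target_mem)
  have hx0 := invNorm_nonneg (lam := lam) a t S.target
  have hz0 := invNorm_nonneg (lam := lam) a t (a t)
  have hxn := sqrt_targetCount_mul_invNorm_le_one hlam S a t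
  rw [← hnt] at hxn
  have hsT : Real.sqrt T₁ ≤ 2 * Real.sqrt nt := by
    have : Real.sqrt T₁ ≤ Real.sqrt (2 ^ 2 * nt) := Real.sqrt_le_sqrt (by linarith)
    rwa [Real.sqrt_mul (by positivity), Real.sqrt_sq two_pos.le] at this
  -- Measured at the target, both corruptions are bounded independently of T: the first by 2γ, since
  -- √T₁ ≤ 2√n, and the second by the estimation error itself.
  have hgx : g * invNorm lam a t S.target ≤ E / 8 := by
    have h1 : 2 / Real.sqrt lam * nonTargetCount S a τ * invNorm lam a t S.target ≤ 2 * γ := by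
      calc _ ≤ γ * (2 * Real.sqrt nt) * invNorm lam a t S.target := by
            refine mul_le_mul_of_nonneg_right (hN.trans ?_) hx0
            gcongr
        _ = 2 * γ * (Real.sqrt nt * invNorm lam a t S.target) := by ring
        _ ≤ 2 * γ * 1 := by gcongr
        _ = _ := mul_one _
    have h2 : |e'| * Real.sqrt nt * invNorm lam a t S.target ≤ |e'| := by
      rw [mul_assoc]
      exact mul_le_of_le_one_right (abs_nonneg _) hxn
    rw [hg, add_mul]
    linarith
  have hgT : g ≤ γ * Real.sqrt T₁ + 2 * e / Real.sqrt T₁ * Real.sqrt T := by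
    rw [hg]
    refine add_le_add hN (mul_le_mul he'le (Real.sqrt_le_sqrt hntT) (Real.sqrt_nonneg _) ?_)
    exact (abs_nonneg _).trans he'le
  have hpull := hfeas.1 (a t) (H.linUCB t htT).1 hat
  rw [← hfeas.inner_target, ← hθ'v] at hpull
  have hw := radius_add_le_totalWidth (L := L) hlam S.dim_pos hR hδ htT.le a ha1
  -- Of the margin E/2, the shortfall of the bonus takes E/16 and the corruption at the target E/8.
  -- The remaining 5E/16 must be covered by the width at the pulled arm.
  have h5 := mul_le_mul_of_nonneg_right (add_le_add hw hgT) hz0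
  linarith

/-- Number of non-target pulls and verdict for positive index. -/
lemma exists_asserts_and_nonTargetCount_le (hR : 0 < R) (hlam : 0 < lam) (hδ : 0 < δ) (hδ1 : δ < 1)
    (hL : 0 ≤ L) (he : 0 ≤ e) (hpos : 0 < attackIndex S θ) (hpar : ‖parPart S θ‖ < 1) :
    ∃ T₀ : ℕ, ∀ T₁ ≥ T₀, ∀ T θ₀ solve a η ν,
      GoodOutcome S θ θ₀ solve R lam δ L e T₁ T a η ν →
      Asserts S T₁ a (trueReward θ a η) ∧
      (nonTargetCount S a T : ℝ) ≤ Real.sqrt T₁ + 4 / attackIndex S θ *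
        ((totalWidth d R lam δ L T + (Real.sqrt T₁ + 2 * e / Real.sqrt T₁ * Real.sqrt T)) *
          Real.sqrt (T * ((1 + 1 / lam) * (d * Real.log (1 + T / lam))))) := by
  classical
  set E := attackIndex S θ with hE
  have h0 : 0 < initIndex S := lt_of_lt_of_le hpos (index_le_initIndex hpos)
  obtain ⟨κ, hκ, hind⟩ := exists_nhds_half_index_le S (inner ℝ S.target θ / ‖S.target‖ ^ 2) hpar hpos
  obtain ⟨n₁, hn₁1, hn₁⟩ := exists_first_stage (S := S) (e := e) hR hlam hδ hδ1 hL h0 hκ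
  have hsl : 0 < Real.sqrt lam := Real.sqrt_pos.2 hlam
  set γ : ℝ := min 1 (E / 32) with hγ
  have hγ0 : 0 < γ := lt_min one_pos (by positivity)
  -- The first entry keeps the switch before 2T₁ and bounds the pulls before it by √T₁; the second
  -- makes their corruption at most γ√T₁.
  set c : ℝ := min (1 / 4) (γ * Real.sqrt lam / 4) with hc
  have hc0 : 0 < c := lt_min (by norm_num) (by positivity)
  have hc1 : c ≤ 1 / 4 := min_le_left _ _
  have hc2 : c ≤ γ * Real.sqrt lam / 4 := min_le_right _ _
  obtain ⟨n₂, hn₂⟩ := exists_nonTargetCount_le_sqrt S hR hlam hδ hδ1 hL h0 hc0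
  obtain ⟨n₃, -, hn₃⟩ := exists_forall_div_sqrt_le (2 * e) (show 0 < E / 16 by positivity)
  obtain ⟨n₄, hn₄⟩ := exists_noiseRadius_sub_le hlam S.dim_pos hR hδ hδ1 hL
    (show 0 < E / 16 by positivity)
  refine ⟨max (max n₁ n₂) (max n₃ n₄), fun T₁ hT₁ T θ₀ solve a η ν H => ?_⟩
  simp only [ge_iff_le, max_le_iff] at hT₁
  obtain ⟨⟨hT1, hT2⟩, hT3, hT4⟩ := hT₁
  obtain ⟨hn0, hn, hZ, hest⟩ := hn₁ T₁ hT1 T θ θ₀ solve a η ν H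
  have hhalf : E / 2 ≤ index S (estPar S T₁ a (trueReward θ a η)) := by
    obtain ⟨c', hc'⟩ := exists_estPar_eq_smul S T₁ a (trueReward θ a η)
    rw [hc'] at hest ⊢
    exact hind c' hest
  have hA : Asserts S T₁ a (trueReward θ a η) := ⟨h0, lt_of_lt_of_le (half_pos hpos) hhalf⟩
  refine ⟨hA, ?_⟩
  have hT1' : (1 : ℝ) ≤ T₁ := by exact_mod_cast hn₁1.trans hT1
  obtain ⟨τ, hτ₁, hτT, hτ, hτa⟩ := exists_switch_time S a H.le
  have hNτ := hn₂ τ (hT2.trans hτ₁) θ₀ H.init a _ _ (H.linUCB.mono hτT)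
    (fun t ht => H.noise t (ht.trans_le hτT)) (fun s hs => reported_before_switch h0 hA hτ hs)
  have hτ1' : (T₁ : ℝ) ≤ τ := by exact_mod_cast hτ₁
  -- Every round between T₁ and the switch is a non-target pull, and there are at most √τ/4 ≤ τ/4 of
  -- those, so the switch cannot be delayed for long.
  have hττ : (τ : ℝ) ≤ 2 * T₁ := by
    have h1 : τ - T₁ ≤ nonTargetCount S a τ := by
      rw [nonTargetCount, ← Nat.card_Ico]
      refine Finset.card_le_card fun s hs => ?_
      rw [Finset.mem_Ico] at hs
      exact Finset.mem_filter.2 ⟨Finset.mem_range.2 hs.2, hτ s hs.1 hs.2⟩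
    have h2 : (τ : ℝ) - T₁ ≤ nonTargetCount S a τ := by
      rw [← Nat.cast_sub hτ₁]; exact_mod_cast h1
    have h3 : Real.sqrt τ ≤ τ := by
      rw [Real.sqrt_le_left (by linarith)]; nlinarith
    nlinarith
  have hsτ : Real.sqrt τ ≤ 2 * Real.sqrt T₁ := by
    have : Real.sqrt τ ≤ Real.sqrt (2 ^ 2 * T₁) := Real.sqrt_le_sqrt (by linarith)
    rwa [Real.sqrt_mul (by positivity), Real.sqrt_sq two_pos.le] at this
  have hsT0 := Real.sqrt_nonneg (T₁ : ℝ)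
  have hN1 : (nonTargetCount S a τ : ℝ) ≤ Real.sqrt T₁ := by nlinarith
  have hN2 : 2 / Real.sqrt lam * nonTargetCount S a τ ≤ γ * Real.sqrt T₁ := by
    rw [div_mul_eq_mul_div, div_le_iff₀ hsl]
    nlinarith
  set W := totalWidth d R lam δ L T + (γ * Real.sqrt T₁ + 2 * e / Real.sqrt T₁ * Real.sqrt T)
    with hW
  set J := (Finset.range T).filter (fun s => τ < s ∧ a s ≠ S.target) with hJ
  have hdiv : 0 ≤ 2 * e / Real.sqrt T₁ := by positivity
  have hW0' : 0 ≤ totalWidth d R lam δ L T := by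
    unfold totalWidth baseRadius; positivity
  have hW0 : 0 ≤ W := by positivity
  have hJc := card_mul_le hlam S.dim_pos (show 0 < E / 4 by positivity) hW0 a T
    (H.linUCB.norm_le le_rfl) (J := J) (Finset.filter_subset _ _) (by
      intro t ht
      rw [hJ, Finset.mem_filter, Finset.mem_range] at ht
      obtain ⟨htT, hτt, hne⟩ := ht
      refine quarter_index_le_of_pull hR hlam hδ H h0 hA hγ0.le hhalf ?_ hn0 hn hZ (hn₃ T₁ hT3)
        hτ₁ hτ (hτa (hτt.trans htT)) hτt htT hN2 ?_ hne
      · have := min_le_right 1 (E / 32)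
        linarith
      · exact hn₄ t (by omega) a (H.linUCB.norm_le htT.le) _ S.norm_target_le)
  have hcount : (nonTargetCount S a T : ℝ) ≤ nonTargetCount S a τ + J.card := by
    have : nonTargetCount S a T ≤
        ((Finset.range τ).filter (fun s => a s ≠ S.target) ∪ J).card := by
      refine Finset.card_le_card fun s hs => ?_
      rw [Finset.mem_filter, Finset.mem_range] at hs
      rw [Finset.mem_union, hJ, Finset.mem_filter, Finset.mem_filter, Finset.mem_range,
        Finset.mem_range]
      rcases lt_trichotomy s τ with h | h | h
      · exact Or.inl ⟨h, hs.2⟩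
      · subst h
        exact absurd (hτa hs.1) hs.2
      · exact Or.inr ⟨hs.1, h, hs.2⟩
    exact_mod_cast this.trans (Finset.card_union_le _ _)
  refine hcount.trans (add_le_add hN1 ?_)
  set Q := Real.sqrt (T * ((1 + 1 / lam) * (d * Real.log (1 + T / lam)))) with hQ
  have hQ0 : 0 ≤ Q := Real.sqrt_nonneg _
  have h6 : (J.card : ℝ) ≤ 4 / E * (W * Q) := by
    rw [div_mul_eq_mul_div, le_div_iff₀ hpos]
    linarith
  refine h6.trans ?_
  rw [hW]
  have : γ * Real.sqrt T₁ ≤ Real.sqrt T₁ := mul_le_of_le_one_left hsT0 (min_le_left _ _)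
  gcongr

open Classical in
/-- The rounds in which the reported reward is generated by the adversary. -/
def attackedRounds (S : ArmSet d) (a : ℕ → Vec d) (T₁ T : ℕ) : Finset ℕ :=
  (Finset.range T).filter (fun s => s < T₁ ∨ a s ≠ S.target)

lemma card_attackedRounds_le (S : ArmSet d) (a : ℕ → Vec d) (T₁ T : ℕ) :
    ((attackedRounds S a T₁ T).card : ℝ) ≤ T₁ + nonTargetCount S a T := by
  classical
  have : (attackedRounds S a T₁ T).card ≤
      (Finset.range T₁ ∪ (Finset.range T).filter (fun s => a s ≠ S.target)).card := by
    refine Finset.card_le_card fun s hs => ?_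
    rw [attackedRounds, Finset.mem_filter] at hs
    rw [Finset.mem_union, Finset.mem_filter, Finset.mem_range]
    tauto
  have h2 := this.trans (Finset.card_union_le _ _)
  rw [Finset.card_range] at h2
  exact_mod_cast h2

/-- Bound for the cost in terms of the noise in the attacked rounds. -/
lemma attackCost_le {T₁ T : ℕ} {a : ℕ → Vec d} {η ν : ℕ → ℝ}
    (H : GoodOutcome S θ θ₀ solve R lam δ L e T₁ T a η ν)
    (hA : Asserts S T₁ a (trueReward θ a η)) :
    attackCost T (trueReward θ a η) (reported S θ θ₀ solve T₁ a η ν) ≤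
      2 * T₁ + ∑ s ∈ attackedRounds S a T₁ T, (2 + |ν s| + |η s|) := by
  classical
  have h0 := hA.1
  have hfeas := H.solver _ hA.2
  set θ' := attackParam S solve T₁ a (trueReward θ a η) with hθ'
  have hn' : ‖θ'‖ ≤ 1 := hfeas.2.2
  obtain ⟨τ, hτ₁, hτT, hτ, hτa⟩ := exists_switch_time S a H.le
  have ha1 := H.linUCB.norm_le le_rfl
  have hgen : ∀ s < T, ∀ θ₁ : Vec d, ‖θ₁‖ ≤ 1 →
      |inner ℝ (a s) θ₁ + ν s - (inner ℝ (a s) θ + η s)| ≤ 2 + |ν s| + |η s| := by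
    intro s hs θ₁ hθ₁
    have h1 := (abs_inner_le_norm_of_norm_le_one (v := θ₁) (ha1 s hs)).trans hθ₁
    have h2 := (abs_inner_le_norm_of_norm_le_one (v := θ) (ha1 s hs)).trans H.norm_le
    rw [abs_le] at h1 h2 ⊢
    constructor <;> linarith [neg_abs_le (ν s), neg_abs_le (η s), le_abs_self (ν s),
      le_abs_self (η s), h1.1, h1.2, h2.1, h2.2]
  have hmix : ∀ s, s < T₁ ∨ a s ≠ S.target → mixedNoise S T₁ a η ν s = ν s := fun s hs => if_pos hs
  have hmix' : ∀ s, T₁ ≤ s → a s = S.target → mixedNoise S T₁ a η ν s = η s := fun s hs h =>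
    if_neg (by rw [not_or, not_not]; exact ⟨not_lt.2 hs, h⟩)
  -- The compensation is the only large single change, n times an inner product of size at most 2,
  -- with n ≤ T₁. Genuine target rewards after the first stage are otherwise free.
  have hround : ∀ s ∈ Finset.range T,
      |reported S θ θ₀ solve T₁ a η ν s - trueReward θ a η s| ≤
        (if s = τ then 2 * (T₁ : ℝ) else 0) +
        (if s < T₁ ∨ a s ≠ S.target then 2 + |ν s| + |η s| else 0) := by
    intro s hs
    have hsT := Finset.mem_range.1 hs
    have hsτ0 : (0 : ℝ) ≤ if s = τ then 2 * (T₁ : ℝ) else 0 := by split_ifs <;> positivity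
    have hP0 : (0 : ℝ) ≤ if s < T₁ ∨ a s ≠ S.target then 2 + |ν s| + |η s| else 0 := by
      split_ifs <;> positivity
    rcases lt_trichotomy s τ with h | h | h
    · have hP : s < T₁ ∨ a s ≠ S.target := by
        by_cases h1 : s < T₁
        · exact Or.inl h1
        · exact Or.inr (hτ s (not_lt.1 h1) h)
      rw [reported_before_switch h0 hA hτ h, hmix s hP, trueReward, if_pos hP]
      exact (hgen s hsT θ₀ H.init.2).trans (le_add_of_nonneg_left hsτ0)
    · subst h
      have has := hτa hsT
      rw [reported_switch h0 hA hτ₁ hτ has, hmix' s hτ₁ has, trueReward, has, if_pos rfl]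
      refine le_trans ?_ (le_add_of_nonneg_right (by rw [has] at hP0; exact hP0))
      rw [add_sub_cancel_left, abs_mul, Nat.abs_cast, mul_comm]
      have h2 : |(inner ℝ S.target (θ' - θ₀) : ℝ)| ≤ 2 := by
        refine (abs_inner_le_norm_of_norm_le_one S.norm_target_le).trans ((norm_sub_le _ _).trans ?_)
        linarith [H.init.2]
      have h3 : (targetCount S a T₁ : ℝ) ≤ T₁ := by
        have := targetCount_add_nonTargetCount S a T₁
        exact_mod_cast (show targetCount S a T₁ ≤ T₁ by omega)
      exact mul_le_mul h2 h3 (Nat.cast_nonneg _) two_pos.le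
    · have hr := reported_after_switch (θ₀ := θ₀) (solve := solve) (ν := ν) h0 hA hτ₁
        (hτa (h.trans hsT)) h
      by_cases h1 : a s = S.target
      · rw [hr.1 h1, hmix' s (by omega) h1, trueReward, h1, sub_self, abs_zero]
        rw [h1] at hP0
        positivity
      · rw [hr.2 h1, hmix s (Or.inr h1), trueReward, if_pos (Or.inr h1)]
        exact (hgen s hsT θ' hn').trans (le_add_of_nonneg_left hsτ0)
  rw [attackCost]
  refine (Finset.sum_le_sum hround).trans ?_
  rw [Finset.sum_add_distrib, ← Finset.sum_filter (s := Finset.range T)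
    (p := fun s => s < T₁ ∨ a s ≠ S.target), Finset.sum_ite_eq' (Finset.range T) τ]
  refine add_le_add ?_ le_rfl
  split_ifs
  · exact le_rfl
  · positivity

end LinBandit
end

/-! ### Probability of good outcomes and simplification of the rates. -/

noncomputable section

namespace LinBandit

open scoped ENNReal

variable {d : ℕ}

/-! ### Probability of good outcomes -/

/-- The noise in the attacked rounds is of the order of their number. -/
def CostNoiseBounded (S : ArmSet d) (R δ : ℝ) (T₁ T : ℕ) (a : ℕ → Vec d) (X : ℕ → ℝ) : Prop :=
  ∑ s ∈ attackedRounds S a T₁ T, |X s| ≤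
    R * (2 * (attackedRounds S a T₁ T).card + Real.log (1 / (δ / 4)))

section Probability

variable {Ω : Type*} {m0 : MeasurableSpace Ω} {μ : Measure Ω} [IsProbabilityMeasure μ]

lemma ofReal_one_sub_le {A : Set Ω} {x : ℝ} (h : μ Aᶜ ≤ ENNReal.ofReal x) (hx : 0 ≤ x) :
    ENNReal.ofReal (1 - x) ≤ μ A := by
  rw [ENNReal.ofReal_sub _ hx, ENNReal.ofReal_one, tsub_le_iff_right]
  calc (1 : ℝ≥0∞) = μ Set.univ := measure_univ.symm
    _ ≤ μ (A ∪ Aᶜ) := by rw [Set.union_compl_self]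
    _ ≤ μ A + μ Aᶜ := measure_union_le _ _
    _ ≤ _ := by gcongr

variable {S : ArmSet d} {θ θ₀ : Vec d} {solve : Vec d → Vec d} {R lam δ : ℝ} {T₁ T : ℕ}
  {ℱ : Filtration ℕ m0} {a : ℕ → Ω → Vec d} {η ν : ℕ → Ω → ℝ}

omit [IsProbabilityMeasure μ] in
lemma IsAttackedRun.measurableSet_target
    (h : IsAttackedRun S θ R lam δ T₁ T μ ℱ θ₀ solve a η ν) {t : ℕ} (ht : t < T) :
    MeasurableSet[ℱ t] {ω | a t ω = S.target} :=
  (h.arm_meas t ht).measurable (measurableSet_singleton S.target)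

omit [IsProbabilityMeasure μ] in
lemma IsAttackedRun.measurableSet_attacked
    (h : IsAttackedRun S θ R lam δ T₁ T μ ℱ θ₀ solve a η ν) {t : ℕ} (ht : t < T) :
    MeasurableSet[ℱ t] {ω | t < T₁ ∨ a t ω ≠ S.target} := by
  by_cases h1 : t < T₁
  · simp [h1]
  · simp only [h1, false_or]
    exact (h.measurableSet_target ht).compl

/-- The origin of the noise is decided by the pulled arm before the reward, so the mixed noise is
conditionally sub-Gaussian and one self-normalized bound serves both stages. -/
lemma IsAttackedRun.measure_not_noiseBounded_le (hlam : 0 < lam) (hR : 0 < R) (hδ : 0 < δ)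
    (h : IsAttackedRun S θ R lam δ T₁ T μ ℱ θ₀ solve a η ν) :
    μ {ω | ¬ ∀ t < T, NoiseBounded R lam (Real.log (1 / (δ / 4))) (fun s => a s ω)
      (mixedNoise S T₁ (fun s => a s ω) (fun s => η s ω) (fun s => ν s ω)) t} ≤
      ENNReal.ofReal (δ / 4) := by
  classical
  have hs := self_normalized_bound (μ := μ) (lam := lam) hlam hR ℱ T (a := a)
    (ξ := fun t ω => if t < T₁ ∨ a t ω ≠ S.target then ν t ω else η t ω)
    (fun t ht => (h.arm_meas t ht).measurable)
    (fun t ht => Measurable.ite (ℱ.mono (Nat.le_succ t) _ (h.measurableSet_attacked ht))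
      (h.advNoise_meas t ht).measurable (h.noise_meas t ht).measurable)
    (fun t ht => SubGaussianGiven.piecewise (ℱ.le t)
      ((h.advNoise_subG t ht).subGaussianGiven (ℱ.le t))
      ((h.noise_subG t ht).subGaussianGiven (ℱ.le t)) (h.measurableSet_attacked ht))
    (δ := δ / 4) (by positivity)
  refine (measure_mono fun ω hω => ?_).trans hs
  simp only [Set.mem_ofPred_eq, not_forall] at hω ⊢
  obtain ⟨t, ht, hn⟩ := hω
  refine ⟨t, ht.le, ?_⟩
  rw [NoiseBounded, not_le] at hn
  have hξ : ∀ s, (if s < T₁ ∨ a s ω ≠ S.target then ν s ω else η s ω) =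
      mixedNoise S T₁ (fun s => a s ω) (fun s => η s ω) (fun s => ν s ω) s := fun s => by
    simp only [mixedNoise]
  simp only [hξ]
  exact hn

/-- Two one-sided Chernoff bounds of level δ/8. The number of target pulls is random and is replaced
by T₁ in the variance term. -/
lemma IsAttackedRun.measure_not_targetNoise_le (hR : 0 < R) (hδ : 0 < δ) (hδ1 : δ < 1)
    (hT : T₁ ≤ T) (hT₁ : 0 < T₁) (h : IsAttackedRun S θ R lam δ T₁ T μ ℱ θ₀ solve a η ν) :
    μ {ω | ¬ |targetNoise S T₁ (fun s => a s ω) (fun s => η s ω)| ≤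
      R * Real.sqrt (2 * Real.log (1 / (δ / 8))) * Real.sqrt T₁} ≤ ENNReal.ofReal (δ / 4) := by
  classical
  set l := Real.log (1 / (δ / 8)) with hl
  have hl0 : 0 < l := Real.log_pos (by rw [lt_div_iff₀ (by positivity)]; linarith)
  have hT₁' : (0 : ℝ) < T₁ := by exact_mod_cast hT₁
  set b := Real.sqrt (2 * l) * Real.sqrt T₁ with hb
  have hb0 : 0 < b := by positivity
  have hb2 : b ^ 2 = 2 * l * T₁ := by
    rw [hb, mul_pow, Real.sq_sqrt (by positivity), Real.sq_sqrt hT₁'.le]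
  -- The slope ±b/(T₁R) balances the exponent: the variance term is at most l and the deviation term
  -- is l, while at the threshold Rb the exponent equals 2l.
  have key : ∀ c : ℝ, c ^ 2 * R ^ 2 = (b / T₁) ^ 2 →
      μ {ω | 2 * l < c * targetNoise S T₁ (fun s => a s ω) (fun s => η s ω)} ≤
        ENNReal.ofReal (δ / 8) := by
    intro c hc
    have h1 := chernoff_bound_predictable (μ := μ) (R := R) ℱ T₁ (X := η)
      (fun t ht => (h.noise_meas t (by omega)).measurable)
      (fun t ht => (h.noise_subG t (by omega)).subGaussianGiven (ℱ.le t))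
      (P := fun t ω => a t ω = S.target) (fun t ht => h.measurableSet_target (by omega))
      (φ := fun y => c * y) (by fun_prop) (κ := c ^ 2 * R ^ 2 / 2)
      (fun ρ _ hs => hs c) (δ := δ / 8) (by positivity)
    refine (measure_mono fun ω hω => ?_).trans h1
    simp only [Set.mem_ofPred_eq] at hω ⊢
    rw [← Finset.mul_sum]
    refine lt_of_le_of_lt ?_ (hω.trans_eq (by rw [targetNoise]; congr!))
    have h2 : ∀ F ⊆ Finset.range T₁, (F.card : ℝ) ≤ T₁ := fun F hF => by
      have := Finset.card_le_card hF
      rw [Finset.card_range] at this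
      exact_mod_cast this
    have h3 : c ^ 2 * R ^ 2 / 2 * T₁ = l := by
      rw [hc, div_pow, hb2]; field_simp
    refine (add_le_add (mul_le_mul_of_nonneg_left (h2 _ fun x hx => by
      simp only [Finset.mem_filter] at hx; exact hx.1)
      (by positivity)) le_rfl).trans ?_
    linarith
  have hk1 := key (b / T₁ / R) (by field_simp)
  have hk2 := key (-(b / T₁ / R)) (by field_simp)
  have hsub : {ω | ¬ |targetNoise S T₁ (fun s => a s ω) (fun s => η s ω)| ≤
      R * Real.sqrt (2 * l) * Real.sqrt T₁} ⊆
      {ω | 2 * l < (b / T₁ / R) * targetNoise S T₁ (fun s => a s ω) (fun s => η s ω)} ∪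
      {ω | 2 * l < (-(b / T₁ / R)) * targetNoise S T₁ (fun s => a s ω) (fun s => η s ω)} := by
    intro ω hω
    simp only [Set.mem_ofPred_eq, not_le, Set.mem_union] at hω ⊢
    rw [mul_assoc, ← hb] at hω
    have e1 : 2 * l = (b / T₁ / R) * (R * b) := by
      field_simp
      linarith
    have hp : 0 < b / T₁ / R := by positivity
    rcases lt_abs.1 hω with h1 | h1
    · left
      rw [e1]
      exact mul_lt_mul_of_pos_left h1 hp
    · right
      rw [e1, neg_mul, ← mul_neg]
      exact mul_lt_mul_of_pos_left h1 hp
  refine (measure_mono hsub).trans ((measure_union_le _ _).trans ((add_le_add hk1 hk2).trans ?_))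
  rw [← ENNReal.ofReal_add (by positivity) (by positivity)]
  refine ENNReal.ofReal_le_ofReal (by linarith)

lemma IsAttackedRun.measure_not_goodOutcome_le (hlam : 0 < lam) (hR : 0 < R) (hδ : 0 < δ)
    (hδ1 : δ < 1) (hθ : ‖θ‖ ≤ 1) (hT : T₁ ≤ T) (hT₁ : 0 < T₁)
    (h : IsAttackedRun S θ R lam δ T₁ T μ ℱ θ₀ solve a η ν) :
    μ {ω | ¬ GoodOutcome S θ θ₀ solve R lam δ (Real.log (1 / (δ / 4)))
      (R * Real.sqrt (2 * Real.log (1 / (δ / 8)))) T₁ T (fun s => a s ω) (fun s => η s ω)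
      (fun s => ν s ω)} ≤ ENNReal.ofReal (δ / 2) := by
  have h1 := h.measure_not_noiseBounded_le hlam hR hδ
  have h2 := h.measure_not_targetNoise_le hR hδ hδ1 hT hT₁
  refine le_trans (measure_mono ?_) ((measure_union_le _ _).trans ((add_le_add h1 h2).trans ?_))
  · intro ω hω
    by_contra hn
    simp only [Set.mem_union, Set.mem_ofPred_eq, not_or, not_not] at hn hω
    exact hω ⟨hT, hθ, h.init, h.solver, h.linUCB ω, hn.1, hn.2⟩
  · rw [← ENNReal.ofReal_add (by positivity) (by positivity)]
    exact ENNReal.ofReal_le_ofReal (by linarith)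

/-- Chernoff for |X|/R over the attacked rounds, a predictable set of random size: its exponential
moment is at most 2√e ≤ e², whence the 2 per round. -/
lemma IsAttackedRun.measure_not_costNoise_le (hR : 0 < R) (hδ : 0 < δ)
    (h : IsAttackedRun S θ R lam δ T₁ T μ ℱ θ₀ solve a η ν) {X : ℕ → Ω → ℝ}
    (hX : ∀ t < T, StronglyMeasurable[ℱ (t + 1)] (X t))
    (hsub : ∀ t < T, CondSubGaussian μ (ℱ t) R (X t)) :
    μ {ω | ¬ CostNoiseBounded S R δ T₁ T (fun s => a s ω) (fun s => X s ω)} ≤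
      ENNReal.ofReal (δ / 4) := by
  classical
  have h1 := chernoff_bound_predictable (μ := μ) (R := R) ℱ T (X := X)
    (fun t ht => (hX t ht).measurable)
    (fun t ht => (hsub t ht).subGaussianGiven (ℱ.le t))
    (P := fun t ω => t < T₁ ∨ a t ω ≠ S.target) (fun t ht => h.measurableSet_attacked ht)
    (φ := fun y => R⁻¹ * |y|) (by fun_prop) (κ := 2)
    (fun ρ _ hs => by
      refine (hs.lintegral_exp_abs_le R⁻¹).trans (ENNReal.ofReal_le_ofReal ?_)
      have e1 : R⁻¹ ^ 2 * R ^ 2 / 2 = 1 / 2 := by field_simp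
      rw [e1]
      have e2 : (2 : ℝ) ≤ Real.exp 1 := by linarith [Real.add_one_le_exp 1]
      calc 2 * Real.exp (1 / 2) ≤ Real.exp 1 * Real.exp (1 / 2) := by gcongr
        _ = Real.exp (1 + 1 / 2) := (Real.exp_add _ _).symm
        _ ≤ Real.exp 2 := Real.exp_le_exp.2 (by norm_num)) (δ := δ / 4) (by positivity)
  refine (measure_mono fun ω hω => ?_).trans h1
  simp only [Set.mem_ofPred_eq, CostNoiseBounded, not_le, attackedRounds] at hω ⊢
  rw [← Finset.mul_sum, lt_inv_mul_iff₀ hR]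
  convert hω

end Probability

/-! ### Rates -/

lemma pullRate_nonneg {ε δ : ℝ} (hε : 0 < ε) (hδ : 0 < δ) (hδ1 : δ < 1) {T₁ : ℕ} (hT₁ : 0 < T₁)
    (T : ℕ) : 0 ≤ pullRate d ε δ T₁ T := by
  have h1 : (1 : ℝ) ≤ T₁ := by exact_mod_cast hT₁
  have h2 : 0 ≤ Real.log (T₁ / δ) := Real.log_nonneg (by rw [le_div_iff₀ hδ]; linarith)
  unfold pullRate
  positivity

lemma one_le_log_div {δ : ℝ} (hδ : 0 < δ) (hδ1 : δ < 1) {t : ℕ} (ht : 3 ≤ t) :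
    1 ≤ Real.log (t / δ) := by
  have h3 : (3 : ℝ) ≤ t := by exact_mod_cast ht
  rw [Real.le_log_iff_exp_le (by positivity)]
  have := Real.exp_one_lt_d9
  rw [le_div_iff₀ hδ]
  nlinarith [Real.exp_pos 1]

/-- The constant in the bound for the number of pulls. -/
def pullConst (R lam : ℝ) : ℝ :=
  2 + 4 * ((6 * R + 2 * Real.sqrt lam + 1) * Real.sqrt (2 * (1 + 1 / lam)))

set_option maxHeartbeats 1000000 in
/-- The finite-time bound for the number of pulls is of the order of `pullRate`. -/
lemma exists_pull_bound_le_pullRate {R lam δ ε : ℝ} (hd : 0 < d) (hR : 0 < R) (hlam : 0 < lam)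
    (hδ : 0 < δ) (hδ1 : δ < 1 / 3) (hε : 0 < ε) (hε2 : ε ≤ 2) :
    ∃ T₀ : ℕ, ∀ T₁ ≥ T₀, ∀ T ≥ T₁,
      Real.sqrt T₁ + 4 / ε * ((totalWidth d R lam δ (Real.log (1 / (δ / 4))) T + (Real.sqrt T₁ +
        2 * (R * Real.sqrt (2 * Real.log (1 / (δ / 8)))) / Real.sqrt T₁ * Real.sqrt T)) *
          Real.sqrt (T * ((1 + 1 / lam) * (d * Real.log (1 + T / lam)))))
        ≤ pullConst R lam * pullRate d ε δ T₁ T := by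
  -- For T beyond this threshold 1 + T/λ ≤ T², so λ disappears from the logarithms at the price of a
  -- factor 2; T ≥ 4 absorbs the 4 in log(4/δ).
  obtain ⟨n, hn⟩ := exists_nat_ge (1 + 1 / lam)
  refine ⟨max n 4, fun T₁ hT₁ T hT => ?_⟩
  have h4 : (4 : ℝ) ≤ T₁ := by exact_mod_cast (le_max_right _ _).trans hT₁
  have hTT : (T₁ : ℝ) ≤ T := by exact_mod_cast hT
  have hTn : 1 + 1 / lam ≤ T :=
    hn.trans ((show (n : ℝ) ≤ T₁ by exact_mod_cast (le_max_left _ _).trans hT₁).trans hTT)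
  have hd1 : (1 : ℝ) ≤ d := by exact_mod_cast hd
  set l := Real.log (T / δ) with hl
  have hT₁3 : 3 ≤ T₁ := le_trans (by norm_num) ((le_max_right _ _).trans hT₁)
  have hl1 : 1 ≤ l := one_le_log_div hδ (by linarith) (hT₁3.trans hT)
  have hl1' : 1 ≤ Real.log (T₁ / δ) := one_le_log_div hδ (by linarith) hT₁3
  have hT0 : (0 : ℝ) < T := by linarith
  have hT₁0 : (0 : ℝ) < T₁ := by linarith
  have hone := one_le_one_add_div hlam T
  have hlamT : 1 + T / lam ≤ (T : ℝ) ^ 2 := by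
    have : 1 + T / lam ≤ T * (1 + 1 / lam) := by
      rw [mul_add, mul_one, mul_one_div]; linarith
    nlinarith
  have hlogδ : Real.log ((1 + T / lam) / δ) ≤ 2 * l := by
    have : 2 * l = Real.log ((T / δ) ^ 2) := by rw [Real.log_pow, hl]; norm_num
    rw [this]
    refine Real.log_le_log (by positivity) ?_
    rw [div_pow, div_le_div_iff₀ hδ (by positivity)]
    have hδ2 : δ ^ 2 ≤ δ := by nlinarith
    nlinarith [sq_nonneg (T : ℝ)]
  have hlog : Real.log (1 + T / lam) ≤ 2 * l :=
    (log_div_ge hlam hδ (by linarith) T).trans hlogδ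
  have hL : Real.log (1 / (δ / 4)) ≤ l := by
    refine Real.log_le_log (by positivity) ?_
    rw [one_div_div]
    gcongr
    linarith
  have hL0 : 0 ≤ Real.log (1 + T / lam) := Real.log_nonneg hone
  have hsd1 : 1 ≤ Real.sqrt d := Real.one_le_sqrt.2 hd1
  have hsl1 : 1 ≤ Real.sqrt l := Real.one_le_sqrt.2 hl1
  have hs2 : Real.sqrt (4 * (d * l)) = 2 * (Real.sqrt d * Real.sqrt l) := by
    rw [Real.sqrt_mul (by norm_num), Real.sqrt_mul (by positivity)]
    congr 1
    rw [show (4 : ℝ) = 2 ^ 2 by norm_num, Real.sqrt_sq two_pos.le]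
  have hW : totalWidth d R lam δ (Real.log (1 / (δ / 4))) T ≤
      Real.sqrt d * ((4 * R + 2 * Real.sqrt lam) * Real.sqrt l) := by
    have e1 : baseRadius d R lam δ T ≤ R * (2 * (Real.sqrt d * Real.sqrt l)) := by
      rw [baseRadius, ← hs2]
      refine mul_le_mul_of_nonneg_left (Real.sqrt_le_sqrt ?_) hR.le
      nlinarith [mul_le_mul_of_nonneg_left hlogδ (Nat.cast_nonneg d : (0 : ℝ) ≤ d)]
    have e2 : R * Real.sqrt (d * Real.log (1 + T / lam) + 2 * Real.log (1 / (δ / 4))) ≤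
        R * (2 * (Real.sqrt d * Real.sqrt l)) := by
      rw [← hs2]
      refine mul_le_mul_of_nonneg_left (Real.sqrt_le_sqrt ?_) hR.le
      nlinarith [mul_le_mul_of_nonneg_left hlog (Nat.cast_nonneg d : (0 : ℝ) ≤ d)]
    have e3 : 2 * Real.sqrt lam ≤ 2 * Real.sqrt lam * (Real.sqrt d * Real.sqrt l) := by
      refine le_mul_of_one_le_right (by positivity) ?_
      nlinarith
    rw [totalWidth]
    linarith
  have hD : 0 ≤ Real.log (1 / δ) := Real.log_nonneg (by rw [le_div_iff₀ hδ]; linarith)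
  -- Here δ < 1/3 is essential: log(8/δ) ≤ 3 log(1/δ) amounts to 8δ² ≤ 1 and fails as δ approaches
  -- 1.
  have hZ : 2 * (R * Real.sqrt (2 * Real.log (1 / (δ / 8)))) / Real.sqrt T₁ * Real.sqrt T ≤
      6 * R * (Real.sqrt (T * Real.log (1 / δ)) / Real.sqrt T₁) := by
    have e1 : Real.log (1 / (δ / 8)) ≤ 3 * Real.log (1 / δ) := by
      have : 3 * Real.log (1 / δ) = Real.log ((1 / δ) ^ 3) := by rw [Real.log_pow]; norm_num
      rw [this]
      refine Real.log_le_log (by positivity) ?_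
      rw [one_div_div, one_div_pow, div_le_div_iff₀ hδ (by positivity)]
      have : δ ^ 2 ≤ 1 / 9 := by nlinarith
      nlinarith
    have e2 : Real.sqrt (2 * Real.log (1 / (δ / 8))) ≤ 3 * Real.sqrt (Real.log (1 / δ)) := by
      refine Real.sqrt_le_iff.2 ⟨by positivity, ?_⟩
      rw [mul_pow, Real.sq_sqrt hD]
      linarith
    rw [Real.sqrt_mul hT0.le]
    calc 2 * (R * Real.sqrt (2 * Real.log (1 / (δ / 8)))) / Real.sqrt T₁ * Real.sqrt T
        ≤ 2 * (R * (3 * Real.sqrt (Real.log (1 / δ)))) / Real.sqrt T₁ * Real.sqrt T := by gcongr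
      _ = _ := by ring
  set u₁ := Real.sqrt l with hu₁
  set u₂ := Real.sqrt T₁ * Real.log (T₁ / δ) with hu₂
  set u₃ := Real.sqrt (T * Real.log (1 / δ)) / Real.sqrt T₁ with hu₃
  have hu₃0 : 0 ≤ u₃ := by positivity
  have hsT₁ : Real.sqrt T₁ ≤ u₂ := le_mul_of_one_le_right (Real.sqrt_nonneg _) hl1'
  have hu₂0 : 0 ≤ u₂ := (Real.sqrt_nonneg _).trans hsT₁
  set K := 6 * R + 2 * Real.sqrt lam + 1 with hK
  have hsl0 := Real.sqrt_nonneg lam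
  have hsum : totalWidth d R lam δ (Real.log (1 / (δ / 4))) T + (Real.sqrt T₁ +
      2 * (R * Real.sqrt (2 * Real.log (1 / (δ / 8)))) / Real.sqrt T₁ * Real.sqrt T) ≤
      Real.sqrt d * (K * (u₁ + u₂ + u₃)) := by
    have e0 : Real.sqrt T₁ + 6 * R * u₃ ≤ Real.sqrt d * (u₂ + 6 * R * u₃) := by
      have : u₂ + 6 * R * u₃ ≤ Real.sqrt d * (u₂ + 6 * R * u₃) :=
        le_mul_of_one_le_left (by positivity) hsd1
      linarith
    have e1 : (4 * R + 2 * Real.sqrt lam) * u₁ + (u₂ + 6 * R * u₃) ≤ K * (u₁ + u₂ + u₃) := by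
      have hu₁0 : 0 ≤ u₁ := by linarith
      rw [hK]
      nlinarith [mul_nonneg hR.le hu₁0, mul_nonneg hR.le hu₂0, mul_nonneg hsl0 hu₂0,
        mul_nonneg hsl0 hu₃0]
    have e2 := mul_le_mul_of_nonneg_left e1 (Real.sqrt_nonneg (d : ℝ))
    linarith
  have hQ : Real.sqrt (T * ((1 + 1 / lam) * (d * Real.log (1 + T / lam)))) ≤
      Real.sqrt d * (Real.sqrt (2 * (1 + 1 / lam)) * Real.sqrt (T * l)) := by
    rw [← Real.sqrt_mul (by positivity), ← Real.sqrt_mul (by positivity)]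
    refine Real.sqrt_le_sqrt ?_
    calc T * ((1 + 1 / lam) * (d * Real.log (1 + T / lam)))
        ≤ T * ((1 + 1 / lam) * (d * (2 * l))) := by gcongr
      _ = _ := by ring
  set q := Real.sqrt (2 * (1 + 1 / lam)) with hq
  have hrate : pullRate d ε δ T₁ T = d * (u₁ + u₂ + u₃) * Real.sqrt (T * l) / ε := rfl
  have hr0 : 0 ≤ u₁ + u₂ + u₃ := by positivity
  have hmain : 4 / ε * ((totalWidth d R lam δ (Real.log (1 / (δ / 4))) T + (Real.sqrt T₁ +
        2 * (R * Real.sqrt (2 * Real.log (1 / (δ / 8)))) / Real.sqrt T₁ * Real.sqrt T)) *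
          Real.sqrt (T * ((1 + 1 / lam) * (d * Real.log (1 + T / lam))))) ≤
      4 * (K * q) * pullRate d ε δ T₁ T := by
    calc _ ≤ 4 / ε * ((Real.sqrt d * (K * (u₁ + u₂ + u₃))) *
          (Real.sqrt d * (q * Real.sqrt (T * l)))) := by gcongr
      _ = 4 / ε * ((Real.sqrt d * Real.sqrt d) * (K * (u₁ + u₂ + u₃) * (q * Real.sqrt (T * l)))) := by
          ring
      _ = _ := by
          rw [Real.mul_self_sqrt (Nat.cast_nonneg d), hrate]
          ring
  -- The pulls before the switch carry no factor 1/ε; they fit into the rate because ε ≤ 2.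
  have hfirst : Real.sqrt T₁ ≤ 2 * pullRate d ε δ T₁ T := by
    rw [hrate, ← mul_div_assoc, le_div_iff₀ hε]
    have e1 : 1 ≤ Real.sqrt (T * l) := Real.one_le_sqrt.2 (by nlinarith)
    have e2 : u₁ + u₂ + u₃ ≤ d * (u₁ + u₂ + u₃) := le_mul_of_one_le_left hr0 hd1
    have e3 : d * (u₁ + u₂ + u₃) ≤ d * (u₁ + u₂ + u₃) * Real.sqrt (T * l) :=
      le_mul_of_one_le_right (by positivity) e1
    have e4 : Real.sqrt T₁ * ε ≤ Real.sqrt T₁ * 2 := by gcongr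
    linarith
  have hC : pullConst R lam * pullRate d ε δ T₁ T =
      2 * pullRate d ε δ T₁ T + 4 * (K * q) * pullRate d ε δ T₁ T := by
    rw [pullConst]; ring
  rw [hC]
  exact add_le_add hfirst hmain

set_option maxHeartbeats 1000000 in
/-- The rate for a first stage of length `√T`. -/
lemma exists_rate_sqrt_le {δ ε : ℝ} (hd : 0 < d) (hδ : 0 < δ) (hδ1 : δ < 1) (hε : 0 < ε)
    (hε2 : ε ≤ 2) : ∃ T₀ : ℕ, ∀ T ≥ T₀, ∀ T₁ : ℕ, T₁ ≤ T → T₁ = ⌈Real.sqrt T⌉₊ →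
      T₁ + pullRate d ε δ T₁ T ≤ 18 * ((d / ε) * (T : ℝ) ^ (3 / 4 : ℝ) * Real.log T ^ 2) := by
  -- Once T ≥ 1/δ, log(1/δ) is at most log T, and δ drops out of the rate.
  obtain ⟨n, hn⟩ := exists_nat_ge (1 / δ)
  refine ⟨max n 3, fun T hT T₁ hT₁T hT₁ => ?_⟩
  have h3 : (3 : ℝ) ≤ T := by exact_mod_cast (le_max_right _ _).trans hT
  have hTn : 1 / δ ≤ T := hn.trans (by exact_mod_cast (le_max_left _ _).trans hT)
  have hd1 : (1 : ℝ) ≤ d := by exact_mod_cast hd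
  have hT0 : (0 : ℝ) < T := by linarith
  have hm1 : 1 ≤ Real.log T := by
    rw [Real.le_log_iff_exp_le hT0]
    linarith [Real.exp_one_lt_d9]
  -- In terms of q = T^(1/4) and m = √(log T) the estimates become polynomial: √T₁ is between q and
  -- 2q, and √T/√T₁ is at most q.
  set q : ℝ := (T : ℝ) ^ (1 / 4 : ℝ) with hq
  have hq1 : 1 ≤ q := Real.one_le_rpow (by linarith) (by norm_num)
  have hq2 : Real.sqrt T = q ^ 2 := by
    rw [hq, Real.sqrt_eq_rpow, ← Real.rpow_natCast, ← Real.rpow_mul hT0.le]; norm_num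
  have hq3 : (T : ℝ) ^ (3 / 4 : ℝ) = q ^ 3 := by
    rw [hq, ← Real.rpow_natCast, ← Real.rpow_mul hT0.le]; norm_num
  set m := Real.sqrt (Real.log T) with hm
  have hm1' : 1 ≤ m := Real.one_le_sqrt.2 hm1
  have hm2 : Real.log T = m ^ 2 := (Real.sq_sqrt (by linarith)).symm
  have hsT1 : 1 ≤ q ^ 2 := by nlinarith
  have hT₁le : (T₁ : ℝ) ≤ 2 * q ^ 2 := by
    have := (Nat.ceil_lt_add_one (Real.sqrt_nonneg (T : ℝ))).le
    rw [← hT₁, hq2] at this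
    linarith
  have hT₁ge : q ^ 2 ≤ T₁ := by
    have := Nat.le_ceil (Real.sqrt (T : ℝ))
    rwa [← hT₁, hq2] at this
  have hsle : Real.sqrt T₁ ≤ 2 * q := by
    refine Real.sqrt_le_iff.2 ⟨by positivity, ?_⟩
    nlinarith
  have hsge : q ≤ Real.sqrt T₁ := Real.le_sqrt_of_sq_le hT₁ge
  have hD : Real.log (1 / δ) ≤ m ^ 2 := by
    rw [← hm2]
    exact Real.log_le_log (by positivity) hTn
  have hD0 : 0 ≤ Real.log (1 / δ) := Real.log_nonneg (by rw [le_div_iff₀ hδ]; linarith)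
  have hl : Real.log (T / δ) ≤ 2 * m ^ 2 := by
    rw [div_eq_mul_one_div, Real.log_mul hT0.ne' (by positivity), hm2]
    linarith
  have hl' : Real.log (T₁ / δ) ≤ 2 * m ^ 2 := by
    refine (Real.log_le_log ?_ ?_).trans hl
    · have : (0 : ℝ) < T₁ := by linarith
      positivity
    · gcongr
  have e1 : Real.sqrt (Real.log (T / δ)) ≤ 2 * m := by
    refine Real.sqrt_le_iff.2 ⟨by positivity, ?_⟩
    nlinarith
  have e2 : Real.sqrt T₁ * Real.log (T₁ / δ) ≤ 2 * q * (2 * m ^ 2) := by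
    refine (mul_le_mul_of_nonneg_left hl' (Real.sqrt_nonneg _)).trans ?_
    gcongr
  have e3 : Real.sqrt (T * Real.log (1 / δ)) / Real.sqrt T₁ ≤ q * m := by
    rw [div_le_iff₀ (by linarith), Real.sqrt_mul hT0.le, hq2]
    have : Real.sqrt (Real.log (1 / δ)) ≤ m := Real.sqrt_le_iff.2 ⟨by positivity, hD⟩
    calc q ^ 2 * Real.sqrt (Real.log (1 / δ)) ≤ q ^ 2 * m := by gcongr
      _ = q * m * q := by ring
      _ ≤ q * m * Real.sqrt T₁ := by gcongr
  have e4 : Real.sqrt (T * Real.log (T / δ)) ≤ q ^ 2 * (2 * m) := by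
    rw [Real.sqrt_mul hT0.le, hq2]
    gcongr
  have hqm : q * m ≤ q * m ^ 2 := by nlinarith [mul_nonneg (by linarith : 0 ≤ q) (by linarith : 0 ≤ m)]
  have hmm : m ≤ q * m ^ 2 := by nlinarith
  -- The constant is 2 + 4 + 1. Multiplied by the outer factor 2q²m it gives 14, and T₁ itself adds
  -- the 4 that makes 18.
  have e5 : Real.sqrt (Real.log (T / δ)) + Real.sqrt T₁ * Real.log (T₁ / δ) +
      Real.sqrt (T * Real.log (1 / δ)) / Real.sqrt T₁ ≤ 7 * (q * m ^ 2) := by linarith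
  have hde : 1 / 2 ≤ d / ε := by
    rw [div_le_div_iff₀ two_pos hε]; linarith
  have e6 : pullRate d ε δ T₁ T ≤ 14 * ((d / ε) * q ^ 3 * m ^ 4) := by
    calc pullRate d ε δ T₁ T ≤ d * (7 * (q * m ^ 2)) * (q ^ 2 * (2 * m)) / ε := by
          unfold pullRate; gcongr
      _ = 14 * ((d / ε) * q ^ 3 * m ^ 3) := by ring
      _ ≤ _ := by
          gcongr 14 * ((d / ε) * q ^ 3 * ?_)
          exact pow_le_pow_right₀ hm1' (by norm_num)
  have e7 : (T₁ : ℝ) ≤ 4 * ((d / ε) * q ^ 3 * m ^ 4) := by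
    have h1 : q ^ 2 ≤ q ^ 3 * m ^ 4 := by
      have a1 : q ^ 2 ≤ q ^ 3 := pow_le_pow_right₀ hq1 (by norm_num)
      have a2 : 1 ≤ m ^ 4 := one_le_pow₀ hm1'
      nlinarith
    have h2 : 1 / 2 * (q ^ 3 * m ^ 4) ≤ d / ε * (q ^ 3 * m ^ 4) := by gcongr
    linarith
  rw [hq3, hm2, ← pow_mul]
  norm_num
  linarith

/-- The constant in the bound for the cost. -/
def costConst (R lam : ℝ) : ℝ := (4 + 6 * R) * (1 + pullConst R lam)

/-- With L = log(4/δ) ≤ T₁, the compensation gives 2T₁, the means 2(T₁ + N), and each of the two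
noises at most R(3T₁ + 2N). -/
lemma attackCost_le_of_noise {S : ArmSet d} {θ θ₀ : Vec d} {solve : Vec d → Vec d}
    {R lam δ L e : ℝ} {T₁ T : ℕ} {a : ℕ → Vec d} {η ν : ℕ → ℝ} (hR : 0 < R)
    (H : GoodOutcome S θ θ₀ solve R lam δ L e T₁ T a η ν)
    (hA : Asserts S T₁ a (trueReward θ a η)) (hη : CostNoiseBounded S R δ T₁ T a η)
    (hν : CostNoiseBounded S R δ T₁ T a ν) (hT₁ : Real.log (1 / (δ / 4)) ≤ T₁) :
    attackCost T (trueReward θ a η) (reported S θ θ₀ solve T₁ a η ν) ≤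
      (4 + 6 * R) * (T₁ + nonTargetCount S a T) := by
  refine (attackCost_le H hA).trans ?_
  have hcard := card_attackedRounds_le S a T₁ T
  rw [Finset.sum_add_distrib, Finset.sum_add_distrib, Finset.sum_const, nsmul_eq_mul]
  rw [CostNoiseBounded] at hη hν
  have hN : (0 : ℝ) ≤ nonTargetCount S a T := Nat.cast_nonneg _
  have h1 : R * (2 * (attackedRounds S a T₁ T).card + Real.log (1 / (δ / 4))) ≤
      R * (2 * (T₁ + nonTargetCount S a T) + T₁) := by gcongr
  nlinarith [mul_nonneg hR.le hN]

end LinBandit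
end

/-! ### Assembly of the thresholds and probabilities. -/

noncomputable section

namespace LinBandit

variable {d : ℕ}

/-- The sign condition stands after the threshold, so that a single threshold can be chosen before
the sign of the index is known. -/
lemma exists_negative_verdict (S : ArmSet d) {θ : Vec d} {R lam δ : ℝ} (hR : 0 < R)
    (hlam : 0 < lam) (hδ : 0 < δ) (hδ1 : δ < 1) (hθ : ‖θ‖ ≤ 1) (L e : ℝ) (hL : 0 ≤ L) :
    ∃ T₀ : ℕ, ∀ T₁ ≥ T₀, attackIndex S θ < 0 → ∀ T θ₀ solve a η ν,
      GoodOutcome S θ θ₀ solve R lam δ L e T₁ T a η ν → ¬ Asserts S T₁ a (trueReward θ a η) := by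
  by_cases h : attackIndex S θ < 0
  · obtain ⟨T₀, hT₀⟩ := exists_not_asserts (S := S) (e := e) hR hlam hδ hδ1 hL hθ h
    exact ⟨T₀, fun T₁ hT₁ _ => hT₀ T₁ hT₁⟩
  · exact ⟨0, fun _ _ h' => absurd h' h⟩

lemma pullConst_pos {R lam : ℝ} (hR : 0 < R) (hlam : 0 < lam) : 0 < pullConst R lam := by
  unfold pullConst; positivity

/-- All conclusions for positive index in a good outcome. -/
lemma exists_positive_bounds (S : ArmSet d) {θ : Vec d} {R lam δ : ℝ} (hR : 0 < R)
    (hlam : 0 < lam) (hδ : 0 < δ) (hδ1 : δ < 1) :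
    ∃ T₀ : ℕ, ∀ T₁ ≥ T₀, 0 < attackIndex S θ → ‖parPart S θ‖ < 1 → ∀ T θ₀ solve a η ν,
      GoodOutcome S θ θ₀ solve R lam δ (Real.log (1 / (δ / 4)))
        (R * Real.sqrt (2 * Real.log (1 / (δ / 8)))) T₁ T a η ν →
      Asserts S T₁ a (trueReward θ a η) ∧ (δ < 1 / 3 →
        (nonTargetCount S a T : ℝ) ≤ pullConst R lam * pullRate d (attackIndex S θ) δ T₁ T ∧
        (CostNoiseBounded S R δ T₁ T a η → CostNoiseBounded S R δ T₁ T a ν →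
          attackCost T (trueReward θ a η) (reported S θ θ₀ solve T₁ a η ν) ≤
            costConst R lam * (T₁ + pullRate d (attackIndex S θ) δ T₁ T))) := by
  by_cases h : 0 < attackIndex S θ ∧ ‖parPart S θ‖ < 1
  swap
  · exact ⟨0, fun _ _ h1 h2 => absurd ⟨h1, h2⟩ h⟩
  obtain ⟨hpos, hpar⟩ := h
  have hL : 0 ≤ Real.log (1 / (δ / 4)) :=
    Real.log_nonneg (by rw [le_div_iff₀ (by positivity)]; linarith)
  obtain ⟨n₁, hn₁⟩ := exists_asserts_and_nonTargetCount_le (S := S) (θ := θ)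
    (e := R * Real.sqrt (2 * Real.log (1 / (δ / 8)))) hR hlam hδ hδ1 hL (by positivity) hpos hpar
  obtain ⟨n₂, hn₂⟩ : ∃ n₂ : ℕ, δ < 1 / 3 → ∀ T₁ ≥ n₂, ∀ T ≥ T₁, _ ≤ _ := by
    by_cases h3 : δ < 1 / 3
    · obtain ⟨n₂, hn₂⟩ := exists_pull_bound_le_pullRate S.dim_pos hR hlam hδ h3 hpos
        (index_le_two S _)
      exact ⟨n₂, fun _ => hn₂⟩
    · exact ⟨0, fun h' => absurd h' h3⟩
  obtain ⟨n₃, hn₃⟩ := exists_nat_ge (Real.log (1 / (δ / 4)))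
  refine ⟨max (max n₁ n₂) (max n₃ 1), fun T₁ hT₁ _ _ T θ₀ solve a η ν H => ?_⟩
  simp only [ge_iff_le, max_le_iff] at hT₁
  obtain ⟨⟨hT1, hT2⟩, hT3, hT4⟩ := hT₁
  obtain ⟨hA, hN⟩ := hn₁ T₁ hT1 T θ₀ solve a η ν H
  refine ⟨hA, fun h3 => ?_⟩
  have hN' := hN.trans (hn₂ h3 T₁ hT2 T H.le)
  refine ⟨hN', fun hη hν => ?_⟩
  refine (attackCost_le_of_noise hR H hA hη hν (hn₃.trans (by exact_mod_cast hT3))).trans ?_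
  have hr := pullRate_nonneg (d := d) hpos hδ hδ1 hT4 T
  have hC := pullConst_pos hR hlam
  rw [costConst, mul_assoc]
  refine mul_le_mul_of_nonneg_left ?_ (by positivity)
  nlinarith [mul_nonneg hC.le (Nat.cast_nonneg T₁ : (0 : ℝ) ≤ T₁)]

end LinBandit

end

theorem mainTheorem2 (R lam : ℝ) (hR : 0 < R) (hlam : 0 < lam) :
    ∃ C : ℝ, ∃ p : ℕ, 0 < C ∧
      ∀ (d : ℕ) (S : LinBandit.ArmSet d) (θ : LinBandit.Vec d), ‖θ‖ ≤ 1 →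
      ∀ δ : ℝ, 0 < δ → δ < 1 →
      ∃ T₀ : ℕ, ∀ (T₁ T : ℕ), T₁ ≤ T →
      ∀ (Ω : Type*) (m0 : MeasurableSpace Ω) (μ : MeasureTheory.Measure Ω)
        (_ : MeasureTheory.IsProbabilityMeasure μ) (ℱ : MeasureTheory.Filtration ℕ m0)
        (θ₀ : LinBandit.Vec d) (solve : LinBandit.Vec d → LinBandit.Vec d)
        (a : ℕ → Ω → LinBandit.Vec d) (η ν : ℕ → Ω → ℝ),
      LinBandit.IsAttackedRun S θ R lam δ T₁ T μ ℱ θ₀ solve a η ν →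
      -- the verdict on an environment that is not attackable
      (LinBandit.attackIndex S θ < 0 → T₀ ≤ T₁ →
        ENNReal.ofReal (1 - δ) ≤ μ {ω | ¬ LinBandit.VerdictAttackable S θ T₁ a η ω}) ∧
      (0 < LinBandit.attackIndex S θ → ‖LinBandit.parPart S θ‖ < 1 →
        -- the verdict on an attackable environment, non-target pulls and cost
        (T₀ ≤ T₁ →
          ENNReal.ofReal (1 - δ) ≤ μ {ω | LinBandit.VerdictAttackable S θ T₁ a η ω} ∧
          ENNReal.ofReal (1 - 3 * δ) ≤ μ {ω | LinBandit.runPulls S T a ω ≤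
            C * LinBandit.pullRate d (LinBandit.attackIndex S θ) δ T₁ T} ∧
          ENNReal.ofReal (1 - 4 * δ) ≤ μ {ω | LinBandit.runCost S θ θ₀ solve T₁ T a η ν ω ≤
            C * (T₁ + LinBandit.pullRate d (LinBandit.attackIndex S θ) δ T₁ T)}) ∧
        -- the choice `T₁ = T ^ (1 / 2)`
        (T₀ ≤ T → T₁ = ⌈Real.sqrt T⌉₊ →
          ENNReal.ofReal (1 - 3 * δ) ≤ μ {ω | LinBandit.runPulls S T a ω ≤
            C * (d / LinBandit.attackIndex S θ) * (T : ℝ) ^ (3 / 4 : ℝ) * Real.log T ^ p} ∧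
          ENNReal.ofReal (1 - 4 * δ) ≤ μ {ω | LinBandit.runCost S θ θ₀ solve T₁ T a η ν ω ≤
            C * (d / LinBandit.attackIndex S θ) * (T : ℝ) ^ (3 / 4 : ℝ) * Real.log T ^ p})) := by
  have hC₁ := LinBandit.pullConst_pos hR hlam
  have hC₂ : 0 < LinBandit.costConst R lam := by unfold LinBandit.costConst; positivity
  have hC₁₂ : LinBandit.pullConst R lam ≤ LinBandit.costConst R lam := by
    unfold LinBandit.costConst; nlinarith
  -- The factor 18 and the power 2 come from the choice T₁ = ⌈√T⌉; the cost constant dominates the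
  -- pull constant.
  refine ⟨18 * LinBandit.costConst R lam, 2, by positivity, fun d S θ hθ δ hδ hδ1 => ?_⟩
  have hL : 0 ≤ Real.log (1 / (δ / 4)) :=
    Real.log_nonneg (by rw [le_div_iff₀ (by positivity)]; linarith)
  obtain ⟨n₁, hn₁⟩ := LinBandit.exists_negative_verdict S hR hlam hδ hδ1 hθ
    (Real.log (1 / (δ / 4))) (R * Real.sqrt (2 * Real.log (1 / (δ / 8)))) hL
  obtain ⟨n₂, hn₂⟩ := LinBandit.exists_positive_bounds S (θ := θ) hR hlam hδ hδ1
  obtain ⟨n₃, hn₃⟩ : ∃ n₃ : ℕ, 0 < LinBandit.attackIndex S θ → ∀ T ≥ n₃, ∀ T₁ : ℕ, T₁ ≤ T →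
      T₁ = ⌈Real.sqrt T⌉₊ → T₁ + LinBandit.pullRate d (LinBandit.attackIndex S θ) δ T₁ T ≤
        18 * ((d / LinBandit.attackIndex S θ) * (T : ℝ) ^ (3 / 4 : ℝ) * Real.log T ^ 2) := by
    by_cases h : 0 < LinBandit.attackIndex S θ
    · obtain ⟨n₃, hn₃⟩ := LinBandit.exists_rate_sqrt_le S.dim_pos hδ hδ1 h
        (LinBandit.index_le_two S _)
      exact ⟨n₃, fun _ => hn₃⟩
    · exact ⟨0, fun h' => absurd h' h⟩
  set m := max (max n₁ n₂) 1 with hm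
  have hm1 : 1 ≤ m := le_max_right _ _
  -- The square serves the last claim, where T ≥ m² ensures ⌈√T⌉ ≥ m.
  refine ⟨max (m ^ 2) n₃, fun T₁ T hT Ω m0 μ hμ ℱ θ₀ solve a η ν hrun => ?_⟩
  have hmm : m ≤ max (m ^ 2) n₃ := (Nat.le_self_pow two_ne_zero m).trans (le_max_left _ _)
  -- probabilities for a long first stage
  have hverdict : ∀ A : Set Ω, m ≤ T₁ → (∀ ω, LinBandit.GoodOutcome S θ θ₀ solve R lam δ
      (Real.log (1 / (δ / 4))) (R * Real.sqrt (2 * Real.log (1 / (δ / 8)))) T₁ T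
      (fun s => a s ω) (fun s => η s ω) (fun s => ν s ω) → ω ∈ A) →
      ENNReal.ofReal (1 - δ) ≤ μ A := by
    intro A hT₁ hA
    refine LinBandit.ofReal_one_sub_le ?_ hδ.le
    have h1 := hrun.measure_not_goodOutcome_le hlam hR hδ hδ1 hθ hT (by omega)
    refine (MeasureTheory.measure_mono ?_).trans
      (h1.trans (ENNReal.ofReal_le_ofReal (by linarith)))
    intro ω hω hg
    exact hω (hA ω hg)
  have hcost : ∀ A : Set Ω, m ≤ T₁ → (∀ ω, LinBandit.GoodOutcome S θ θ₀ solve R lam δ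
      (Real.log (1 / (δ / 4))) (R * Real.sqrt (2 * Real.log (1 / (δ / 8)))) T₁ T
      (fun s => a s ω) (fun s => η s ω) (fun s => ν s ω) →
      LinBandit.CostNoiseBounded S R δ T₁ T (fun s => a s ω) (fun s => η s ω) →
      LinBandit.CostNoiseBounded S R δ T₁ T (fun s => a s ω) (fun s => ν s ω) → ω ∈ A) →
      ENNReal.ofReal (1 - δ) ≤ μ A := by
    intro A hT₁ hA
    refine LinBandit.ofReal_one_sub_le ?_ hδ.le
    have h1 := hrun.measure_not_goodOutcome_le hlam hR hδ hδ1 hθ hT (by omega)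
    have h2 := hrun.measure_not_costNoise_le hR hδ hrun.noise_meas hrun.noise_subG
    have h3 := hrun.measure_not_costNoise_le hR hδ hrun.advNoise_meas hrun.advNoise_subG
    refine le_trans (MeasureTheory.measure_mono ?_) ((MeasureTheory.measure_union_le _ _).trans
      ((add_le_add ((MeasureTheory.measure_union_le _ _).trans (add_le_add h1 h2)) h3).trans ?_))
    · intro ω hω
      by_contra hn
      simp only [Set.mem_union, Set.mem_ofPred_eq, not_or, not_not] at hn
      exact hω (hA ω hn.1.1 hn.1.2 hn.2)
    · rw [← ENNReal.ofReal_add (by positivity) (by positivity),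
        ← ENNReal.ofReal_add (by positivity) (by positivity)]
      exact ENNReal.ofReal_le_ofReal (by linarith)
  -- The free upper bounds `b` and `b'` let one argument yield both the general rate and the
  -- explicit rate for T₁ = ⌈√T⌉.
  have hpulls : m ≤ T₁ → 0 < LinBandit.attackIndex S θ → ‖LinBandit.parPart S θ‖ < 1 →
      ∀ b : ℝ, LinBandit.costConst R lam *
        (T₁ + LinBandit.pullRate d (LinBandit.attackIndex S θ) δ T₁ T) ≤ b →
      ∀ b' : ℝ, LinBandit.costConst R lam *
        LinBandit.pullRate d (LinBandit.attackIndex S θ) δ T₁ T ≤ b' →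
      ENNReal.ofReal (1 - 3 * δ) ≤ μ {ω | LinBandit.runPulls S T a ω ≤ b'} ∧
      ENNReal.ofReal (1 - 4 * δ) ≤ μ {ω | LinBandit.runCost S θ θ₀ solve T₁ T a η ν ω ≤ b} := by
    intro hT₁ hpos hpar b hb b' hb'
    have hm₂ : n₂ ≤ T₁ := ((le_max_right _ _).trans (le_max_left _ _)).trans hT₁
    have hr := LinBandit.pullRate_nonneg (d := d) hpos hδ hδ1 (show 0 < T₁ by omega) T
    -- For δ ≥ 1/3 both claimed probabilities are at most 0. Otherwise the bounds already hold with
    -- probability 1 − δ.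
    rcases le_or_gt (1 / 3) δ with h3 | h3
    · rw [ENNReal.ofReal_of_nonpos (by linarith), ENNReal.ofReal_of_nonpos (by linarith)]
      exact ⟨zero_le, zero_le⟩
    · constructor
      · refine (ENNReal.ofReal_le_ofReal (by linarith)).trans (hverdict _ hT₁ fun ω hg => ?_)
        have := ((hn₂ T₁ hm₂ hpos hpar T θ₀ solve _ _ _ hg).2 h3).1
        exact this.trans ((mul_le_mul_of_nonneg_right hC₁₂ hr).trans hb')
      · refine (ENNReal.ofReal_le_ofReal (by linarith)).trans (hcost _ hT₁ fun ω hg hη hν => ?_)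
        exact (((hn₂ T₁ hm₂ hpos hpar T θ₀ solve _ _ _ hg).2 h3).2 hη hν).trans hb
  refine ⟨fun hneg hT₁ => hverdict _ (hmm.trans hT₁) fun ω hg => ?_, fun hpos hpar =>
    ⟨fun hT₁ => ⟨hverdict _ (hmm.trans hT₁) fun ω hg => ?_, ?_⟩, fun hT₀ hT₁ => ?_⟩⟩
  · exact hn₁ T₁ (((le_max_left _ _).trans (le_max_left _ _)).trans (hmm.trans hT₁)) hneg
      T θ₀ solve _ _ _ hg
  · exact (hn₂ T₁ (((le_max_right _ _).trans (le_max_left _ _)).trans (hmm.trans hT₁)) hpos hpar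
      T θ₀ solve _ _ _ hg).1
  · have hr := LinBandit.pullRate_nonneg (d := d) hpos hδ hδ1
      (show 0 < T₁ from hm1.trans (hmm.trans hT₁)) T
    have hT₁0 : (0 : ℝ) ≤ T₁ := Nat.cast_nonneg _
    exact hpulls (hmm.trans hT₁) hpos hpar _
      (mul_le_mul_of_nonneg_right (by linarith) (by positivity)) _
      (mul_le_mul_of_nonneg_right (by linarith) hr)
  · have hmT₁ : m ≤ T₁ := by
      have h1 : (m : ℝ) ^ 2 ≤ T := by exact_mod_cast (le_max_left _ _).trans hT₀
      have h2 : (m : ℝ) ≤ T₁ := by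
        rw [hT₁]
        exact (Real.le_sqrt_of_sq_le h1).trans (Nat.le_ceil _)
      exact_mod_cast h2
    have hrate := hn₃ hpos T ((le_max_right _ _).trans hT₀) T₁ hT hT₁
    have hb := mul_le_mul_of_nonneg_left hrate hC₂.le
    have hT₁0 : (0 : ℝ) ≤ T₁ := Nat.cast_nonneg _
    exact hpulls hmT₁ hpos hpar _ (hb.trans (le_of_eq (by ring))) _
      ((mul_le_mul_of_nonneg_left (le_add_of_nonneg_left hT₁0) hC₂.le).trans
        (hb.trans (le_of_eq (by ring))))
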